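/- Let $k$ be an algebraically closed field (of any characteristic) and let $n\ge 2$. Let $Q_n$ be the quiver with vertices $e_{i,u}$, $(i,u)\in\mathbb Z/n\times\mathbb Z/n$, and with arrows $a_{i,u}\colon e_{i,u}\to e_{i-1,u}$ for $u\neq i-1$ and $b_{i,u}\colon e_{i,u}\to e_{i,u-1}$ for $u\ne i$. Let $\Gamma_{\Lambda_n}$ (the Auslander algebra of the Taft algebra $\Lambda_n$) be the quotient of the path algebra $kQ_n$, with paths composed from right to left, by the two-sided ideal generated by the mesh relations $a_{i,i-2}\,b_{i,i-1}=0$ for all $i\in\mathbb Z/n$, and $a_{i,u-1}\,b_{i,u}+b_{i-1,u}\,a_{i,u}=0$ for all $i,u\in\mathbb Z/n$ with $u\ne i$ and $u\neq i-1$. Let $kQ_0$ be the $k$-vector space with basis the vertices of $Q_n$, let $\mathrm{HH}_*$ denote the Hochschild homology over $k$ of an algebra with coefficients in itself, and let $\mathrm{HC}_*$ denote cyclic homology over $k$, that is, the homology of the total complex of the cyclic bicomplex. Then: 1. $\mathrm{HH}_0(\Gamma_{\Lambda_n})=kQ_0\cong k^{n^2}$, in the sense that the classes of the vertices $e_{i,u}$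 form a basis of $\mathrm{HH}_0(\Gamma_{\Lambda_n})$, and $\mathrm{HH}_p(\Gamma_{\Lambda_n})=0$ for all $p>0$. 2. $\mathrm{HC}_{2p}(\Gamma_{\Lambda_n})\cong kQ_0\cong k^{n^2}$ and $\mathrm{HC}_{2p+1}(\Gamma_{\Lambda_n})=0$ for all $p\ge 0$. -/

import Mathlib

/-! ### The path algebra of a quiver -/

namespace TaftAuslander

/-- The underlying module of the path algebra `kQ` of a quiver `Q` with vertex set `V`:
the free `k`-module on all (possibly trivial) paths of `Q`. -/
def PathAlgebra (k V : Type*) [Quiver V] [CommRing k] : Type _ :=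
  (Σ x y : V, Quiver.Path x y) →₀ k

namespace PathAlgebra

section

variable {k V : Type*} [Quiver V] [CommRing k]

noncomputable instance : AddCommGroup (PathAlgebra k V) :=
  inferInstanceAs (AddCommGroup ((Σ x y : V, Quiver.Path x y) →₀ k))

noncomputable instance : Module k (PathAlgebra k V) :=
  inferInstanceAs (Module k ((Σ x y : V, Quiver.Path x y) →₀ k))

/-- The basis element of the path algebra given by a path from `x` to `y`. -/
noncomputable def ofPath (k : Type*) [CommRing k] {x y : V} (p : Quiver.Path x y) :
    PathAlgebra k V :=
  Finsupp.single (⟨x, y, p⟩ : Σ x y : V, Quiver.Path x y) (1 : k)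

theorem induction {P : PathAlgebra k V → Prop} (h0 : P 0)
    (hadd : ∀ f g, P f → P g → P (f + g)) (hsmul : ∀ (c : k) f, P f → P (c • f))
    (hpath : ∀ (x y : V) (p : Quiver.Path x y), P (ofPath k p)) (f : PathAlgebra k V) : P f := by
  refine Finsupp.induction_linear (motive := P) f h0 hadd ?_
  rintro ⟨x, y, p⟩ c
  have h := hsmul c _ (hpath x y p)
  have e : c • ofPath k p = Finsupp.single (⟨x, y, p⟩ : Σ x y : V, Quiver.Path x y) c :=
    (Finsupp.smul_single _ _ _).trans (by simp)
  exact e ▸ h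

variable [DecidableEq V]

/-- The product of two paths, composed from right to left: `p * q` is "first `q`, then `p`" if
`q` ends where `p` starts, and `0` otherwise. -/
noncomputable def pathMul (k : Type*) [CommRing k] (p q : Σ x y : V, Quiver.Path x y) :
    PathAlgebra k V :=
  if h : q.2.1 = p.1 then ofPath k ((q.2.2.cast rfl h).comp p.2.2) else 0

/-- The `k`-bilinear extension of the product of paths. -/
noncomputable def mulLin : PathAlgebra k V →ₗ[k] PathAlgebra k V →ₗ[k] PathAlgebra k V :=
  Finsupp.linearCombination k (fun p => Finsupp.linearCombination k (fun q => pathMul k p q))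

theorem mulLin_ofPath {x y y' z : V} (p : Quiver.Path y' z) (q : Quiver.Path x y) :
    mulLin (ofPath k p) (ofPath k q) = pathMul k ⟨y', z, p⟩ ⟨x, y, q⟩ := by
  have h1 : mulLin (ofPath k p) =
      Finsupp.linearCombination k (fun q => pathMul k ⟨y', z, p⟩ q) :=
    (Finsupp.linearCombination_single k (1 : k) _).trans (one_smul _ _)
  rw [h1]
  exact (Finsupp.linearCombination_single k (1 : k) _).trans (one_smul _ _)

theorem mulLin_ofPath_comp {x y z : V} (p : Quiver.Path y z) (q : Quiver.Path x y) :
    mulLin (ofPath k p) (ofPath k q) = ofPath k (q.comp p) := by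
  rw [mulLin_ofPath]
  simp [pathMul]

theorem mulLin_ofPath_ne {x y y' z : V} (p : Quiver.Path y' z) (q : Quiver.Path x y)
    (h : y ≠ y') : mulLin (ofPath k p) (ofPath k q) = 0 := by
  rw [mulLin_ofPath]
  simp [pathMul, h]

theorem mulLin_assoc (f g h : PathAlgebra k V) :
    mulLin (mulLin f g) h = mulLin f (mulLin g h) := by
  induction f using PathAlgebra.induction with
  | h0 => simp
  | hadd f f' hf hf' => simp [hf, hf']
  | hsmul c f hf => simp [hf]
  | hpath y z p =>
  induction g using PathAlgebra.induction with
  | h0 => simp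
  | hadd f f' hf hf' => simp [hf, hf']
  | hsmul c f hf => simp [hf]
  | hpath x y' q =>
  induction h using PathAlgebra.induction with
  | h0 => simp
  | hadd f f' hf hf' => simp [hf, hf']
  | hsmul c f hf => simp [hf]
  | hpath w x' r =>
  by_cases h1 : y' = y
  · subst h1
    by_cases h2 : x' = x
    · subst h2
      simp [mulLin_ofPath_comp]
    · rw [mulLin_ofPath_comp, mulLin_ofPath_ne _ _ h2, mulLin_ofPath_ne _ _ h2, map_zero]
  · by_cases h2 : x' = x
    · subst h2
      rw [mulLin_ofPath_comp, mulLin_ofPath_ne _ _ h1, mulLin_ofPath_ne _ _ h1, map_zero]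
      rfl
    · rw [mulLin_ofPath_ne _ _ h1, mulLin_ofPath_ne _ _ h2, map_zero, map_zero]
      rfl

variable [Fintype V]

theorem sum_nil_mulLin (f : PathAlgebra k V) :
    mulLin (∑ x : V, ofPath k (Quiver.Path.nil : Quiver.Path x x)) f = f := by
  induction f using PathAlgebra.induction with
  | h0 => simp
  | hadd f f' hf hf' => rw [map_add, hf, hf']
  | hsmul c f hf => rw [map_smul, hf]
  | hpath x y p =>
    rw [map_sum, LinearMap.sum_apply, Finset.sum_eq_single y]
    · rw [mulLin_ofPath_comp, Quiver.Path.comp_nil]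
    · intro z _ hz
      exact mulLin_ofPath_ne _ _ hz.symm
    · simp

theorem mulLin_sum_nil (f : PathAlgebra k V) :
    mulLin f (∑ x : V, ofPath k (Quiver.Path.nil : Quiver.Path x x)) = f := by
  induction f using PathAlgebra.induction with
  | h0 => simp
  | hadd f f' hf hf' => rw [map_add, LinearMap.add_apply, hf, hf']
  | hsmul c f hf => rw [map_smul, LinearMap.smul_apply, hf]
  | hpath x y p =>
    rw [map_sum, Finset.sum_eq_single x]
    · rw [mulLin_ofPath_comp, Quiver.Path.nil_comp]
    · intro z _ hz
      exact mulLin_ofPath_ne _ _ hz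
    · simp

/-- The ring structure of the path algebra of a quiver with finitely many vertices; its unit is
the sum of the trivial paths. -/
noncomputable instance : Ring (PathAlgebra k V) :=
  { (inferInstance : AddCommGroup (PathAlgebra k V)) with
    mul := fun f g => mulLin f g
    one := ∑ x : V, ofPath k (Quiver.Path.nil : Quiver.Path x x)
    mul_assoc := mulLin_assoc
    one_mul := sum_nil_mulLin
    mul_one := mulLin_sum_nil
    zero_mul := fun f => by
      change mulLin 0 f = 0
      simp
    mul_zero := fun f => by
      change mulLin f 0 = 0
      simp
    left_distrib := fun f g h => map_add (mulLin f) g h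
    right_distrib := fun f g h => by
      change mulLin (f + g) h = mulLin f h + mulLin g h
      simp }

noncomputable instance : Algebra k (PathAlgebra k V) :=
  Algebra.ofModule
    (fun c f g => by
      change mulLin (c • f) g = c • mulLin f g
      simp)
    (fun c f g => map_smul (mulLin f) c g)

end

end PathAlgebra

/-! ### The cylinder quiver and the Auslander algebra of the Taft algebra -/

/-- The vertices `e_{i,u}` of the quiver `Q_n`. -/
def Vertex (n : ℕ) : Type := ZMod n × ZMod n

instance (n : ℕ) : DecidableEq (Vertex n) := inferInstanceAs (DecidableEq (ZMod n × ZMod n))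

instance (n : ℕ) [NeZero n] : Fintype (Vertex n) := inferInstanceAs (Fintype (ZMod n × ZMod n))

/-- The arrows of the quiver `Q_n`: arrows `a_{i,u} : (i,u) ⟶ (i-1,u)` for `u ≠ i - 1`, and arrows
`b_{i,u} : (i,u) ⟶ (i,u-1)` for `u ≠ i`.  The vertices `(i,i)` and the vertices `(i,i-1)` lie on the
two boundary circles of the cylinder, and no arrow joins the two circles around the outside. -/
inductive Arrow (n : ℕ) : Vertex n → Vertex n → Type
  | a (i u : ZMod n) (h : u ≠ i - 1) : Arrow n (i, u) (i - 1, u)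
  | b (i u : ZMod n) (h : u ≠ i) : Arrow n (i, u) (i, u - 1)

instance (n : ℕ) : Quiver (Vertex n) := ⟨Arrow n⟩

section

variable (k : Type*) [CommRing k] (n : ℕ)

/-- The arrow `a_{i,u}` as an element of `kQ_n`; it is read as `0` if `u = i - 1`, where `Q_n` has
no such arrow. -/
noncomputable def arrowA (i u : ZMod n) : PathAlgebra k (Vertex n) :=
  if h : u ≠ i - 1 then
    PathAlgebra.ofPath k (Quiver.Hom.toPath (V := Vertex n) (Arrow.a i u h)) else 0

/-- The arrow `b_{i,u}` as an element of `kQ_n`; it is read as `0` if `u = i`, where `Q_n` has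
no such arrow. -/
noncomputable def arrowB (i u : ZMod n) : PathAlgebra k (Vertex n) :=
  if h : u ≠ i then
    PathAlgebra.ofPath k (Quiver.Hom.toPath (V := Vertex n) (Arrow.b i u h)) else 0

variable [NeZero n]

/-- The mesh relations: the paths `a_{i,i-2} b_{i,i-1}` along the boundary circle of the vertices
`(i,i-1)` vanish, and every square of the quiver (the four arrows involved all exist exactly if
`u ≠ i` and `u ≠ i - 1`) anticommutes. -/
def meshRelations : Set (PathAlgebra k (Vertex n)) :=
  {r | ∃ i : ZMod n, r = arrowA k n i (i - 2) * arrowB k n i (i - 1)} ∪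
  {r | ∃ i u : ZMod n, u ≠ i ∧ u ≠ i - 1 ∧
    r = arrowA k n i (u - 1) * arrowB k n i u + arrowB k n (i - 1) u * arrowA k n i u}

/-- The congruence on `kQ_n` of the two-sided ideal generated by the mesh relations. -/
noncomputable def meshCon : RingCon (PathAlgebra k (Vertex n)) :=
  (TwoSidedIdeal.span (meshRelations k n)).ringCon

/-- The Auslander algebra of the Taft algebra: the quotient of the path algebra `kQ_n` by the
two-sided ideal generated by the mesh relations. -/
def AuslanderTaft : Type _ := (meshCon k n).Quotient

noncomputable instance : Ring (AuslanderTaft k n) :=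
  inferInstanceAs (Ring (meshCon k n).Quotient)

noncomputable instance : Algebra k (AuslanderTaft k n) :=
  inferInstanceAs (Algebra k (meshCon k n).Quotient)

/-- The idempotent of the Auslander algebra at the vertex `x` of `Q_n`. -/
noncomputable def vertexIdem (x : Vertex n) : AuslanderTaft k n :=
  (meshCon k n).mk' (PathAlgebra.ofPath k (Quiver.Path.nil : Quiver.Path x x))

end

/-! ### Hochschild and cyclic homology of an algebra -/

section

variable (k : Type*) [CommRing k] (A : Type*) [Ring A] [Algebra k A]

/-- The module `A^{⊗(m+1)}` of Hochschild `m`-chains. -/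
abbrev Chains (m : ℕ) : Type _ := PiTensorProduct k (fun _ : Fin (m + 1) => A)

theorem exists_contractNth_update (m : ℕ) (i : Fin (m + 1)) (c : Fin (m + 2) → A)
    (l : Fin (m + 2)) : ∃ (j : Fin (m + 1)) (g : A →ₗ[k] A), ∀ x : A,
      Fin.contractNth i.castSucc (fun x y : A => x * y) (Function.update c l x) =
        Function.update (Fin.contractNth i.castSucc (fun x y : A => x * y) c) j (g x) := by
  rcases lt_trichotomy (l : ℕ) (i : ℕ) with h | h | h
  · refine ⟨⟨l, by omega⟩, LinearMap.id, fun x => funext fun a => ?_⟩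
    simp only [Fin.contractNth, Function.update_apply, Fin.ext_iff, Fin.val_castSucc, Fin.val_succ,
      LinearMap.id_apply]
    split_ifs <;> first | rfl | omega
  · refine ⟨i, LinearMap.mulRight k (c i.succ), fun x => funext fun a => ?_⟩
    simp only [Fin.contractNth, Function.update_apply, Fin.ext_iff, Fin.val_castSucc, Fin.val_succ,
      LinearMap.mulRight_apply]
    split_ifs with h1 h2 h3 h4 h5 h6 h7 <;> first | rfl | omega | skip
    all_goals (obtain rfl : a = i := Fin.ext (by omega); rfl)
  · rcases Nat.eq_or_lt_of_le (Nat.succ_le_of_lt h) with h' | h'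
    · refine ⟨i, LinearMap.mulLeft k (c i.castSucc), fun x => funext fun a => ?_⟩
      simp only [Fin.contractNth, Function.update_apply, Fin.ext_iff, Fin.val_castSucc,
        Fin.val_succ, LinearMap.mulLeft_apply]
      split_ifs with h1 h2 h3 h4 h5 h6 h7 <;> first | rfl | omega | skip
      all_goals (obtain rfl : a = i := Fin.ext (by omega); rfl)
    · refine ⟨⟨l - 1, by omega⟩, LinearMap.id, fun x => funext fun a => ?_⟩
      simp only [Fin.contractNth, Function.update_apply, Fin.ext_iff, Fin.val_castSucc,
        Fin.val_succ, LinearMap.id_apply]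
      split_ifs <;> first | rfl | omega

/-- The multilinear map `(a_0, …, a_{m+1}) ↦ a_0 ⊗ ⋯ ⊗ a_i a_{i+1} ⊗ ⋯ ⊗ a_{m+1}`. -/
noncomputable def faceMultilinear (m : ℕ) (i : Fin (m + 1)) :
    MultilinearMap k (fun _ : Fin (m + 2) => A) (Chains k A m) :=
  MultilinearMap.mk'
    (fun c => PiTensorProduct.tprod k (Fin.contractNth i.castSucc (fun x y : A => x * y) c))
    (fun c l x y => by
      obtain ⟨j, g, hg⟩ := exists_contractNth_update k A m i c l
      simp only [hg, map_add, MultilinearMap.map_update_add])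
    (fun c l r x => by
      obtain ⟨j, g, hg⟩ := exists_contractNth_update k A m i c l
      simp only [hg, map_smul, MultilinearMap.map_update_smul])

/-- The inner face `a_0 ⊗ ⋯ ⊗ a_{m+1} ↦ a_0 ⊗ ⋯ ⊗ a_i a_{i+1} ⊗ ⋯ ⊗ a_{m+1}`, `0 ≤ i ≤ m`. -/
noncomputable def face (m : ℕ) (i : Fin (m + 1)) : Chains k A (m + 1) →ₗ[k] Chains k A m :=
  PiTensorProduct.lift (faceMultilinear k A m i)

/-- The unsigned cyclic rotation `a_0 ⊗ ⋯ ⊗ a_m ↦ a_m ⊗ a_0 ⊗ ⋯ ⊗ a_{m-1}`. -/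
noncomputable def rotation (m : ℕ) : Chains k A m →ₗ[k] Chains k A m :=
  (PiTensorProduct.reindex k (fun _ : Fin (m + 1) => A) (finRotate (m + 1))).toLinearMap

/-- The cyclic operator `t`, `a_0 ⊗ ⋯ ⊗ a_m ↦ (-1)^m a_m ⊗ a_0 ⊗ ⋯ ⊗ a_{m-1}`. -/
noncomputable def cyclicT (m : ℕ) : Chains k A m →ₗ[k] Chains k A m :=
  (-1 : k) ^ m • rotation k A m

/-- The norm operator `N = 1 + t + ⋯ + t^m` on `A^{⊗(m+1)}`. -/
noncomputable def cyclicN (m : ℕ) : Chains k A m →ₗ[k] Chains k A m :=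
  ∑ j ∈ Finset.range (m + 1), cyclicT k A m ^ j

/-- The bar differential `b'`, the alternating sum of the inner faces. -/
noncomputable def barB (m : ℕ) : Chains k A (m + 1) →ₗ[k] Chains k A m :=
  ∑ i : Fin (m + 1), (-1 : k) ^ (i : ℕ) • face k A m i

/-- The Hochschild differential `b`: the sum of `b'` and of the last, cyclic, face
`(-1)^{m+1} a_{m+1} a_0 ⊗ a_1 ⊗ ⋯ ⊗ a_m`. -/
noncomputable def hochschildB (m : ℕ) : Chains k A (m + 1) →ₗ[k] Chains k A m :=
  barB k A m + (-1 : k) ^ (m + 1) • (face k A m 0 ∘ₗ rotation k A (m + 1))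

/-- Hochschild `m`-cycles. -/
noncomputable def hochschildCycles : (m : ℕ) → Submodule k (Chains k A m)
  | 0 => ⊤
  | m + 1 => LinearMap.ker (hochschildB k A m)

/-- The Hochschild homology `HH_m(A)` of the `k`-algebra `A` with coefficients in `A`: cycles modulo
boundaries of the Hochschild complex. -/
abbrev HochschildHomology (m : ℕ) : Type _ :=
  hochschildCycles k A m ⧸
    (LinearMap.range (hochschildB k A m)).submoduleOf (hochschildCycles k A m)

/-- The class in `HH_0(A)` of an element of `A`. -/
noncomputable def hochschildClassZero (x : A) : HochschildHomology k A 0 :=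
  Submodule.Quotient.mk ⟨PiTensorProduct.tprod k (fun _ : Fin 1 => x), Submodule.mem_top⟩

/-- Degree `m` of the total complex of the cyclic bicomplex `CC(A)`, whose entry in column `p` and
row `q` is `A^{⊗(q+1)}`: the sum over `p + q = m`, indexed by the row `q`. -/
abbrev CyclicTot (m : ℕ) : Type _ := (q : Fin (m + 1)) → Chains k A q

/-- The differential of the total complex of `CC(A)`.  The columns with `p` even carry `b`, those
with `p` odd carry `-b'`; the horizontal maps are `1 - t` from odd to even columns and `N` from
even to odd columns.  The component of the differential at row `q`, column `p = m - q`, comes from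
row `q + 1` in the same column and from row `q` in the column `p + 1`. -/
noncomputable def cyclicTotD (m : ℕ) : CyclicTot k A (m + 1) →ₗ[k] CyclicTot k A m :=
  LinearMap.pi fun q : Fin (m + 1) =>
    if Even (m - (q : ℕ)) then
      hochschildB k A q ∘ₗ LinearMap.proj (R := k) (φ := fun q : Fin (m + 2) => Chains k A q) q.succ
        + (LinearMap.id - cyclicT k A q) ∘ₗ
          LinearMap.proj (R := k) (φ := fun q : Fin (m + 2) => Chains k A q) q.castSucc
    else
      -(barB k A q ∘ₗ LinearMap.proj (R := k) (φ := fun q : Fin (m + 2) => Chains k A q) q.succ)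
        + cyclicN k A q ∘ₗ
          LinearMap.proj (R := k) (φ := fun q : Fin (m + 2) => Chains k A q) q.castSucc

/-- Cycles of degree `m` of the total complex of `CC(A)`. -/
noncomputable def cyclicCycles : (m : ℕ) → Submodule k (CyclicTot k A m)
  | 0 => ⊤
  | m + 1 => LinearMap.ker (cyclicTotD k A m)

/-- The cyclic homology `HC_m(A)` of the `k`-algebra `A`: the homology of the total complex of the
cyclic bicomplex, cycles modulo boundaries. -/
abbrev CyclicHomology (m : ℕ) : Type _ :=
  cyclicCycles k A m ⧸ (LinearMap.range (cyclicTotD k A m)).submoduleOf (cyclicCycles k A m)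

end

end TaftAuslander

/-!
Write `A` for the Auslander algebra. It has a basis of monomials `b^t a^s e_{i,u}`, detected by its
action on ladder modules. Filter `A` by the ideals generated by the powers `a^s e_{i,u}`, ordered by
a weight that right multiplication by an arrow increases. Each layer is generated by one element
`v = a^s e_{i,u}`, on which `A` acts from the right through the character `χ` of the vertex
`(i, u)`, and as a left module it has a resolution `0 → A p' → A p → A v → 0` with idempotents
`p = e_{i-s,u}` and `p' = e_{i-s-1,u}` (or `p' = 0`), the first map being right multiplication by
an arrow `a`. Hochschild homology with coefficients in a left module `A p` with right action `χ` is
concentrated in degree `0`, and vanishes altogether if `χ p = 0`. Since `χ p' = 0`, no layer has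
homology in positive degrees, and hence neither does `A`.

In degree `0`, a monomial whose endpoints differ is a commutator, and the augmentation onto the
semisimple quotient separates the vertices.

For cyclic homology, the odd columns of the bicomplex are the exact bar complexes, so if the
Hochschild homology vanishes in positive degrees then forgetting the first two columns gives an
isomorphism `HC_{m+2} ≅ HC_m`, and `HC_1 = 0`.
-/

namespace TaftAuslander

open scoped TensorProduct

universe u v

/-! ### Hochschild chains with coefficients -/

/-- An `A`-bimodule structure on a `k`-module `M`, unbundled as a pair of commuting actions so that
one module can carry several structures. -/
structure BimoduleAction (k : Type v) (A M : Type u) [CommRing k] [Ring A] [Algebra k A]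
    [AddCommGroup M] [Module k M] where
  left : A →ₗ[k] M →ₗ[k] M
  right : A →ₗ[k] M →ₗ[k] M
  left_mul : ∀ a b x, left (a * b) x = left a (left b x)
  right_mul : ∀ a b x, right (a * b) x = right b (right a x)
  left_right_comm : ∀ a b x, left a (right b x) = right b (left a x)

section CoeffChains

variable (k : Type v) (A M : Type u) [CommRing k] [Ring A] [Algebra k A]
  [AddCommGroup M] [Module k M]

/-- The modules `M ⊗ A^{⊗m}`, bundled in order to define type and module structure in a single
recursion. -/
noncomputable def coeffModule : ℕ → ModuleCat.{u} k
  | 0 => ModuleCat.of k M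
  | m + 1 => ModuleCat.of k (coeffModule m ⊗[k] A)

/-- The module `M ⊗ A^{⊗m}` of Hochschild `m`-chains with coefficients in `M`, bracketed as
`(⋯((M ⊗ A) ⊗ A)⋯) ⊗ A`. -/
def CoeffChains (m : ℕ) : Type u := coeffModule k A M m

noncomputable instance (m : ℕ) : AddCommGroup (CoeffChains k A M m) :=
  inferInstanceAs (AddCommGroup (coeffModule k A M m))

noncomputable instance (m : ℕ) : Module k (CoeffChains k A M m) :=
  inferInstanceAs (Module k (coeffModule k A M m))

namespace CoeffChains

/-- Chains of degree `0` are coefficients. -/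
noncomputable def zeroEquiv : M ≃ₗ[k] CoeffChains k A M 0 := LinearEquiv.refl k M

/-- Chains of degree `m + 1` arise from those of degree `m` by one more tensor factor. -/
noncomputable def succEquiv (m : ℕ) : CoeffChains k A M m ⊗[k] A ≃ₗ[k] CoeffChains k A M (m + 1) :=
  LinearEquiv.refl k (CoeffChains k A M m ⊗[k] A)

variable {k A M}

/-- The chain `x ⊗ a`. -/
noncomputable def snoc {m : ℕ} : CoeffChains k A M m →ₗ[k] A →ₗ[k] CoeffChains k A M (m + 1) :=
  (TensorProduct.mk k (CoeffChains k A M m) A).compr₂ (succEquiv k A M m).toLinearMap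

@[simp] theorem succEquiv_tmul {m : ℕ} (x : CoeffChains k A M m) (a : A) :
    succEquiv k A M m (x ⊗ₜ[k] a) = snoc x a := rfl

@[simp] theorem succEquiv_symm_snoc {m : ℕ} (x : CoeffChains k A M m) (a : A) :
    (succEquiv k A M m).symm (snoc x a) = x ⊗ₜ[k] a := rfl

theorem induction_snoc {m : ℕ} {P : CoeffChains k A M (m + 1) → Prop}
    (snoc : ∀ x a, P (snoc x a)) (add : ∀ x y, P x → P y → P (x + y))
    (x : CoeffChains k A M (m + 1)) : P x := by
  obtain ⟨y, rfl⟩ := (succEquiv k A M m).surjective x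
  induction y using TensorProduct.induction_on with
  | zero => simpa using snoc 0 0
  | tmul x a => exact snoc x a
  | add y z hy hz => simpa using add _ _ hy hz

theorem induction_zeroEquiv {P : CoeffChains k A M 0 → Prop}
    (zeroEquiv : ∀ x, P (zeroEquiv k A M x)) (x : CoeffChains k A M 0) : P x := zeroEquiv x

/-- The linear map on chains of degree `m + 1` induced by a bilinear map. -/
noncomputable def lift {P : Type*} [AddCommGroup P] [Module k P] {m : ℕ}
    (f : CoeffChains k A M m →ₗ[k] A →ₗ[k] P) : CoeffChains k A M (m + 1) →ₗ[k] P :=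
  TensorProduct.lift f ∘ₗ (succEquiv k A M m).symm.toLinearMap

@[simp] theorem lift_snoc {P : Type*} [AddCommGroup P] [Module k P] {m : ℕ}
    (f : CoeffChains k A M m →ₗ[k] A →ₗ[k] P) (x : CoeffChains k A M m) (a : A) :
    lift f (snoc x a) = f x a := by
  simp [lift]

@[simp] theorem lift_succEquiv {P : Type*} [AddCommGroup P] [Module k P] {m : ℕ}
    (f : CoeffChains k A M m →ₗ[k] A →ₗ[k] P) (y : CoeffChains k A M m ⊗[k] A) :
    lift f (succEquiv k A M m y) = TensorProduct.lift f y := by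
  simp [lift]

variable (B : BimoduleAction k A M)

/-- Right multiplication on the last tensor factor. -/
noncomputable def rmul :
    (m : ℕ) → CoeffChains k A M m →ₗ[k] A →ₗ[k] CoeffChains k A M m
  | 0 => B.right.flip.compr₂ (zeroEquiv k A M).toLinearMap ∘ₗ (zeroEquiv k A M).symm.toLinearMap
  | _ + 1 => lift (LinearMap.mk₂ k (fun x c => snoc x ∘ₗ LinearMap.mul k A c)
      (fun x y c => by simp [LinearMap.add_comp]) (fun s x c => by simp [LinearMap.smul_comp])
      (fun x c d => by simp [LinearMap.comp_add]) (fun s x c => by simp [LinearMap.comp_smul]))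

/-- Left multiplication on the coefficients. -/
noncomputable def lmul :
    (m : ℕ) → CoeffChains k A M m →ₗ[k] A →ₗ[k] CoeffChains k A M m
  | 0 => B.left.flip.compr₂ (zeroEquiv k A M).toLinearMap ∘ₗ (zeroEquiv k A M).symm.toLinearMap
  | m + 1 => lift (LinearMap.mk₂ k (fun x c => snoc.flip c ∘ₗ lmul m x)
      (fun x y c => by simp [LinearMap.comp_add]) (fun s x c => by simp [LinearMap.comp_smul])
      (fun x c d => by simp [LinearMap.add_comp]) (fun s x c => by simp [LinearMap.smul_comp]))

@[simp] theorem rmul_zeroEquiv (x : M) (a : A) :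
    rmul B 0 (zeroEquiv k A M x) a = zeroEquiv k A M (B.right a x) := by
  simp [rmul]

@[simp] theorem lmul_zeroEquiv (x : M) (a : A) :
    lmul B 0 (zeroEquiv k A M x) a = zeroEquiv k A M (B.left a x) := by
  simp [lmul]

@[simp] theorem rmul_snoc {m : ℕ} (x : CoeffChains k A M m) (c a : A) :
    rmul B (m + 1) (snoc x c) a = snoc x (c * a) := by
  simp [rmul]

@[simp] theorem lmul_snoc {m : ℕ} (x : CoeffChains k A M m) (c a : A) :
    lmul B (m + 1) (snoc x c) a = snoc (lmul B m x a) c := by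
  simp [lmul]

/-- The alternating sum of all faces except the cyclic one. -/
noncomputable def bar : (m : ℕ) → CoeffChains k A M (m + 1) →ₗ[k] CoeffChains k A M m
  | 0 => lift (rmul B 0)
  | m + 1 => lift (snoc ∘ₗ bar m + (-1 : k) ^ (m + 1) • rmul B (m + 1))

/-- The cyclic face `x ⊗ a_1 ⊗ ⋯ ⊗ a_{m+1} ↦ a_{m+1} x ⊗ a_1 ⊗ ⋯ ⊗ a_m`. -/
noncomputable def cyc (m : ℕ) : CoeffChains k A M (m + 1) →ₗ[k] CoeffChains k A M m :=
  lift (lmul B m)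

/-- The Hochschild differential with coefficients in a bimodule. -/
noncomputable def diff (m : ℕ) : CoeffChains k A M (m + 1) →ₗ[k] CoeffChains k A M m :=
  bar B m + (-1 : k) ^ (m + 1) • cyc B m

@[simp] theorem bar_zero_snoc (x : CoeffChains k A M 0) (a : A) :
    bar B 0 (snoc x a) = rmul B 0 x a := by
  simp [bar]

@[simp] theorem bar_succ_snoc {m : ℕ} (x : CoeffChains k A M (m + 1)) (a : A) :
    bar B (m + 1) (snoc x a) = snoc (bar B m x) a + (-1 : k) ^ (m + 1) • rmul B (m + 1) x a := by
  simp [bar]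

@[simp] theorem cyc_snoc {m : ℕ} (x : CoeffChains k A M m) (a : A) :
    cyc B m (snoc x a) = lmul B m x a := by
  simp [cyc]

theorem diff_apply {m : ℕ} (x : CoeffChains k A M (m + 1)) :
    diff B m x = bar B m x + (-1 : k) ^ (m + 1) • cyc B m x := rfl

theorem rmul_mul {m : ℕ} (x : CoeffChains k A M m) (a c : A) :
    rmul B m x (a * c) = rmul B m (rmul B m x a) c := by
  cases m with
  | zero =>
    induction x using induction_zeroEquiv with
    | zeroEquiv x => simp [B.right_mul]
  | succ m =>
    induction x using induction_snoc with
    | snoc x d => simp [mul_assoc]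
    | add x y hx hy => simp only [map_add, LinearMap.add_apply, hx, hy]

theorem lmul_mul {m : ℕ} (x : CoeffChains k A M m) (a c : A) :
    lmul B m x (a * c) = lmul B m (lmul B m x c) a := by
  induction m with
  | zero =>
    induction x using induction_zeroEquiv with
    | zeroEquiv x => simp [B.left_mul]
  | succ m ih =>
    induction x using induction_snoc with
    | snoc x d => simp [ih]
    | add x y hx hy => simp only [map_add, LinearMap.add_apply, hx, hy]

theorem lmul_rmul {m : ℕ} (x : CoeffChains k A M m) (a c : A) :
    lmul B m (rmul B m x a) c = rmul B m (lmul B m x c) a := by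
  cases m with
  | zero =>
    induction x using induction_zeroEquiv with
    | zeroEquiv x => simp [B.left_right_comm]
  | succ m =>
    induction x using induction_snoc with
    | snoc x d => simp
    | add x y hx hy => simp only [map_add, LinearMap.add_apply, hx, hy]

theorem bar_rmul {m : ℕ} (x : CoeffChains k A M (m + 1)) (a : A) :
    bar B m (rmul B (m + 1) x a) = rmul B m (bar B m x) a := by
  induction x using induction_snoc with
  | snoc x c => cases m <;> simp [rmul_mul]
  | add x y hx hy => simp only [map_add, LinearMap.add_apply, hx, hy]

theorem bar_lmul {m : ℕ} (x : CoeffChains k A M (m + 1)) (a : A) :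
    bar B m (lmul B (m + 1) x a) = lmul B m (bar B m x) a := by
  induction m with
  | zero =>
    induction x using induction_snoc with
    | snoc x c => simp [lmul_rmul]
    | add x y hx hy => simp only [map_add, LinearMap.add_apply, hx, hy]
  | succ m ih =>
    induction x using induction_snoc with
    | snoc x c => simp [ih, lmul_rmul]
    | add x y hx hy => simp only [map_add, LinearMap.add_apply, hx, hy]

theorem bar_bar {m : ℕ} (x : CoeffChains k A M (m + 2)) : bar B m (bar B (m + 1) x) = 0 := by
  induction m with
  | zero =>
    induction x using induction_snoc with
    | snoc x a => simp [bar_rmul]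
    | add x y hx hy => simp only [map_add, hx, hy, add_zero]
  | succ m ih =>
    induction x using induction_snoc with
    | snoc x a => simp [bar_rmul, ih, pow_succ]
    | add x y hx hy => simp only [map_add, hx, hy, add_zero]

theorem cyc_rmul {m : ℕ} (x : CoeffChains k A M (m + 1)) (a : A) :
    cyc B m (rmul B (m + 1) x a) = cyc B m (lmul B (m + 1) x a) := by
  induction x using induction_snoc with
  | snoc x c => simp [lmul_mul]
  | add x y hx hy => simp only [map_add, LinearMap.add_apply, hx, hy]

theorem cyc_bar {m : ℕ} (x : CoeffChains k A M (m + 2)) :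
    cyc B m (bar B (m + 1) x) =
      bar B m (cyc B (m + 1) x) - (-1 : k) ^ m • cyc B m (cyc B (m + 1) x) := by
  induction x using induction_snoc with
  | snoc x a => simp [bar_lmul, cyc_rmul, pow_succ, sub_eq_add_neg]
  | add x y hx hy =>
    simp only [map_add, smul_add, hx, hy]
    abel

theorem diff_diff {m : ℕ} (x : CoeffChains k A M (m + 2)) :
    diff B m (diff B (m + 1) x) = 0 := by
  simp only [diff_apply, map_add, map_smul, bar_bar, cyc_bar]
  module

/-- The Hochschild cycles of degree `m` with coefficients in a bimodule. -/
noncomputable def cycles : (m : ℕ) → Submodule k (CoeffChains k A M m)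
  | 0 => ⊤
  | m + 1 => LinearMap.ker (diff B m)

variable {B} in
theorem mem_cycles_succ {m : ℕ} {x : CoeffChains k A M (m + 1)} :
    x ∈ cycles B (m + 1) ↔ diff B m x = 0 := Iff.rfl

/-- The Hochschild homology with coefficients in a bimodule vanishes in degree `m`. -/
def Acyclic (m : ℕ) : Prop := cycles B m ≤ LinearMap.range (diff B m)

end CoeffChains

end CoeffChains

/-! ### Functoriality and exactness in the coefficients -/

section Functoriality

variable {k : Type v} {A M M' M'' X Y : Type u} [CommRing k] [Ring A] [Algebra k A]
  [AddCommGroup M] [Module k M] [AddCommGroup M'] [Module k M'] [AddCommGroup M''] [Module k M'']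
  [AddCommGroup X] [Module k X] [AddCommGroup Y] [Module k Y]

/-- A linear map is compatible with given bimodule structures on its source and target. -/
structure BimoduleAction.IsHom (B : BimoduleAction k A M) (B' : BimoduleAction k A M')
    (f : M →ₗ[k] M') : Prop where
  map_left : ∀ a x, f (B.left a x) = B'.left a (f x)
  map_right : ∀ a x, f (B.right a x) = B'.right a (f x)

namespace CoeffChains

/-- The map induced on chains by a linear map between coefficients. -/
noncomputable def map (f : M →ₗ[k] M') :
    (m : ℕ) → CoeffChains k A M m →ₗ[k] CoeffChains k A M' m
  | 0 => (zeroEquiv k A M').toLinearMap ∘ₗ f ∘ₗ (zeroEquiv k A M).symm.toLinearMap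
  | m + 1 => lift (snoc ∘ₗ map f m)

@[simp] theorem map_zeroEquiv (f : M →ₗ[k] M') (x : M) :
    map f 0 (zeroEquiv k A M x) = zeroEquiv k A M' (f x) := by
  simp [map]

@[simp] theorem map_snoc (f : M →ₗ[k] M') {m : ℕ} (x : CoeffChains k A M m) (a : A) :
    map f (m + 1) (snoc x a) = snoc (map f m x) a := by
  simp [map]

theorem map_succEquiv (f : M →ₗ[k] M') {m : ℕ} (y : CoeffChains k A M m ⊗[k] A) :
    map f (m + 1) (succEquiv k A M m y) = succEquiv k A M' m ((map f m).rTensor A y) := by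
  induction y using TensorProduct.induction_on with
  | zero => simp only [map_zero]
  | tmul x a => simp
  | add y z hy hz => simp only [map_add, hy, hz]

section Naturality

variable {B : BimoduleAction k A M} {B' : BimoduleAction k A M'} {f : M →ₗ[k] M'}
  (hf : B.IsHom B' f)

include hf

theorem map_rmul {m : ℕ} (x : CoeffChains k A M m) (a : A) :
    map f m (rmul B m x a) = rmul B' m (map f m x) a := by
  cases m with
  | zero =>
    induction x using induction_zeroEquiv with
    | zeroEquiv x => simp [hf.map_right]
  | succ m =>
    induction x using induction_snoc with
    | snoc x c => simp
    | add x y hx hy => simp only [map_add, LinearMap.add_apply, hx, hy]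

theorem map_lmul {m : ℕ} (x : CoeffChains k A M m) (a : A) :
    map f m (lmul B m x a) = lmul B' m (map f m x) a := by
  induction m with
  | zero =>
    induction x using induction_zeroEquiv with
    | zeroEquiv x => simp [hf.map_left]
  | succ m ih =>
    induction x using induction_snoc with
    | snoc x c => simp [ih]
    | add x y hx hy => simp only [map_add, LinearMap.add_apply, hx, hy]

theorem map_bar {m : ℕ} (x : CoeffChains k A M (m + 1)) :
    map f m (bar B m x) = bar B' m (map f (m + 1) x) := by
  induction m with
  | zero =>
    induction x using induction_snoc with
    | snoc x c => simp [map_rmul hf]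
    | add x y hx hy => simp only [map_add, hx, hy]
  | succ m ih =>
    induction x using induction_snoc with
    | snoc x c => simp only [bar_succ_snoc, map_add, map_smul, map_snoc, ih, map_rmul hf]
    | add x y hx hy => simp only [map_add, hx, hy]

theorem map_cyc {m : ℕ} (x : CoeffChains k A M (m + 1)) :
    map f m (cyc B m x) = cyc B' m (map f (m + 1) x) := by
  induction x using induction_snoc with
  | snoc x c => simp [map_lmul hf]
  | add x y hx hy => simp only [map_add, hx, hy]

theorem map_diff {m : ℕ} (x : CoeffChains k A M (m + 1)) :
    map f m (diff B m x) = diff B' m (map f (m + 1) x) := by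
  simp only [diff_apply, map_add, map_smul, map_bar hf, map_cyc hf]

theorem map_mem_cycles {m : ℕ} {x : CoeffChains k A M m} (hx : x ∈ cycles B m) :
    map f m x ∈ cycles B' m := by
  cases m with
  | zero => trivial
  | succ m => rw [mem_cycles_succ, ← map_diff hf, mem_cycles_succ.1 hx, map_zero]

end Naturality

theorem map_surjective {f : M →ₗ[k] M'} (hf : Function.Surjective f) (m : ℕ) :
    Function.Surjective (map (A := A) f m) := by
  induction m with
  | zero => exact hf
  | succ m ih =>
    intro y
    obtain ⟨y, rfl⟩ := (succEquiv k A M' m).surjective y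
    obtain ⟨x, rfl⟩ := LinearMap.rTensor_surjective A ih y
    exact ⟨succEquiv k A M m x, map_succEquiv f x⟩

theorem map_injective [Module.Flat k A] {f : M →ₗ[k] M'} (hf : Function.Injective f) (m : ℕ) :
    Function.Injective (map (A := A) f m) := by
  induction m with
  | zero => exact hf
  | succ m ih =>
    rw [injective_iff_map_eq_zero]
    intro y hy
    obtain ⟨y, rfl⟩ := (succEquiv k A M m).surjective y
    rw [map_succEquiv, LinearEquiv.map_eq_zero_iff] at hy
    rw [LinearEquiv.map_eq_zero_iff]
    exact (map_eq_zero_iff _ (Module.Flat.rTensor_preserves_injective_linearMap _ ih)).1 hy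

theorem map_exact [Module.Flat k A] {f : M →ₗ[k] M'} {g : M' →ₗ[k] M''}
    (h : Function.Exact f g) (m : ℕ) :
    Function.Exact (map (A := A) f m) (map (A := A) g m) := by
  induction m with
  | zero => exact h
  | succ m ih =>
    intro y
    obtain ⟨y, rfl⟩ := (succEquiv k A M' m).surjective y
    rw [map_succEquiv, LinearEquiv.map_eq_zero_iff, Module.Flat.rTensor_exact A ih y]
    simp only [Set.mem_range, (succEquiv k A M m).surjective.exists, map_succEquiv,
      EmbeddingLike.apply_eq_iff_eq]

theorem Acyclic.of_exact [Module.Flat k A] {BX : BimoduleAction k A X} {BY : BimoduleAction k A Y}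
    {B : BimoduleAction k A M} {B' : BimoduleAction k A M'} {f : X →ₗ[k] Y} {g : Y →ₗ[k] M}
    {q : M →ₗ[k] M'} (hf : BX.IsHom BY f) (hg : BY.IsHom B g) (hq : B.IsHom B' q)
    (f_injective : Function.Injective f) (fg_exact : Function.Exact f g)
    (gq_exact : Function.Exact g q) (q_surjective : Function.Surjective q) {m : ℕ}
    (hX : Acyclic BX m) (hY : Acyclic BY (m + 1)) (hB' : Acyclic B' (m + 1)) :
    Acyclic B (m + 1) := by
  intro x hx
  obtain ⟨w', hw'⟩ := hB' (map_mem_cycles hq hx)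
  obtain ⟨w, rfl⟩ := map_surjective q_surjective _ w'
  obtain ⟨y, hy⟩ := (map_exact gq_exact (m + 1) (x - diff B (m + 1) w)).1 (by
    rw [map_sub, map_diff hq, hw', sub_self])
  obtain ⟨z, hz⟩ := (map_exact fg_exact m (diff BY m y)).1 (by
    rw [map_diff hg, hy, map_sub, mem_cycles_succ.1 hx, diff_diff, sub_zero])
  have hz_cycle : z ∈ cycles BX m := by
    cases m with
    | zero => trivial
    | succ m =>
      apply map_injective f_injective m
      rw [map_diff hf, hz, diff_diff, map_zero]
  obtain ⟨t, rfl⟩ := hX hz_cycle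
  obtain ⟨c, hc⟩ := hY (x := y - map f (m + 1) t) (by
    rw [mem_cycles_succ, map_sub, ← map_diff hf, hz, sub_self])
  refine ⟨map g (m + 2) c + w, ?_⟩
  rw [map_add, ← map_diff hg, hc, map_sub, (map_exact fg_exact (m + 1)).apply_apply_eq_zero,
    sub_zero, hy, sub_add_cancel]

theorem Acyclic.of_isHom_bijective [Module.Flat k A] {B : BimoduleAction k A M}
    {B' : BimoduleAction k A M'} {f : M →ₗ[k] M'} (hf : B.IsHom B' f) (hf' : Function.Bijective f)
    {m : ℕ} (h : Acyclic B' m) : Acyclic B m := by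
  intro x hx
  obtain ⟨w', hw'⟩ := h (map_mem_cycles hf hx)
  obtain ⟨w, rfl⟩ := map_surjective hf'.surjective _ w'
  exact ⟨w, map_injective hf'.injective m (by rw [map_diff hf, hw'])⟩

theorem Acyclic.of_subsingleton [Subsingleton M] (B : BimoduleAction k A M) (m : ℕ) :
    Acyclic B m := by
  have subsingleton_chains : ∀ m, Subsingleton (CoeffChains k A M m) := fun m => by
    induction m with
    | zero => exact (zeroEquiv k A M).symm.injective.subsingleton
    | succ m ih =>
      refine ⟨fun x y => ?_⟩
      have snoc_eq_zero (z : CoeffChains k A M (m + 1)) : z = 0 := by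
        induction z using induction_snoc with
        | snoc z a => rw [Subsingleton.elim z 0, map_zero, LinearMap.zero_apply]
        | add z z' hz hz' => rw [hz, hz', add_zero]
      rw [snoc_eq_zero x, snoc_eq_zero y]
  exact fun x _ => ⟨0, (subsingleton_chains m).elim _ _⟩

end CoeffChains

end Functoriality

/-! ### Relatively projective bimodules -/

section Splitting

variable {k : Type v} {A M : Type u} [CommRing k] [Ring A] [Algebra k A]
  [AddCommGroup M] [Module k M]

/-- The map `σ` is a bimodule morphism splitting the left multiplication `x ⊗ a ↦ a x`, so that `M`
is a direct summand of the left-induced bimodule `M ⊗ A`. -/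
structure BimoduleAction.IsSplitting (B : BimoduleAction k A M) (σ : M →ₗ[k] M ⊗[k] A) : Prop where
  lift_left : ∀ x, TensorProduct.lift B.left.flip (σ x) = x
  map_left : ∀ a x, σ (B.left a x) = (LinearMap.mul k A a).lTensor M (σ x)
  map_right : ∀ a x, σ (B.right a x) = (B.right a).rTensor A (σ x)

namespace CoeffChains

variable (σ : M →ₗ[k] M ⊗[k] A)

/-- The contracting homotopy defined by a splitting `σ`: if `σ x = ∑ x' ⊗ c`, it sends
`x ⊗ a_1 ⊗ ⋯ ⊗ a_m` to `∑ x' ⊗ a_1 ⊗ ⋯ ⊗ a_m ⊗ c`. -/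
noncomputable def homotopy : (m : ℕ) → CoeffChains k A M m →ₗ[k] CoeffChains k A M m ⊗[k] A
  | 0 => (zeroEquiv k A M).toLinearMap.rTensor A ∘ₗ σ ∘ₗ (zeroEquiv k A M).symm.toLinearMap
  | m + 1 => lift (LinearMap.lcomp k _ (homotopy m) ∘ₗ LinearMap.rTensorHom A ∘ₗ snoc.flip).flip

@[simp] theorem homotopy_zeroEquiv (x : M) :
    homotopy σ 0 (zeroEquiv k A M x) = (zeroEquiv k A M).toLinearMap.rTensor A (σ x) := by
  simp [homotopy]

@[simp] theorem homotopy_snoc {m : ℕ} (x : CoeffChains k A M m) (a : A) :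
    homotopy σ (m + 1) (snoc x a) = (snoc.flip a).rTensor A (homotopy σ m x) := by
  simp [homotopy]

theorem rTensor_lTensor_comm {V W : Type*} [AddCommGroup V] [Module k V] [AddCommGroup W]
    [Module k W] (f : V →ₗ[k] W) (g : A →ₗ[k] A) (y : V ⊗[k] A) :
    f.rTensor A (g.lTensor V y) = g.lTensor W (f.rTensor A y) := by
  rw [← LinearMap.comp_apply, ← LinearMap.comp_apply, LinearMap.rTensor_comp_lTensor,
    LinearMap.lTensor_comp_rTensor]

variable {B : BimoduleAction k A M} {σ} (hσ : B.IsSplitting σ)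

theorem bar_succEquiv_succ {m : ℕ} (y : CoeffChains k A M (m + 1) ⊗[k] A) :
    bar B (m + 1) (succEquiv k A M (m + 1) y) =
      succEquiv k A M m ((bar B m).rTensor A y) +
        (-1 : k) ^ (m + 1) • TensorProduct.lift (rmul B (m + 1)) y := by
  induction y using TensorProduct.induction_on with
  | zero => simp only [map_zero, smul_zero, add_zero]
  | tmul x a => simp
  | add y z hy hz =>
    simp only [map_add, hy, hz, smul_add]
    abel

include hσ

theorem homotopy_rmul {m : ℕ} (x : CoeffChains k A M m) (a : A) :
    homotopy σ m (rmul B m x a) = ((rmul B m).flip a).rTensor A (homotopy σ m x) := by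
  cases m with
  | zero =>
    induction x using induction_zeroEquiv with
    | zeroEquiv x =>
      simp only [rmul_zeroEquiv, homotopy_zeroEquiv, hσ.map_right, ← LinearMap.rTensor_comp_apply]
      congr 2
  | succ m =>
    induction x using induction_snoc with
    | snoc x c =>
      simp only [rmul_snoc, homotopy_snoc, ← LinearMap.rTensor_comp_apply]
      congr 2
    | add x y hx hy => simp only [map_add, LinearMap.add_apply, hx, hy]

theorem homotopy_lmul {m : ℕ} (x : CoeffChains k A M m) (a : A) :
    homotopy σ m (lmul B m x a) = (LinearMap.mul k A a).lTensor _ (homotopy σ m x) := by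
  induction m with
  | zero =>
    induction x using induction_zeroEquiv with
    | zeroEquiv x => simp [hσ.map_left, rTensor_lTensor_comm]
  | succ m ih =>
    induction x using induction_snoc with
    | snoc x c => simp [ih, rTensor_lTensor_comm]
    | add x y hx hy => simp only [map_add, LinearMap.add_apply, hx, hy]

theorem lift_lmul_homotopy {m : ℕ} (x : CoeffChains k A M m) :
    TensorProduct.lift (lmul B m) (homotopy σ m x) = x := by
  induction m with
  | zero =>
    induction x using induction_zeroEquiv with
    | zeroEquiv x =>
      have h : TensorProduct.lift (lmul B 0) ∘ₗ (zeroEquiv k A M).toLinearMap.rTensor A =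
          (zeroEquiv k A M).toLinearMap ∘ₗ TensorProduct.lift B.left.flip :=
        TensorProduct.ext' fun x a => by simp
      simpa [hσ.lift_left] using LinearMap.congr_fun h (σ x)
  | succ m ih =>
    induction x using induction_snoc with
    | snoc x c =>
      have h : TensorProduct.lift (lmul B (m + 1)) ∘ₗ (snoc.flip c).rTensor A =
          snoc.flip c ∘ₗ TensorProduct.lift (lmul B m) :=
        TensorProduct.ext' fun x a => by simp
      simpa [ih] using LinearMap.congr_fun h (homotopy σ m x)
    | add x y hx hy => simp only [map_add, hx, hy]

theorem rTensor_bar_homotopy {m : ℕ} (x : CoeffChains k A M (m + 1)) :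
    (bar B m).rTensor A (homotopy σ (m + 1) x) = homotopy σ m (bar B m x) := by
  induction m with
  | zero =>
    induction x using induction_snoc with
    | snoc x c =>
      simp only [bar_zero_snoc, homotopy_snoc, homotopy_rmul hσ, ← LinearMap.rTensor_comp_apply]
      congr 2
    | add x y hx hy => simp only [map_add, hx, hy]
  | succ m ih =>
    induction x using induction_snoc with
    | snoc x c =>
      have h : bar B (m + 1) ∘ₗ snoc.flip c =
          snoc.flip c ∘ₗ bar B m + (-1 : k) ^ (m + 1) • (rmul B (m + 1)).flip c := by
        ext y
        simp
      simp only [bar_succ_snoc, homotopy_snoc, map_add, map_smul, homotopy_rmul hσ, ← ih,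
        ← LinearMap.rTensor_comp_apply, h, LinearMap.rTensor_add, LinearMap.rTensor_smul,
        LinearMap.add_apply, LinearMap.smul_apply]
    | add x y hx hy => simp only [map_add, hx, hy]

theorem lift_rmul_homotopy {m : ℕ} (x : CoeffChains k A M (m + 1)) :
    TensorProduct.lift (rmul B (m + 1)) (homotopy σ (m + 1) x) =
      succEquiv k A M m (homotopy σ m (cyc B m x)) := by
  induction x using induction_snoc with
  | snoc x c =>
    have h : TensorProduct.lift (rmul B (m + 1)) ∘ₗ (snoc.flip c).rTensor A =
        (succEquiv k A M m).toLinearMap ∘ₗ (LinearMap.mul k A c).lTensor _ :=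
      TensorProduct.ext' fun x a => by simp
    simpa [homotopy_lmul hσ] using LinearMap.congr_fun h (homotopy σ m x)
  | add x y hx hy => simp only [map_add, hx, hy]

theorem cyc_homotopy {m : ℕ} (x : CoeffChains k A M m) :
    cyc B m (succEquiv k A M m (homotopy σ m x)) = x := by
  rw [cyc, lift_succEquiv, lift_lmul_homotopy hσ]

theorem diff_homotopy {m : ℕ} (x : CoeffChains k A M (m + 1)) :
    diff B (m + 1) (succEquiv k A M (m + 1) (homotopy σ (m + 1) x)) =
      succEquiv k A M m (homotopy σ m (diff B m x)) + (-1 : k) ^ (m + 2) • x := by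
  rw [diff_apply, cyc_homotopy hσ, bar_succEquiv_succ, rTensor_bar_homotopy hσ,
    lift_rmul_homotopy hσ]
  simp only [diff_apply, map_add, map_smul]

theorem Acyclic.of_splitting (m : ℕ) : Acyclic B (m + 1) := by
  intro x hx
  refine ⟨(-1 : k) ^ (m + 2) • succEquiv k A M (m + 1) (homotopy σ (m + 1) x), ?_⟩
  rw [map_smul, diff_homotopy hσ, mem_cycles_succ.1 hx, map_zero, map_zero, zero_add, smul_smul,
    ← mul_pow, neg_one_mul, neg_neg, one_pow, one_smul]

theorem Acyclic.zero_of_splitting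
    (hσ_right : ∀ x, TensorProduct.lift B.right.flip (σ x) = 0) : Acyclic B 0 := by
  have bar_zero : bar B 0 ∘ₗ (succEquiv k A M 0).toLinearMap ∘ₗ
      (zeroEquiv k A M).toLinearMap.rTensor A =
        (zeroEquiv k A M).toLinearMap ∘ₗ TensorProduct.lift B.right.flip :=
    TensorProduct.ext' fun x a => by simp
  intro x _
  induction x using induction_zeroEquiv with
  | zeroEquiv x =>
    refine ⟨-succEquiv k A M 0 (homotopy σ 0 (zeroEquiv k A M x)), ?_⟩
    rw [map_neg, diff_apply, cyc_homotopy hσ, homotopy_zeroEquiv]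
    have h := LinearMap.congr_fun bar_zero (σ x)
    simp only [LinearMap.comp_apply, hσ_right, LinearEquiv.coe_coe, map_zero] at h
    simp [h]

end CoeffChains

end Splitting

/-! ### Quotients by two-sided ideals and modules with a character on the right -/

section Bimodules

variable {k : Type v} {A M M' : Type u} [CommRing k] [Ring A] [Algebra k A]
  [AddCommGroup M] [Module k M] [AddCommGroup M'] [Module k M']

namespace BimoduleAction

variable (k A) in
/-- The regular bimodule. -/
noncomputable def self : BimoduleAction k A A where
  left := LinearMap.mul k A
  right := (LinearMap.mul k A).flip
  left_mul a b x := by simp [mul_assoc]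
  right_mul a b x := by simp [mul_assoc]
  left_right_comm a b x := by simp [mul_assoc]

@[simp] theorem self_left (a x : A) : (self k A).left a x = a * x := rfl

@[simp] theorem self_right (a x : A) : (self k A).right a x = x * a := rfl

/-- The submodule `X` is stable under both actions. -/
structure IsInvariant (B : BimoduleAction k A M) (X : Submodule k M) : Prop where
  left_mem : ∀ a, ∀ x ∈ X, B.left a x ∈ X
  right_mem : ∀ a, ∀ x ∈ X, B.right a x ∈ X

/-- The bimodule structure on the quotient by an invariant submodule. -/
noncomputable def quotient (B : BimoduleAction k A M) {X : Submodule k M} (hX : B.IsInvariant X) :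
    BimoduleAction k A (M ⧸ X) where
  left :=
    { toFun := fun a => X.mapQ X (B.left a) (hX.left_mem a)
      map_add' := fun a b => by ext; simp
      map_smul' := fun c a => by ext; simp }
  right :=
    { toFun := fun a => X.mapQ X (B.right a) (hX.right_mem a)
      map_add' := fun a b => by ext; simp
      map_smul' := fun c a => by ext; simp }
  left_mul a b x := by
    induction x using Submodule.Quotient.induction_on with
    | _ x => simp [B.left_mul]
  right_mul a b x := by
    induction x using Submodule.Quotient.induction_on with
    | _ x => simp [B.right_mul]
  left_right_comm a b x := by
    induction x using Submodule.Quotient.induction_on with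
    | _ x => simp [B.left_right_comm]

@[simp] theorem quotient_left_mk (B : BimoduleAction k A M) {X : Submodule k M}
    (hX : B.IsInvariant X) (a : A) (x : M) :
    (B.quotient hX).left a (Submodule.Quotient.mk x) =
      Submodule.Quotient.mk (B.left a x) := rfl

@[simp] theorem quotient_right_mk (B : BimoduleAction k A M) {X : Submodule k M}
    (hX : B.IsInvariant X) (a : A) (x : M) :
    (B.quotient hX).right a (Submodule.Quotient.mk x) =
      Submodule.Quotient.mk (B.right a x) := rfl

theorem isHom_factor (B : BimoduleAction k A M) {X Y : Submodule k M} (hX : B.IsInvariant X)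
    (hY : B.IsInvariant Y) (hXY : X ≤ Y) :
    (B.quotient hX).IsHom (B.quotient hY) (Submodule.factor hXY) where
  map_left a x := by
    obtain ⟨x, rfl⟩ := X.mkQ_surjective x
    rfl
  map_right a x := by
    obtain ⟨x, rfl⟩ := X.mkQ_surjective x
    rfl

variable [Module A M] [IsScalarTower k A M] [Module A M'] [IsScalarTower k A M']

variable (M) in
/-- A left `A`-module on which `A` acts from the right through a character. -/
noncomputable def ofCharacter (χ : A →ₐ[k] k) : BimoduleAction k A M where
  left := (Algebra.lsmul k k M).toLinearMap
  right := LinearMap.lsmul k M ∘ₗ χ.toLinearMap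
  left_mul a b x := by simp
  right_mul a b x := by simp [smul_smul]
  left_right_comm a b x := by simp

@[simp] theorem ofCharacter_left (χ : A →ₐ[k] k) (a : A) (x : M) :
    (ofCharacter M χ).left a x = a • x := rfl

@[simp] theorem ofCharacter_right (χ : A →ₐ[k] k) (a : A) (x : M) :
    (ofCharacter M χ).right a x = χ a • x := rfl

theorem isHom_ofCharacter (χ : A →ₐ[k] k) (f : M →ₗ[A] M') :
    (ofCharacter M χ).IsHom (ofCharacter M' χ) (f.restrictScalars k) where
  map_left a x := map_smul f a x
  map_right a x := map_smul (f.restrictScalars k) (χ a) x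

end BimoduleAction

open BimoduleAction CoeffChains

theorem mem_span_idempotent {p : A} (hp : IsIdempotentElem p) {x : A} :
    x ∈ Ideal.span {p} ↔ x * p = x := by
  refine Ideal.mem_span_singleton'.trans ⟨?_, fun h => ⟨x, h⟩⟩
  rintro ⟨a, rfl⟩
  rw [mul_assoc, hp]

theorem isSplitting_span_idempotent (χ : A →ₐ[k] k) {p : A} (hp : IsIdempotentElem p) :
    (ofCharacter (Ideal.span {p}) χ).IsSplitting
      (TensorProduct.mk k (Ideal.span {p}) A ⟨p, Ideal.mem_span_singleton_self p⟩ ∘ₗ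
        (Ideal.span {p}).subtype.restrictScalars k) where
  lift_left x := Subtype.ext <| by simpa using (mem_span_idempotent hp).1 x.2
  map_left a x := by simp
  map_right a x := (TensorProduct.smul_tmul (χ a) _ _).symm

theorem acyclic_span_idempotent (χ : A →ₐ[k] k) {p : A} (hp : IsIdempotentElem p) (m : ℕ) :
    Acyclic (ofCharacter (Ideal.span {p}) χ) (m + 1) :=
  .of_splitting (isSplitting_span_idempotent χ hp) m

theorem acyclic_span_idempotent_of_map_eq_zero (χ : A →ₐ[k] k) {p : A} (hp : IsIdempotentElem p)
    (hχ : χ p = 0) : ∀ m, Acyclic (ofCharacter (Ideal.span {p}) χ) m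
  | 0 => .zero_of_splitting (isSplitting_span_idempotent χ hp) fun x => by
      have hx : χ x = 0 := by rw [← (mem_span_idempotent hp).1 x.2, map_mul, hχ, mul_zero]
      simp [hx]
  | m + 1 => acyclic_span_idempotent χ hp m

end Bimodules

section RemoveGenerator

variable {k : Type v} {A : Type u} [CommRing k] [Ring A] [Algebra k A] [Module.Flat k A]

open BimoduleAction CoeffChains

/-- The hypotheses make `Y / X` the cokernel of right multiplication by `α`, from `A p'` to `A p`,
with `A` acting from the right through `χ`; both left ideals are relatively projective, and
`χ p' = 0` kills the homology of the first one. -/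
theorem acyclic_quotient_of_generator {X Y : Submodule k A} (hX : (self k A).IsInvariant X)
    (hY : (self k A).IsInvariant Y) {χ : A →ₐ[k] k} {p p' α v : A} (hp : IsIdempotentElem p)
    (hp' : IsIdempotentElem p') (hχp' : χ p' = 0) (hα : α * p = α) (hpv : p * v = v)
    (hvχ : ∀ r, v * r - χ r • v ∈ X) (hXY : ∀ y, y ∈ Y ↔ ∃ c, y - c * v ∈ X)
    (α_injective : ∀ x, x * p' = x → x * α = 0 → x = 0)
    (α_exact : ∀ x, x * p = x → (x * v ∈ X ↔ ∃ y, y * p' = y ∧ y * α = x)) {m : ℕ}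
    (hacyc : Acyclic ((self k A).quotient hY) (m + 1)) :
    Acyclic ((self k A).quotient hX) (m + 1) := by
  have hX_le : X ≤ Y := fun x hx => (hXY x).2 ⟨0, by simpa using hx⟩
  have mul_α_mem : ∀ x ∈ Ideal.span {p'}, LinearMap.toSpanSingleton A A α x ∈ Ideal.span {p} :=
    fun x _ => (mem_span_idempotent hp).2 (by simp [mul_assoc, hα])
  let f : Ideal.span {p'} →ₗ[A] Ideal.span {p} :=
    (LinearMap.toSpanSingleton A A α).restrict mul_α_mem
  let g : Ideal.span {p} →ₗ[k] A ⧸ X :=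
    X.mkQ ∘ₗ LinearMap.mulRight k v ∘ₗ (Ideal.span {p}).subtype.restrictScalars k
  have hg : (ofCharacter _ χ).IsHom ((self k A).quotient hX) g :=
    { map_left := fun a x => by simp [g, mul_assoc]
      map_right := fun a x => by
        have h := hX.left_mem x.1 _ (hvχ a)
        rw [self_left, mul_sub, mul_smul_comm, ← mul_assoc] at h
        simpa [g] using ((Submodule.Quotient.eq X).2 h).symm }
  have f_injective : Function.Injective f := by
    refine (injective_iff_map_eq_zero f).2 fun x hx => Subtype.ext ?_
    exact α_injective x ((mem_span_idempotent hp').1 x.2) (congrArg Subtype.val hx)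
  have fg_exact : Function.Exact f g := fun x => by
    have h := α_exact x ((mem_span_idempotent hp).1 x.2)
    simpa [g, f, mem_span_idempotent hp', Subtype.ext_iff] using h
  have gq_exact : Function.Exact g (Submodule.factor hX_le) := fun y => by
    obtain ⟨y, rfl⟩ := X.mkQ_surjective y
    constructor
    · intro hy
      obtain ⟨c, hc⟩ := (hXY y).1 (by simpa using hy)
      refine ⟨⟨c * p, Ideal.mem_span_singleton'.2 ⟨c, rfl⟩⟩, ((Submodule.Quotient.eq X).2 ?_).symm⟩
      simpa [mul_assoc, hpv] using hc
    · rintro ⟨x, hx⟩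
      have hx : y - x * v ∈ X := (Submodule.Quotient.eq X).1 hx.symm
      simpa using (hXY y).2 ⟨x, hx⟩
  exact .of_exact (isHom_ofCharacter χ f) hg (isHom_factor _ hX hY hX_le) f_injective fg_exact
    gq_exact (Submodule.factor_surjective hX_le)
    (acyclic_span_idempotent_of_map_eq_zero χ hp' hχp' m) (acyclic_span_idempotent χ hp m) hacyc

end RemoveGenerator

/-! ### Hochschild chains as iterated tensor products -/

namespace Chains

section

variable {k : Type*} [CommRing k] {A : Type*} [Ring A] [Algebra k A]

/-- The chain `x ⊗ a`. -/
noncomputable def snoc {m : ℕ} : Chains k A m →ₗ[k] A →ₗ[k] Chains k A (m + 1) :=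
  PiTensorProduct.lift (MultilinearMap.curryRight (M := fun _ : Fin (m + 2) => A)
    (PiTensorProduct.tprod k))

theorem snoc_tprod {m : ℕ} (c : Fin (m + 1) → A) (a : A) :
    snoc (PiTensorProduct.tprod k c) a =
      PiTensorProduct.tprod k (Fin.snoc (α := fun _ : Fin (m + 2) => A) c a) := by
  rw [snoc, PiTensorProduct.lift.tprod]
  rfl

/-- The map on chains of degree `m + 1` that separates the last tensor factor. -/
noncomputable def unsnoc {m : ℕ} : Chains k A (m + 1) →ₗ[k] Chains k A m ⊗[k] A :=
  PiTensorProduct.lift (MultilinearMap.uncurryRight (M := fun _ : Fin (m + 2) => A)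
    ((TensorProduct.mk k (Chains k A m) A).compMultilinearMap (PiTensorProduct.tprod k)))

theorem unsnoc_tprod {m : ℕ} (c : Fin (m + 2) → A) :
    unsnoc (PiTensorProduct.tprod k c) =
      PiTensorProduct.tprod k (Fin.init (α := fun _ : Fin (m + 2) => A) c) ⊗ₜ[k]
        c (Fin.last (m + 1)) := by
  rw [unsnoc, PiTensorProduct.lift.tprod]
  rfl

theorem unsnoc_snoc {m : ℕ} (x : Chains k A m) (a : A) : unsnoc (snoc x a) = x ⊗ₜ[k] a := by
  suffices unsnoc ∘ₗ snoc.flip a = (TensorProduct.mk k (Chains k A m) A).flip a from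
    LinearMap.congr_fun this x
  refine PiTensorProduct.ext (MultilinearMap.ext fun c => ?_)
  simp [snoc_tprod, unsnoc_tprod, Fin.init_snoc]

theorem lift_snoc_unsnoc {m : ℕ} (x : Chains k A (m + 1)) :
    TensorProduct.lift snoc (unsnoc x) = x := by
  suffices TensorProduct.lift snoc ∘ₗ unsnoc = LinearMap.id from LinearMap.congr_fun this x
  refine PiTensorProduct.ext (MultilinearMap.ext fun c => ?_)
  simp only [LinearMap.compMultilinearMap_apply, LinearMap.comp_apply, unsnoc_tprod,
    TensorProduct.lift.tmul, snoc_tprod, Fin.snoc_init_self, LinearMap.id_apply]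

variable (k A) in
/-- Chains of degree `m + 1` arise from those of degree `m` by one more tensor factor. -/
noncomputable def snocEquiv (m : ℕ) : Chains k A m ⊗[k] A ≃ₗ[k] Chains k A (m + 1) :=
  LinearEquiv.ofLinearMap (TensorProduct.lift snoc) unsnoc (LinearMap.ext lift_snoc_unsnoc)
    (TensorProduct.ext' unsnoc_snoc)

@[simp] theorem snocEquiv_tmul {m : ℕ} (x : Chains k A m) (a : A) :
    snocEquiv k A m (x ⊗ₜ a) = snoc x a := rfl

variable (k A) in
/-- Chains of degree `0` are elements of the algebra. -/
noncomputable def zeroEquiv : A ≃ₗ[k] Chains k A 0 :=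
  (PiTensorProduct.subsingletonEquiv (R := k) (s := fun _ : Fin 1 => A) 0).symm

theorem zeroEquiv_apply (a : A) :
    zeroEquiv k A a = PiTensorProduct.tprod k (fun _ : Fin 1 => a) := by
  rw [zeroEquiv, LinearEquiv.symm_apply_eq, PiTensorProduct.subsingletonEquiv_apply_tprod]

/-! ### Faces and rotations -/

theorem face_tprod (m : ℕ) (i : Fin (m + 1)) (c : Fin (m + 2) → A) :
    face k A m i (PiTensorProduct.tprod k c) =
      PiTensorProduct.tprod k (Fin.contractNth i.castSucc (fun x y : A => x * y) c) := by
  rw [face, PiTensorProduct.lift.tprod]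
  rfl

theorem rotation_tprod (m : ℕ) (c : Fin (m + 1) → A) :
    rotation k A m (PiTensorProduct.tprod k c) =
      PiTensorProduct.tprod k (fun i => c ((finRotate (m + 1)).symm i)) :=
  PiTensorProduct.reindex_tprod _ _

theorem rotation_tprod_snoc {m : ℕ} (c : Fin (m + 1) → A) (a : A) :
    rotation k A (m + 1)
        (PiTensorProduct.tprod k (Fin.snoc (α := fun _ : Fin (m + 2) => A) c a)) =
      PiTensorProduct.tprod k (Fin.cons (α := fun _ : Fin (m + 2) => A) a c) := by
  rw [rotation_tprod]
  congr 1
  ext i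
  obtain ⟨i, rfl⟩ := (finRotate (m + 2)).surjective i
  rw [Equiv.symm_apply_apply]
  cases i using Fin.lastCases with
  | last => simp
  | cast i => simp [Fin.snoc_castSucc]

theorem contractNth_castSucc_snoc {m : ℕ} (i : Fin (m + 1)) (c : Fin (m + 2) → A) (a : A) :
    Fin.contractNth i.castSucc.castSucc (fun x y : A => x * y)
        (Fin.snoc (α := fun _ : Fin (m + 3) => A) c a) =
      Fin.snoc (α := fun _ : Fin (m + 2) => A)
        (Fin.contractNth i.castSucc (fun x y : A => x * y) c) a := by
  have hi := i.isLt
  ext j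
  cases j using Fin.lastCases with
  | last =>
    rw [Fin.snoc_last, Fin.contractNth_apply_of_gt _ _ _ _ (by simp; omega), Fin.succ_last,
      Fin.snoc_last]
  | cast j =>
    rw [Fin.snoc_castSucc]
    rcases lt_trichotomy (j : ℕ) (i : ℕ) with h | h | h
    · rw [Fin.contractNth_apply_of_lt _ _ _ _ (by simpa using h),
        Fin.contractNth_apply_of_lt _ _ _ _ (by simpa using h), Fin.snoc_castSucc]
    · rw [Fin.contractNth_apply_of_eq _ _ _ _ (by simpa using h),
        Fin.contractNth_apply_of_eq _ _ _ _ (by simpa using h), Fin.snoc_castSucc,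
        Fin.succ_castSucc, Fin.snoc_castSucc]
    · rw [Fin.contractNth_apply_of_gt _ _ _ _ (by simpa using h),
        Fin.contractNth_apply_of_gt _ _ _ _ (by simpa using h), Fin.succ_castSucc,
        Fin.snoc_castSucc]

theorem contractNth_last_snoc_snoc {m : ℕ} (d : Fin (m + 1) → A) (c a : A) :
    Fin.contractNth (Fin.last (m + 1)).castSucc (fun x y : A => x * y)
        (Fin.snoc (α := fun _ : Fin (m + 3) => A)
          (Fin.snoc (α := fun _ : Fin (m + 2) => A) d c) a) =
      Fin.snoc (α := fun _ : Fin (m + 2) => A) d (c * a) := by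
  ext j
  cases j using Fin.lastCases with
  | last =>
    rw [Fin.contractNth_apply_of_eq _ _ _ _ (by simp), Fin.snoc_castSucc, Fin.snoc_last,
      Fin.succ_last, Fin.snoc_last, Fin.snoc_last]
  | cast j =>
    rw [Fin.contractNth_apply_of_lt _ _ _ _ (by simp; omega), Fin.snoc_castSucc,
      Fin.snoc_castSucc, Fin.snoc_castSucc]

theorem face_castSucc_snoc {m : ℕ} (i : Fin (m + 1)) (x : Chains k A (m + 1)) (a : A) :
    face k A (m + 1) i.castSucc (snoc x a) = snoc (face k A m i x) a := by
  suffices face k A (m + 1) i.castSucc ∘ₗ snoc.flip a = snoc.flip a ∘ₗ face k A m i from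
    LinearMap.congr_fun this x
  refine PiTensorProduct.ext (MultilinearMap.ext fun c => ?_)
  simp only [LinearMap.compMultilinearMap_apply, LinearMap.comp_apply, LinearMap.flip_apply,
    snoc_tprod, face_tprod, contractNth_castSucc_snoc]

theorem face_last_snoc_snoc {m : ℕ} (x : Chains k A m) (c a : A) :
    face k A (m + 1) (Fin.last (m + 1)) (snoc (snoc x c) a) = snoc x (c * a) := by
  suffices face k A (m + 1) (Fin.last (m + 1)) ∘ₗ snoc.flip a ∘ₗ snoc.flip c =
      snoc.flip (c * a) from LinearMap.congr_fun this x
  refine PiTensorProduct.ext (MultilinearMap.ext fun d => ?_)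
  simp only [LinearMap.compMultilinearMap_apply, LinearMap.comp_apply, LinearMap.flip_apply,
    snoc_tprod, face_tprod, contractNth_last_snoc_snoc]

theorem face_zero_rotation_snoc_snoc {m : ℕ} (x : Chains k A m) (c a : A) :
    face k A (m + 1) 0 (rotation k A (m + 2) (snoc (snoc x c) a)) =
      snoc (face k A m 0 (rotation k A (m + 1) (snoc x a))) c := by
  suffices face k A (m + 1) 0 ∘ₗ rotation k A (m + 2) ∘ₗ snoc.flip a ∘ₗ snoc.flip c =
      snoc.flip c ∘ₗ face k A m 0 ∘ₗ rotation k A (m + 1) ∘ₗ snoc.flip a from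
    LinearMap.congr_fun this x
  refine PiTensorProduct.ext (MultilinearMap.ext fun d => ?_)
  simp only [LinearMap.compMultilinearMap_apply, LinearMap.comp_apply, LinearMap.flip_apply,
    snoc_tprod, rotation_tprod_snoc, Fin.cons_snoc_eq_snoc_cons]
  rw [← snoc_tprod]
  exact face_castSucc_snoc 0 _ c

theorem face_snoc_zeroEquiv (x a : A) :
    face k A 0 0 (snoc (zeroEquiv k A x) a) = zeroEquiv k A (x * a) := by
  rw [zeroEquiv_apply, zeroEquiv_apply, snoc_tprod, face_tprod]
  congr 1
  ext i
  rw [Fin.fin_one_eq_zero i, Fin.contractNth_apply_of_eq _ _ _ _ rfl]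
  rfl

theorem face_rotation_snoc_zeroEquiv (x a : A) :
    face k A 0 0 (rotation k A 1 (snoc (zeroEquiv k A x) a)) = zeroEquiv k A (a * x) := by
  rw [zeroEquiv_apply, zeroEquiv_apply, snoc_tprod, rotation_tprod_snoc, face_tprod]
  congr 1
  ext i
  rw [Fin.fin_one_eq_zero i, Fin.contractNth_apply_of_eq _ _ _ _ rfl]
  rfl

end

/-! ### Comparison with chains with coefficients -/

open CoeffChains (diff bar cyc rmul lmul Acyclic)
open BimoduleAction (self)

section Comparison

variable (k : Type v) (A : Type u) [CommRing k] [Ring A] [Algebra k A]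

/-- The Hochschild chains of an algebra are its chains with coefficients in itself. -/
noncomputable def coeffEquiv : (m : ℕ) → CoeffChains k A A m ≃ₗ[k] Chains k A m
  | 0 => (CoeffChains.zeroEquiv k A A).symm ≪≫ₗ zeroEquiv k A
  | m + 1 => (CoeffChains.succEquiv k A A m).symm ≪≫ₗ
      TensorProduct.congr (coeffEquiv m) (LinearEquiv.refl k A) ≪≫ₗ snocEquiv k A m

variable {k A}

@[simp] theorem coeffEquiv_zeroEquiv (a : A) :
    coeffEquiv k A 0 (CoeffChains.zeroEquiv k A A a) = zeroEquiv k A a := by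
  simp [coeffEquiv]

@[simp] theorem coeffEquiv_snoc {m : ℕ} (x : CoeffChains k A A m) (a : A) :
    coeffEquiv k A (m + 1) (CoeffChains.snoc x a) = snoc (coeffEquiv k A m x) a := by
  simp [coeffEquiv]

theorem coeffEquiv_rmul {m : ℕ} (x : CoeffChains k A A m) (a : A) :
    coeffEquiv k A m (rmul (self k A) m x a) =
      face k A m (Fin.last m) (snoc (coeffEquiv k A m x) a) := by
  cases m with
  | zero =>
    induction x using CoeffChains.induction_zeroEquiv with
    | zeroEquiv x => simp [face_snoc_zeroEquiv]
  | succ m =>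
    induction x using CoeffChains.induction_snoc with
    | snoc x c => simp [face_last_snoc_snoc]
    | add x y hx hy => simp only [map_add, LinearMap.add_apply, hx, hy]

theorem coeffEquiv_lmul {m : ℕ} (x : CoeffChains k A A m) (a : A) :
    coeffEquiv k A m (lmul (self k A) m x a) =
      face k A m 0 (rotation k A (m + 1) (snoc (coeffEquiv k A m x) a)) := by
  induction m with
  | zero =>
    induction x using CoeffChains.induction_zeroEquiv with
    | zeroEquiv x => simp [face_rotation_snoc_zeroEquiv]
  | succ m ih =>
    induction x using CoeffChains.induction_snoc with
    | snoc x c => simp [ih, face_zero_rotation_snoc_snoc]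
    | add x y hx hy => simp only [map_add, LinearMap.add_apply, hx, hy]

theorem barB_zero_apply (x : Chains k A 1) : barB k A 0 x = face k A 0 0 x := by
  simp [barB]

theorem barB_succ_snoc {m : ℕ} (x : Chains k A (m + 1)) (a : A) :
    barB k A (m + 1) (snoc x a) = snoc (barB k A m x) a +
      (-1 : k) ^ (m + 1) • face k A (m + 1) (Fin.last (m + 1)) (snoc x a) := by
  simp only [barB, Fin.sum_univ_castSucc (n := m + 1), LinearMap.add_apply, LinearMap.sum_apply,
    LinearMap.smul_apply, map_sum, map_smul, face_castSucc_snoc, Fin.val_castSucc, Fin.val_last]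

theorem coeffEquiv_bar {m : ℕ} (x : CoeffChains k A A (m + 1)) :
    coeffEquiv k A m (bar (self k A) m x) = barB k A m (coeffEquiv k A (m + 1) x) := by
  induction m with
  | zero =>
    induction x using CoeffChains.induction_snoc with
    | snoc x a =>
      rw [CoeffChains.bar_zero_snoc, coeffEquiv_rmul, coeffEquiv_snoc, barB_zero_apply]
      rfl
    | add x y hx hy => simp only [map_add, hx, hy]
  | succ m ih =>
    induction x using CoeffChains.induction_snoc with
    | snoc x a =>
      rw [CoeffChains.bar_succ_snoc, map_add, map_smul, coeffEquiv_snoc, coeffEquiv_rmul,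
        coeffEquiv_snoc, barB_succ_snoc, ih]
    | add x y hx hy => simp only [map_add, hx, hy]

theorem coeffEquiv_cyc {m : ℕ} (x : CoeffChains k A A (m + 1)) :
    coeffEquiv k A m (cyc (self k A) m x) =
      face k A m 0 (rotation k A (m + 1) (coeffEquiv k A (m + 1) x)) := by
  induction x using CoeffChains.induction_snoc with
  | snoc x a => simp [coeffEquiv_lmul]
  | add x y hx hy => simp only [map_add, hx, hy]

theorem coeffEquiv_diff {m : ℕ} (x : CoeffChains k A A (m + 1)) :
    coeffEquiv k A m (diff (self k A) m x) = hochschildB k A m (coeffEquiv k A (m + 1) x) := by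
  rw [CoeffChains.diff_apply, map_add, map_smul, coeffEquiv_bar, coeffEquiv_cyc]
  rfl

theorem barB_barB {m : ℕ} (x : Chains k A (m + 2)) : barB k A m (barB k A (m + 1) x) = 0 := by
  obtain ⟨x, rfl⟩ := (coeffEquiv k A (m + 2)).surjective x
  rw [← coeffEquiv_bar, ← coeffEquiv_bar, CoeffChains.bar_bar, map_zero]

theorem hochschildB_hochschildB {m : ℕ} (x : Chains k A (m + 2)) :
    hochschildB k A m (hochschildB k A (m + 1) x) = 0 := by
  obtain ⟨x, rfl⟩ := (coeffEquiv k A (m + 2)).surjective x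
  rw [← coeffEquiv_diff, ← coeffEquiv_diff, CoeffChains.diff_diff, map_zero]

theorem exact_hochschildB {m : ℕ} (h : Acyclic (self k A) (m + 1)) :
    Function.Exact (hochschildB k A (m + 1)) (hochschildB k A m) := by
  refine fun x => ⟨fun hx => ?_, fun ⟨y, hy⟩ => hy ▸ hochschildB_hochschildB y⟩
  obtain ⟨x, rfl⟩ := (coeffEquiv k A (m + 1)).surjective x
  rw [← coeffEquiv_diff, LinearEquiv.map_eq_zero_iff] at hx
  obtain ⟨y, hy⟩ := h hx
  exact ⟨coeffEquiv k A (m + 2) y, by rw [← coeffEquiv_diff, hy]⟩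

end Comparison

/-! ### Exactness of the bar complex -/

section Bar

variable {k : Type*} [CommRing k] {A : Type*} [Ring A] [Algebra k A]

variable (k A) in
/-- The chain `1 ⊗ x`: the contracting homotopy of the bar complex. -/
noncomputable def consOne : (m : ℕ) → Chains k A m →ₗ[k] Chains k A (m + 1)
  | 0 => snoc (zeroEquiv k A 1) ∘ₗ (zeroEquiv k A).symm.toLinearMap
  | m + 1 => TensorProduct.lift (snoc ∘ₗ consOne m) ∘ₗ (snocEquiv k A m).symm.toLinearMap

theorem consOne_zeroEquiv (a : A) :
    consOne k A 0 (zeroEquiv k A a) = snoc (zeroEquiv k A 1) a := by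
  simp [consOne]

theorem consOne_snoc {m : ℕ} (x : Chains k A m) (a : A) :
    consOne k A (m + 1) (snoc x a) = snoc (consOne k A m x) a := by
  simp [consOne, ← snocEquiv_tmul]

theorem induction_snoc {m : ℕ} {P : Chains k A (m + 1) → Prop}
    (snoc : ∀ x a, P (snoc x a)) (add : ∀ x y, P x → P y → P (x + y))
    (x : Chains k A (m + 1)) : P x := by
  obtain ⟨y, rfl⟩ := (snocEquiv k A m).surjective x
  induction y using TensorProduct.induction_on with
  | zero => simpa using snoc 0 0
  | tmul x a => exact snoc x a
  | add y z hy hz => simpa using add _ _ hy hz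

theorem barB_zero_consOne (x : Chains k A 0) : barB k A 0 (consOne k A 0 x) = x := by
  obtain ⟨x, rfl⟩ := (zeroEquiv k A).surjective x
  rw [consOne_zeroEquiv, barB_zero_apply, face_snoc_zeroEquiv, one_mul]

theorem face_last_snoc_consOne {m : ℕ} (x : Chains k A m) (a : A) :
    face k A (m + 1) (Fin.last (m + 1)) (snoc (consOne k A m x) a) =
      consOne k A m (face k A m (Fin.last m) (snoc x a)) := by
  cases m with
  | zero =>
    obtain ⟨x, rfl⟩ := (zeroEquiv k A).surjective x
    rw [consOne_zeroEquiv, face_last_snoc_snoc, ← consOne_zeroEquiv, ← face_snoc_zeroEquiv]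
    rfl
  | succ m =>
    induction x using induction_snoc with
    | snoc x c => simp only [consOne_snoc, face_last_snoc_snoc]
    | add x y hx hy => simp only [map_add, LinearMap.add_apply, hx, hy]

theorem barB_consOne {m : ℕ} (x : Chains k A (m + 1)) :
    barB k A (m + 1) (consOne k A (m + 1) x) + consOne k A m (barB k A m x) = x := by
  induction m with
  | zero =>
    induction x using induction_snoc with
    | snoc x a =>
      rw [consOne_snoc, barB_succ_snoc, barB_zero_consOne, face_last_snoc_consOne, barB_zero_apply]
      simp
    | add x y hx hy =>
      simp only [map_add]
      rw [add_add_add_comm, hx, hy]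
  | succ m ih =>
    induction x using induction_snoc with
    | snoc x a =>
      rw [consOne_snoc, barB_succ_snoc, face_last_snoc_consOne, barB_succ_snoc, map_add, map_smul,
        consOne_snoc, pow_succ]
      have ih_snoc : snoc (barB k A (m + 1) (consOne k A (m + 1) x)) a +
          snoc (consOne k A m (barB k A m x)) a = snoc x a := by
        rw [← LinearMap.add_apply, ← map_add, ih]
      linear_combination (norm := module) ih_snoc
    | add x y hx hy =>
      simp only [map_add]
      rw [add_add_add_comm, hx, hy]

theorem barB_zero_surjective : Function.Surjective (barB k A 0) := fun x =>
  ⟨_, barB_zero_consOne x⟩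

end Bar

section

variable {k : Type v} [CommRing k] {A : Type u} [Ring A] [Algebra k A]

theorem exact_barB (m : ℕ) : Function.Exact (barB k A (m + 1)) (barB k A m) := by
  refine fun x => ⟨fun hx => ⟨consOne k A (m + 1) x, ?_⟩, fun ⟨y, hy⟩ => hy ▸ barB_barB y⟩
  simpa [hx] using barB_consOne x

end

end Chains

namespace Chains

/-! ### The cyclic bicomplex -/

section Rotation

theorem contractNth_succ_cons {α : Type*} {m : ℕ} (i : Fin (m + 1)) (f : α → α → α) (a : α)
    (d : Fin (m + 1) → α) :
    Fin.contractNth i.succ f (Fin.cons (α := fun _ : Fin (m + 2) => α) a d) =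
      Fin.cons (α := fun _ : Fin (m + 1) => α) a (Fin.contractNth i f d) := by
  ext j
  cases j using Fin.cases with
  | zero =>
    rw [Fin.contractNth_apply_of_lt _ _ _ _ (by simp)]
    rfl
  | succ j =>
    rw [Fin.cons_succ]
    rcases lt_trichotomy (j : ℕ) (i : ℕ) with h | h | h
    · rw [Fin.contractNth_apply_of_lt _ _ _ _ (by simpa using h),
        Fin.contractNth_apply_of_lt _ _ _ _ h]
      rfl
    · rw [Fin.contractNth_apply_of_eq _ _ _ _ (by simpa using h),
        Fin.contractNth_apply_of_eq _ _ _ _ h]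
      rfl
    · rw [Fin.contractNth_apply_of_gt _ _ _ _ (by simpa using h),
        Fin.contractNth_apply_of_gt _ _ _ _ h]
      rfl

variable {k : Type*} [CommRing k] {A : Type*} [Ring A] [Algebra k A]

theorem rotation_pow_tprod (m j : ℕ) (c : Fin (m + 1) → A) :
    (rotation k A m ^ j) (PiTensorProduct.tprod k c) =
      PiTensorProduct.tprod k fun i => c (i - j • 1) := by
  induction j with
  | zero => simp
  | succ j ih =>
    rw [pow_succ', Module.End.mul_apply, ih, rotation_tprod]
    simp only [finRotate_symm_apply, sub_sub, succ_nsmul']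

theorem rotation_pow (m : ℕ) : rotation k A m ^ (m + 1) = 1 := by
  refine PiTensorProduct.ext (MultilinearMap.ext fun c => ?_)
  have card_nsmul : (m + 1) • (1 : Fin (m + 1)) = 0 := by
    simpa using card_nsmul_eq_zero (x := (1 : Fin (m + 1)))
  simp only [LinearMap.compMultilinearMap_apply, rotation_pow_tprod, card_nsmul, sub_zero]
  rfl

theorem cyclicT_pow (m : ℕ) : cyclicT k A m ^ (m + 1) = 1 := by
  rw [cyclicT, smul_pow, rotation_pow, ← pow_mul, (Nat.even_mul_succ_self m).neg_one_pow, one_smul]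

theorem cyclicN_cyclicT {m : ℕ} (x : Chains k A m) :
    cyclicN k A m (cyclicT k A m x) = cyclicN k A m x := by
  have h := geom_sum_mul (cyclicT k A m) (m + 1)
  rw [cyclicT_pow, sub_self, mul_sub, mul_one, sub_eq_zero] at h
  exact LinearMap.congr_fun h x

theorem cyclicT_cyclicN {m : ℕ} (x : Chains k A m) :
    cyclicT k A m (cyclicN k A m x) = cyclicN k A m x := by
  have h := mul_geom_sum (cyclicT k A m) (m + 1)
  rw [cyclicT_pow, sub_self, sub_mul, one_mul, sub_eq_zero] at h
  exact LinearMap.congr_fun h x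

theorem cyclicN_cyclicT_pow {m : ℕ} (j : ℕ) (x : Chains k A m) :
    cyclicN k A m ((cyclicT k A m ^ j) x) = cyclicN k A m x := by
  induction j with
  | zero => rfl
  | succ j ih => rw [pow_succ', Module.End.mul_apply, cyclicN_cyclicT, ih]

theorem cyclicT_pow_cyclicN {m : ℕ} (j : ℕ) (x : Chains k A m) :
    (cyclicT k A m ^ j) (cyclicN k A m x) = cyclicN k A m x := by
  induction j with
  | zero => rfl
  | succ j ih => rw [pow_succ, Module.End.mul_apply, cyclicT_cyclicN, ih]

theorem cyclicT_pow_sub_pow {m j : ℕ} (hj : j ≤ m + 1) (x : Chains k A m) :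
    (cyclicT k A m ^ j) ((cyclicT k A m ^ (m + 1 - j)) x) = x := by
  rw [← Module.End.mul_apply, ← pow_add, Nat.add_sub_cancel' hj, cyclicT_pow, Module.End.one_apply]

theorem sum_cyclicT_pow_sub {m : ℕ} (x : Chains k A m) :
    ∑ i ∈ Finset.range (m + 1), (cyclicT k A m ^ (m + 1 - i)) x = cyclicN k A m x := by
  rw [← cyclicN_cyclicT, cyclicN, LinearMap.sum_apply, ← Finset.sum_range_reflect]
  refine Finset.sum_congr rfl fun i hi => ?_
  rw [← Module.End.mul_apply, ← pow_succ]
  congr 2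
  have := Finset.mem_range.1 hi
  omega

theorem face_succ_rotation {m : ℕ} (i : Fin m) (x : Chains k A (m + 1)) :
    face k A m i.succ (rotation k A (m + 1) x) = rotation k A m (face k A m i.castSucc x) := by
  obtain _ | m := m
  · exact i.elim0
  suffices face k A (m + 1) i.succ ∘ₗ rotation k A (m + 2) =
      rotation k A (m + 1) ∘ₗ face k A (m + 1) i.castSucc from LinearMap.congr_fun this x
  refine PiTensorProduct.ext (MultilinearMap.ext fun c => ?_)
  rw [← Fin.snoc_init_self c]
  simp only [LinearMap.compMultilinearMap_apply, LinearMap.comp_apply, rotation_tprod_snoc,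
    face_tprod, contractNth_castSucc_snoc, ← Fin.succ_castSucc, contractNth_succ_cons]

end Rotation

section SignedFace

variable (k : Type*) [CommRing k] (A : Type*) [Ring A] [Algebra k A]

/-- The `i`-th face of a chain of degree `m + 1`, with the sign `(-1)^i`. The face with `i = m + 1`,
also taken as the value for larger `i`, is the cyclic one `a_{m+1} a_0 ⊗ a_1 ⊗ ⋯ ⊗ a_m`. -/
noncomputable def signedFace (m i : ℕ) : Chains k A (m + 1) →ₗ[k] Chains k A m :=
  if h : i < m + 1 then (-1 : k) ^ i • face k A m ⟨i, h⟩
  else (-1 : k) ^ (m + 1) • (face k A m 0 ∘ₗ rotation k A (m + 1))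

variable {k A} {m : ℕ}

theorem signedFace_of_lt {i : ℕ} (h : i < m + 1) :
    signedFace k A m i = (-1 : k) ^ i • face k A m ⟨i, h⟩ := dif_pos h

theorem signedFace_last :
    signedFace k A m (m + 1) = (-1 : k) ^ (m + 1) • (face k A m 0 ∘ₗ rotation k A (m + 1)) :=
  dif_neg (lt_irrefl _)

theorem sum_signedFace_eq_barB (x : Chains k A (m + 1)) :
    ∑ i ∈ Finset.range (m + 1), signedFace k A m i x = barB k A m x := by
  rw [barB, LinearMap.sum_apply, ← Fin.sum_univ_eq_sum_range (fun i => signedFace k A m i x)]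
  exact Finset.sum_congr rfl fun i _ => by rw [signedFace_of_lt i.isLt]

theorem sum_signedFace_eq_hochschildB (x : Chains k A (m + 1)) :
    ∑ i ∈ Finset.range (m + 2), signedFace k A m i x = hochschildB k A m x := by
  rw [Finset.sum_range_succ, sum_signedFace_eq_barB, signedFace_last]
  rfl

theorem signedFace_zero_cyclicT (x : Chains k A (m + 1)) :
    signedFace k A m 0 (cyclicT k A (m + 1) x) = signedFace k A m (m + 1) x := by
  rw [signedFace_of_lt m.succ_pos, signedFace_last]
  simp [cyclicT]

theorem signedFace_succ_cyclicT_of_lt {i : ℕ} (hi : i < m) (x : Chains k A (m + 1)) :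
    signedFace k A m (i + 1) (cyclicT k A (m + 1) x) = cyclicT k A m (signedFace k A m i x) := by
  have h := face_succ_rotation ⟨i, hi⟩ x
  simp only [Fin.succ_mk, Fin.castSucc_mk] at h
  simp only [signedFace_of_lt (show i < m + 1 by omega),
    signedFace_of_lt (show i + 1 < m + 1 by omega), cyclicT, LinearMap.smul_apply, map_smul, h]
  module

theorem signedFace_cyclicT_pow_of_le {i : ℕ} (hi : i ≤ m) (x : Chains k A (m + 1)) :
    signedFace k A m i ((cyclicT k A (m + 1) ^ i) x) =
      (cyclicT k A m ^ i) (signedFace k A m 0 x) := by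
  induction i with
  | zero => rfl
  | succ i ih =>
    rw [pow_succ', pow_succ', Module.End.mul_apply, Module.End.mul_apply,
      signedFace_succ_cyclicT_of_lt hi, ih (by omega)]

theorem signedFace_succ_cyclicT {i : ℕ} (hi : i ≤ m) (x : Chains k A (m + 1)) :
    signedFace k A m (i + 1) (cyclicT k A (m + 1) x) = cyclicT k A m (signedFace k A m i x) := by
  obtain hi | rfl := hi.lt_or_eq
  · exact signedFace_succ_cyclicT_of_lt hi x
  · rw [← signedFace_zero_cyclicT]
    nth_rw 2 [← cyclicT_pow_sub_pow (Nat.le_add_right i 2) x]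
    rw [signedFace_cyclicT_pow_of_le le_rfl, ← Module.End.mul_apply (cyclicT k A i), ← pow_succ',
      cyclicT_pow, Module.End.one_apply, show i + 1 + 1 - i = 2 by omega, pow_two,
      Module.End.mul_apply]

theorem signedFace_cyclicT_pow {i : ℕ} (hi : i ≤ m + 1) (x : Chains k A (m + 1)) :
    signedFace k A m i ((cyclicT k A (m + 1) ^ i) x) =
      (cyclicT k A m ^ i) (signedFace k A m 0 x) := by
  induction i with
  | zero => rfl
  | succ i ih =>
    rw [pow_succ', pow_succ', Module.End.mul_apply, Module.End.mul_apply,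
      signedFace_succ_cyclicT (by omega), ih (by omega)]

theorem hochschildB_sub_cyclicT (x : Chains k A (m + 1)) :
    hochschildB k A m (x - cyclicT k A (m + 1) x) =
      barB k A m x - cyclicT k A m (barB k A m x) := by
  have cyclic : hochschildB k A m (cyclicT k A (m + 1) x) =
      cyclicT k A m (barB k A m x) + signedFace k A m (m + 1) x := by
    rw [← sum_signedFace_eq_hochschildB, Finset.sum_range_succ', signedFace_zero_cyclicT,
      ← sum_signedFace_eq_barB, map_sum]
    congr 1
    exact Finset.sum_congr rfl fun i hi =>
      signedFace_succ_cyclicT (Nat.lt_succ_iff.1 (Finset.mem_range.1 hi)) x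
  rw [map_sub, cyclic, ← sum_signedFace_eq_hochschildB, Finset.sum_range_succ,
    sum_signedFace_eq_barB]
  abel

theorem barB_cyclicN_eq_cyclicN_signedFace_cyclicN (x : Chains k A (m + 1)) :
    barB k A m (cyclicN k A (m + 1) x) =
      cyclicN k A m (signedFace k A m 0 (cyclicN k A (m + 1) x)) := by
  rw [← sum_signedFace_eq_barB, cyclicN.eq_1 k A m, LinearMap.sum_apply]
  refine Finset.sum_congr rfl fun i hi => ?_
  rw [← signedFace_cyclicT_pow (Finset.mem_range.1 hi).le, cyclicT_pow_cyclicN]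

theorem cyclicN_signedFace {i : ℕ} (hi : i ≤ m + 1) (x : Chains k A (m + 1)) :
    cyclicN k A m (signedFace k A m i x) =
      cyclicN k A m (signedFace k A m 0 ((cyclicT k A (m + 1) ^ (m + 2 - i)) x)) := by
  nth_rw 1 [← cyclicT_pow_sub_pow (Nat.le_succ_of_le hi) x]
  rw [signedFace_cyclicT_pow hi, cyclicN_cyclicT_pow]

theorem barB_cyclicN (x : Chains k A (m + 1)) :
    barB k A m (cyclicN k A (m + 1) x) = cyclicN k A m (hochschildB k A m x) := by
  rw [barB_cyclicN_eq_cyclicN_signedFace_cyclicN, ← sum_cyclicT_pow_sub x, map_sum, map_sum,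
    ← sum_signedFace_eq_hochschildB, map_sum]
  exact Finset.sum_congr rfl fun i hi =>
    (cyclicN_signedFace (Nat.lt_succ_iff.1 (Finset.mem_range.1 hi)) x).symm

end SignedFace

end Chains

/-! ### Cyclic homology in the absence of higher Hochschild homology -/

section Cyclic

open CoeffChains (Acyclic)
open BimoduleAction (self)
open Chains

variable {k : Type*} [CommRing k] {A : Type*} [Ring A] [Algebra k A]

theorem cyclicTotD_apply_even {m : ℕ} (x : CyclicTot k A (m + 1)) (q : ℕ) (hq : q < m + 1)
    (h : Even (m - q)) : cyclicTotD k A m x ⟨q, hq⟩ =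
      hochschildB k A q (x ⟨q + 1, by omega⟩) +
        (x ⟨q, by omega⟩ - cyclicT k A q (x ⟨q, by omega⟩)) := by
  rw [cyclicTotD, LinearMap.pi_apply, if_pos h]
  rfl

theorem cyclicTotD_apply_odd {m : ℕ} (x : CyclicTot k A (m + 1)) (q : ℕ) (hq : q < m + 1)
    (h : ¬ Even (m - q)) : cyclicTotD k A m x ⟨q, hq⟩ =
      -barB k A q (x ⟨q + 1, by omega⟩) + cyclicN k A q (x ⟨q, by omega⟩) := by
  rw [cyclicTotD, LinearMap.pi_apply, if_neg h]
  rfl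

theorem cyclicTotD_cyclicTotD {m : ℕ} (x : CyclicTot k A (m + 2)) :
    cyclicTotD k A m (cyclicTotD k A (m + 1) x) = 0 := by
  funext ⟨q, hq⟩
  have same_column : m + 1 - (q + 1) = m - q := by omega
  have next_column : m + 1 - q = m - q + 1 := by omega
  by_cases h : Even (m - q)
  · rw [cyclicTotD_apply_even _ q hq h, cyclicTotD_apply_even _ (q + 1) _ (same_column ▸ h),
      cyclicTotD_apply_odd _ q _ (by rwa [next_column, Nat.even_add_one, not_not]), map_add,
      hochschildB_hochschildB, hochschildB_sub_cyclicT, map_add, map_neg, cyclicT_cyclicN,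
      Pi.zero_apply]
    abel
  · rw [cyclicTotD_apply_odd _ q hq h, cyclicTotD_apply_odd _ (q + 1) _ (same_column ▸ h),
      cyclicTotD_apply_even _ q _ (by rwa [next_column, Nat.even_add_one]), map_add, map_neg,
      barB_barB, barB_cyclicN, map_add, map_sub, cyclicN_cyclicT, Pi.zero_apply]
    abel

/-- The periodicity map: the projection of the total complex that forgets the columns `0` and `1`
of the cyclic bicomplex. -/
noncomputable def periodicity (m : ℕ) : CyclicTot k A (m + 2) →ₗ[k] CyclicTot k A m :=
  LinearMap.pi fun q : Fin (m + 1) =>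
    LinearMap.proj (R := k) (φ := fun q : Fin (m + 3) => Chains k A q) ⟨q, by omega⟩

theorem periodicity_apply {m : ℕ} (x : CyclicTot k A (m + 2)) (q : ℕ) (hq : q < m + 1) :
    periodicity m x ⟨q, hq⟩ = x ⟨q, by omega⟩ := rfl

theorem cyclicTotD_periodicity {m : ℕ} (x : CyclicTot k A (m + 3)) :
    cyclicTotD k A m (periodicity (m + 1) x) = periodicity m (cyclicTotD k A (m + 2) x) := by
  funext ⟨q, hq⟩
  have even_iff : Even (m + 2 - q) ↔ Even (m - q) := by
    rw [show m + 2 - q = m - q + 2 by omega, Nat.even_add]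
    simp
  rw [periodicity_apply]
  by_cases h : Even (m - q)
  · rw [cyclicTotD_apply_even _ q _ h, cyclicTotD_apply_even _ q _ (even_iff.2 h)]
    rfl
  · rw [cyclicTotD_apply_odd _ q _ h, cyclicTotD_apply_odd _ q _ (mt even_iff.1 h)]
    rfl

/-- Extension by zero in the columns `0` and `1`, a section of the periodicity map. -/
noncomputable def extendZero {m : ℕ} (x : CyclicTot k A m) : CyclicTot k A (m + 2) := fun q =>
  if h : (q : ℕ) < m + 1 then x ⟨q, h⟩ else 0

theorem periodicity_extendZero {m : ℕ} (x : CyclicTot k A m) :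
    periodicity m (extendZero x) = x := by
  funext ⟨q, hq⟩
  rw [periodicity_apply, extendZero, dif_pos hq]

theorem mem_cyclicCycles_succ {m : ℕ} {x : CyclicTot k A (m + 1)} :
    x ∈ cyclicCycles k A (m + 1) ↔ cyclicTotD k A m x = 0 := Iff.rfl

theorem periodicity_mem_cyclicCycles {m : ℕ} {z : CyclicTot k A (m + 2)}
    (hz : z ∈ cyclicCycles k A (m + 2)) : periodicity m z ∈ cyclicCycles k A m := by
  obtain _ | m := m
  · exact Submodule.mem_top
  · rw [mem_cyclicCycles_succ, cyclicTotD_periodicity, mem_cyclicCycles_succ.1 hz, map_zero]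

theorem cyclicTotD_extendZero_apply {m : ℕ} {w : CyclicTot k A m}
    (hw : w ∈ cyclicCycles k A m) (q : ℕ) (hq : q < m) :
    cyclicTotD k A (m + 1) (extendZero w) ⟨q, by omega⟩ = 0 := by
  obtain _ | m := m
  · omega
  · rw [← periodicity_apply (cyclicTotD k A (m + 2) (extendZero w)) q hq,
      ← cyclicTotD_periodicity, periodicity_extendZero, mem_cyclicCycles_succ.1 hw]
    rfl

/-- The element of the total complex with `v` in column `0`, `y` in column `1`, and zero in the
other columns. -/
noncomputable def firstColumns {m : ℕ} (y : Chains k A m) (v : Chains k A (m + 1)) :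
    CyclicTot k A (m + 1) :=
  Pi.single (M := fun q : Fin (m + 2) => Chains k A q) ⟨m, by omega⟩ y +
    Pi.single (M := fun q : Fin (m + 2) => Chains k A q) ⟨m + 1, by omega⟩ v

section FirstColumns

variable {m : ℕ} (y : Chains k A m) (v : Chains k A (m + 1))

theorem firstColumns_apply_of_lt {q : ℕ} (hq : q < m) :
    firstColumns y v ⟨q, by omega⟩ = 0 := by
  rw [firstColumns, Pi.add_apply, Pi.single_eq_of_ne (by simp; omega),
    Pi.single_eq_of_ne (by simp; omega), add_zero]

theorem firstColumns_apply_one : firstColumns y v ⟨m, by omega⟩ = y := by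
  rw [firstColumns, Pi.add_apply, Pi.single_eq_same, Pi.single_eq_of_ne (by simp), add_zero]

theorem firstColumns_apply_zero : firstColumns y v ⟨m + 1, by omega⟩ = v := by
  rw [firstColumns, Pi.add_apply, Pi.single_eq_same, Pi.single_eq_of_ne (by simp), zero_add]

end FirstColumns

theorem firstColumns_eq {m : ℕ} {x : CyclicTot k A (m + 1)}
    (h : ∀ (q : ℕ) (hq : q < m), x ⟨q, by omega⟩ = 0) :
    firstColumns (m := m) (x ⟨m, by omega⟩) (x ⟨m + 1, by omega⟩) = x := by
  funext ⟨q, hq⟩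
  rcases lt_trichotomy q m with hqm | rfl | hqm
  · rw [firstColumns_apply_of_lt _ _ hqm, h q hqm]
  · exact firstColumns_apply_one _ _
  · obtain rfl : q = m + 1 := by omega
    exact firstColumns_apply_zero _ _

theorem periodicity_firstColumns {m : ℕ} (y : Chains k A (m + 1)) (v : Chains k A (m + 2)) :
    periodicity m (firstColumns y v) = 0 :=
  funext fun ⟨_, hq⟩ => firstColumns_apply_of_lt y v hq

theorem cyclicTotD_firstColumns {m : ℕ} (y : Chains k A (m + 1)) (v : Chains k A (m + 2)) :
    cyclicTotD k A (m + 1) (firstColumns y v) =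
      firstColumns (-barB k A m y)
        (hochschildB k A (m + 1) v + (y - cyclicT k A (m + 1) y)) := by
  rw [← firstColumns_eq (x := cyclicTotD k A (m + 1) (firstColumns y v)),
    cyclicTotD_apply_odd _ m _ (by simp), cyclicTotD_apply_even _ (m + 1) _ (by simp),
    firstColumns_apply_one, firstColumns_apply_zero, firstColumns_apply_of_lt _ _ m.lt_succ_self,
    map_zero, add_zero]
  intro q hq
  by_cases h : Even (m + 1 - q)
  · rw [cyclicTotD_apply_even _ q _ h, firstColumns_apply_of_lt _ _ (by omega),
      firstColumns_apply_of_lt _ _ (by omega)]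
    simp
  · rw [cyclicTotD_apply_odd _ q _ h, firstColumns_apply_of_lt _ _ (by omega),
      firstColumns_apply_of_lt _ _ (by omega)]
    simp

theorem mem_range_barB_of_cyclicTotD_firstColumns_eq_zero {m : ℕ} {y : Chains k A m}
    {v : Chains k A (m + 1)} (h : cyclicTotD k A m (firstColumns y v) = 0) :
    ∃ z, barB k A m z = y := by
  obtain _ | m := m
  · exact barB_zero_surjective y
  · have hy := congrFun h ⟨m, by omega⟩
    rw [cyclicTotD_firstColumns, firstColumns_apply_one] at hy
    exact (exact_barB m y).1 (neg_eq_zero.1 hy)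

theorem exists_cyclicTotD_firstColumns_eq {m : ℕ} (hA : Acyclic (self k A) (m + 1))
    {x : CyclicTot k A (m + 1)} (hx : cyclicTotD k A m x = 0)
    (h : ∀ (q : ℕ) (hq : q < m), x ⟨q, by omega⟩ = 0) :
    ∃ y v, cyclicTotD k A (m + 1) (firstColumns y v) = x := by
  have hv := congrFun hx ⟨m, by omega⟩
  rw [cyclicTotD_apply_even _ m _ (by simp)] at hv
  rw [← firstColumns_eq h] at hx ⊢
  obtain ⟨z, hz⟩ := mem_range_barB_of_cyclicTotD_firstColumns_eq_zero hx
  obtain ⟨w, hw⟩ := (exact_hochschildB hA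
    (x ⟨m + 1, by omega⟩ + (z - cyclicT k A (m + 1) z))).1 (by
      rw [map_add, hochschildB_sub_cyclicT, hz]
      exact hv)
  refine ⟨-z, w, ?_⟩
  rw [cyclicTotD_firstColumns, map_neg, neg_neg, hz, hw, map_neg]
  congr 1
  abel

/-- The map induced by the periodicity map from cycles to homology. -/
noncomputable def periodicityClass (m : ℕ) : cyclicCycles k A (m + 2) →ₗ[k] CyclicHomology k A m :=
  Submodule.mkQ _ ∘ₗ (periodicity m).restrict fun _ => periodicity_mem_cyclicCycles

theorem periodicityClass_surjective {m : ℕ} (hA : Acyclic (self k A) (m + 1)) :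
    Function.Surjective (periodicityClass (k := k) (A := A) m) := by
  intro c
  obtain ⟨⟨w, hw⟩, rfl⟩ := Submodule.mkQ_surjective _ c
  obtain ⟨y, v, hyv⟩ := exists_cyclicTotD_firstColumns_eq hA
    (cyclicTotD_cyclicTotD (extendZero w)) (cyclicTotD_extendZero_apply hw)
  refine ⟨⟨extendZero w - firstColumns y v, ?_⟩, congrArg (Submodule.mkQ _) (Subtype.ext ?_)⟩
  · rw [mem_cyclicCycles_succ, map_sub, hyv, sub_self]
  · change periodicity m (extendZero w - firstColumns y v) = w
    rw [map_sub, periodicity_extendZero, periodicity_firstColumns, sub_zero]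

theorem ker_periodicityClass {m : ℕ} (hA : Acyclic (self k A) (m + 2)) :
    LinearMap.ker (periodicityClass (k := k) (A := A) m) =
      (LinearMap.range (cyclicTotD k A (m + 2))).submoduleOf (cyclicCycles k A (m + 2)) := by
  ext ⟨z, hz⟩
  change Submodule.Quotient.mk _ = 0 ↔ z ∈ LinearMap.range (cyclicTotD k A (m + 2))
  rw [Submodule.Quotient.mk_eq_zero]
  change periodicity m z ∈ LinearMap.range (cyclicTotD k A m) ↔ _
  constructor
  · rintro ⟨y, hy⟩
    have periodicity_eq_zero : periodicity m (z - cyclicTotD k A (m + 2) (extendZero y)) = 0 := by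
      rw [map_sub, ← cyclicTotD_periodicity, periodicity_extendZero, hy, sub_self]
    obtain ⟨u, v, huv⟩ := exists_cyclicTotD_firstColumns_eq hA
      (x := z - cyclicTotD k A (m + 2) (extendZero y))
      (by rw [map_sub, cyclicTotD_cyclicTotD, sub_zero, mem_cyclicCycles_succ.1 hz])
      fun q hq => congrFun periodicity_eq_zero ⟨q, hq⟩
    exact ⟨firstColumns u v + extendZero y, by rw [map_add, huv, sub_add_cancel]⟩
  · rintro ⟨y, rfl⟩
    exact ⟨periodicity (m + 1) y, cyclicTotD_periodicity y⟩

theorem nonempty_quotient_equiv {M N : Type*} [AddCommGroup M] [AddCommGroup N] [Module k M]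
    [Module k N] (f : M →ₗ[k] N) (hf : Function.Surjective f) {p : Submodule k M}
    (hp : LinearMap.ker f = p) : Nonempty ((M ⧸ p) ≃ₗ[k] N) :=
  hp ▸ ⟨f.quotKerEquivOfSurjective hf⟩

theorem nonempty_cyclicHomology_add_two_equiv {m : ℕ} (h : Acyclic (self k A) (m + 1))
    (h' : Acyclic (self k A) (m + 2)) :
    Nonempty (CyclicHomology k A (m + 2) ≃ₗ[k] CyclicHomology k A m) := by
  have surjective := periodicityClass_surjective h
  have ker_eq := ker_periodicityClass h'
  exact nonempty_quotient_equiv _ surjective ker_eq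

theorem subsingleton_cyclicHomology_one (h : Acyclic (self k A) 1) :
    Subsingleton (CyclicHomology k A 1) := by
  refine Submodule.Quotient.subsingleton_iff.2 (eq_top_iff.2 fun ⟨x, hx⟩ _ => ?_)
  obtain ⟨y, v, hyv⟩ := exists_cyclicTotD_firstColumns_eq h hx fun q hq => absurd hq q.not_lt_zero
  exact ⟨firstColumns y v, hyv⟩

theorem subsingleton_cyclicHomology_odd (hA : ∀ m, Acyclic (self k A) (m + 1)) (p : ℕ) :
    Subsingleton (CyclicHomology k A (2 * p + 1)) := by
  induction p with
  | zero => exact subsingleton_cyclicHomology_one (hA 0)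
  | succ p ih =>
    obtain ⟨e⟩ := nonempty_cyclicHomology_add_two_equiv (hA (2 * p + 1)) (hA (2 * p + 2))
    exact e.toEquiv.subsingleton

theorem nonempty_cyclicHomology_even_equiv (hA : ∀ m, Acyclic (self k A) (m + 1)) (p : ℕ) :
    Nonempty (CyclicHomology k A (2 * p) ≃ₗ[k] CyclicHomology k A 0) := by
  induction p with
  | zero => exact ⟨LinearEquiv.refl _ _⟩
  | succ p ih =>
    obtain ⟨e⟩ := nonempty_cyclicHomology_add_two_equiv (hA (2 * p)) (hA (2 * p + 1))
    exact ⟨e ≪≫ₗ ih.some⟩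

theorem subsingleton_hochschildHomology {m : ℕ} (h : Acyclic (self k A) (m + 1)) :
    Subsingleton (HochschildHomology k A (m + 1)) :=
  Submodule.Quotient.subsingleton_iff.2 <| eq_top_iff.2 fun ⟨x, hx⟩ _ =>
    (exact_hochschildB h x).1 hx

end Cyclic

/-! ### Degree zero -/

section DegreeZero

open Chains

variable (k : Type*) [CommRing k] (A : Type*) [Ring A] [Algebra k A]

/-- The total complex of the cyclic bicomplex in degree `0`. -/
noncomputable def cyclicTotZeroEquiv : CyclicTot k A 0 ≃ₗ[k] Chains k A 0 :=
  LinearEquiv.ofBijective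
    (LinearMap.proj (R := k) (φ := fun q : Fin 1 => Chains k A q) 0)
    ⟨fun _ _ h => funext fun q => by rwa [Subsingleton.elim q 0], fun y =>
      ⟨Pi.single (M := fun q : Fin 1 => Chains k A q) 0 y,
        Pi.single_eq_same (M := fun q : Fin 1 => Chains k A q) 0 y⟩⟩

variable {k A} in
theorem cyclicTotZeroEquiv_cyclicTotD (x : CyclicTot k A 1) :
    cyclicTotZeroEquiv k A (cyclicTotD k A 0 x) = hochschildB k A 0 (x 1) := by
  have rotation_zero : rotation k A 0 = 1 := by simpa using rotation_pow (k := k) (A := A) 0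
  change cyclicTotD k A 0 x ⟨0, _⟩ = _
  rw [cyclicTotD_apply_even (m := 0) x 0 _ (by simp), cyclicT, rotation_zero, pow_zero, one_smul,
    Module.End.one_apply, sub_self, add_zero]
  rfl

theorem map_range_cyclicTotD_zero : (LinearMap.range (cyclicTotD k A 0)).map
    (cyclicTotZeroEquiv k A).toLinearMap = LinearMap.range (hochschildB k A 0) := by
  have surjective_proj : Function.Surjective
      (LinearMap.proj (R := k) (φ := fun q : Fin 2 => Chains k A q) 1) :=
    Function.surjective_eval _
  rw [← LinearMap.range_comp, ← LinearMap.range_comp_of_range_eq_top (hochschildB k A 0)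
    (LinearMap.range_eq_top.2 surjective_proj)]
  exact congrArg LinearMap.range (LinearMap.ext cyclicTotZeroEquiv_cyclicTotD)

/-- Cyclic and Hochschild homology agree in degree `0`. -/
noncomputable def cyclicHomologyZeroEquiv :
    CyclicHomology k A 0 ≃ₗ[k] HochschildHomology k A 0 :=
  Submodule.Quotient.equiv _ _
    (Submodule.topEquiv ≪≫ₗ cyclicTotZeroEquiv k A ≪≫ₗ Submodule.topEquiv.symm) <| by
      ext ⟨x, hx⟩
      change _ ↔ x ∈ LinearMap.range (hochschildB k A 0)
      rw [← map_range_cyclicTotD_zero]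
      exact ⟨fun ⟨⟨y, _⟩, hy, h⟩ => ⟨y, hy, congrArg Subtype.val h⟩,
        fun ⟨y, hy, h⟩ => ⟨⟨y, Submodule.mem_top⟩, hy, Subtype.ext h⟩⟩

/-- The projection of an algebra onto its Hochschild homology in degree `0`. -/
noncomputable def hochschildZeroMk : A →ₗ[k] HochschildHomology k A 0 :=
  ((LinearMap.range (hochschildB k A 0)).submoduleOf (hochschildCycles k A 0)).mkQ ∘ₗ
    (zeroEquiv k A).toLinearMap.codRestrict (hochschildCycles k A 0) fun _ => Submodule.mem_top

variable {k A}

theorem hochschildZeroMk_apply (x : A) : hochschildZeroMk k A x = hochschildClassZero k A x :=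
  congrArg Submodule.Quotient.mk (Subtype.ext (zeroEquiv_apply x))

variable (k A) in
theorem hochschildZeroMk_surjective : Function.Surjective (hochschildZeroMk k A) := by
  intro c
  obtain ⟨⟨y, hy⟩, rfl⟩ := Submodule.mkQ_surjective _ c
  obtain ⟨a, rfl⟩ := (zeroEquiv k A).surjective y
  exact ⟨a, rfl⟩

theorem hochschildB_zero_snoc (x a : A) :
    hochschildB k A 0 (snoc (zeroEquiv k A x) a) = zeroEquiv k A (x * a - a * x) := by
  rw [hochschildB, LinearMap.add_apply, barB_zero_apply, LinearMap.smul_apply, LinearMap.comp_apply,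
    face_rotation_snoc_zeroEquiv, face_snoc_zeroEquiv, map_sub]
  module

theorem hochschildZeroMk_mul_comm (x a : A) :
    hochschildZeroMk k A (x * a) = hochschildZeroMk k A (a * x) := by
  rw [← sub_eq_zero, ← map_sub]
  exact (Submodule.Quotient.mk_eq_zero _).2 ⟨_, hochschildB_zero_snoc x a⟩

theorem exists_comp_hochschildZeroMk_eq {N : Type*} [AddCommGroup N] [Module k N] (f : A →ₗ[k] N)
    (hf : ∀ x a, f (x * a) = f (a * x)) :
    ∃ g : HochschildHomology k A 0 →ₗ[k] N, g ∘ₗ hochschildZeroMk k A = f := by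
  have comp_hochschildB (y : Chains k A 1) :
      f ((zeroEquiv k A).symm (hochschildB k A 0 y)) = 0 := by
    induction y using induction_snoc with
    | snoc x a =>
      obtain ⟨x, rfl⟩ := (zeroEquiv k A).surjective x
      rw [hochschildB_zero_snoc, LinearEquiv.symm_apply_apply, map_sub, hf, sub_self]
    | add y z hy hz => simp only [map_add, hy, hz, add_zero]
  refine ⟨Submodule.liftQ _ (f ∘ₗ (zeroEquiv k A).symm.toLinearMap ∘ₗ
    (hochschildCycles k A 0).subtype) ?_, LinearMap.ext fun x => ?_⟩
  · rintro ⟨_, _⟩ ⟨y, rfl⟩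
    exact comp_hochschildB y
  · exact congrArg f ((zeroEquiv k A).symm_apply_apply x)

end DegreeZero

/-! ### Generators and relations -/

namespace PathAlgebra

section Representation

variable {k V R : Type*} [Quiver V] [CommRing k] [Fintype V] [Ring R] [Algebra k R]

/-- Elements `e x` and `F f` of a ring, one for each vertex and each arrow, which satisfy the
relations that hold between the trivial paths and the arrows in a path algebra. -/
structure IsRepresentation (e : V → R) (F : ∀ ⦃x y : V⦄, (x ⟶ y) → R) : Prop where
  idem : ∀ x, e x * e x = e x
  ortho : ∀ x y, x ≠ y → e x * e y = 0
  sum : ∑ x, e x = 1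
  source : ∀ ⦃x y : V⦄ (f : x ⟶ y), F f * e x = F f
  target : ∀ ⦃x y : V⦄ (f : x ⟶ y), e y * F f = F f

/-- The product of the elements assigned to the arrows of a path. -/
def evalPath (e : V → R) (F : ∀ ⦃x y : V⦄, (x ⟶ y) → R) {x : V} :
    ∀ {y : V}, Quiver.Path x y → R
  | _, .nil => e x
  | _, .cons p f => F f * evalPath e F p

variable {e : V → R} {F : ∀ ⦃x y : V⦄, (x ⟶ y) → R}

variable (k e F) in
/-- The linear extension of `evalPath`. -/
noncomputable def evalLin : PathAlgebra k V →ₗ[k] R :=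
  Finsupp.linearCombination k (fun p : Σ x y : V, Quiver.Path x y => evalPath e F p.2.2)

omit [Fintype V] in
theorem evalLin_ofPath {x y : V} (p : Quiver.Path x y) :
    evalLin k e F (ofPath k p) = evalPath e F p :=
  (Finsupp.linearCombination_single k (1 : k) _).trans (one_smul _ _)

namespace IsRepresentation

variable (h : IsRepresentation e F)

include h

theorem evalPath_source {x y : V} (p : Quiver.Path x y) :
    evalPath e F p * e x = evalPath e F p := by
  induction p with
  | nil => exact h.idem x
  | cons p f ih => simp only [evalPath, mul_assoc, ih]

theorem evalPath_target {x y : V} (p : Quiver.Path x y) :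
    e y * evalPath e F p = evalPath e F p := by
  cases p with
  | nil => exact h.idem x
  | cons p f => simp only [evalPath, ← mul_assoc, h.target]

theorem evalPath_comp {x y z : V} (q : Quiver.Path x y) (p : Quiver.Path y z) :
    evalPath e F (q.comp p) = evalPath e F p * evalPath e F q := by
  induction p with
  | nil => exact (h.evalPath_target q).symm
  | cons p f ih => simp only [Quiver.Path.comp_cons, evalPath, mul_assoc, ih]

variable [DecidableEq V]

theorem evalLin_mul (f g : PathAlgebra k V) :
    evalLin k e F (f * g) = evalLin k e F f * evalLin k e F g := by
  change evalLin k e F (mulLin f g) = _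
  induction f using PathAlgebra.induction with
  | h0 => simp
  | hadd f f' hf hf' => simp [hf, hf', add_mul]
  | hsmul c f hf => simp [hf]
  | hpath y z p =>
  induction g using PathAlgebra.induction with
  | h0 => simp
  | hadd f f' hf hf' => simp [hf, hf', mul_add]
  | hsmul c f hf => simp [hf]
  | hpath x y' q =>
  by_cases hy : y' = y
  · subst hy
    rw [mulLin_ofPath_comp]
    simp only [evalLin_ofPath, h.evalPath_comp]
  · rw [mulLin_ofPath_ne _ _ hy, map_zero, evalLin_ofPath, evalLin_ofPath,
      ← h.evalPath_source p, ← h.evalPath_target q, mul_assoc, ← mul_assoc (e y),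
      h.ortho _ _ (Ne.symm hy), zero_mul, mul_zero]

variable (k) in
/-- The algebra homomorphism on the path algebra defined by its values on vertices and arrows. -/
noncomputable def hom : PathAlgebra k V →ₐ[k] R :=
  AlgHom.ofLinearMap (evalLin k e F)
    (by
      change evalLin k e F (∑ x : V, ofPath k (Quiver.Path.nil : Quiver.Path x x)) = 1
      rw [map_sum, ← h.sum]
      exact Finset.sum_congr rfl fun x _ => evalLin_ofPath _)
    h.evalLin_mul

theorem hom_nil (x : V) : h.hom k (ofPath k (Quiver.Path.nil : Quiver.Path x x)) = e x :=
  evalLin_ofPath _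

theorem hom_arrow {x y : V} (f : x ⟶ y) : h.hom k (ofPath k f.toPath) = F f := by
  refine (evalLin_ofPath _).trans ?_
  simp only [Quiver.Hom.toPath, evalPath, h.source]

end IsRepresentation

end Representation

end PathAlgebra

section Generators

variable (k : Type*) [CommRing k] (n : ℕ) [NeZero n]

/-- The projection of the path algebra onto the Auslander algebra. -/
noncomputable def proj : PathAlgebra k (Vertex n) →ₐ[k] AuslanderTaft k n := (meshCon k n).mkₐ k

theorem proj_surjective : Function.Surjective (proj k n) := (meshCon k n).mkₐ_surjective (α := k)

/-- The idempotent at the vertex `(i, u)`, as a function of the two coordinates. -/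
noncomputable def vert (i u : ZMod n) : AuslanderTaft k n := vertexIdem k n (i, u)

/-- The class of the arrow `a_{i,u}`, read as `0` where there is no such arrow. -/
noncomputable def arrA (i u : ZMod n) : AuslanderTaft k n := proj k n (arrowA k n i u)

/-- The class of the arrow `b_{i,u}`, read as `0` where there is no such arrow. -/
noncomputable def arrB (i u : ZMod n) : AuslanderTaft k n := proj k n (arrowB k n i u)

theorem vert_eq_proj (i u : ZMod n) : vert k n i u =
    proj k n (PathAlgebra.ofPath k (Quiver.Path.nil : Quiver.Path (V := Vertex n) (i, u) (i, u))) :=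
  rfl

variable {n}

theorem proj_eq_zero {r : PathAlgebra k (Vertex n)} (hr : r ∈ meshRelations k n) :
    proj k n r = 0 := by
  have hr : meshCon k n r 0 := TwoSidedIdeal.subset_span hr
  rw [← map_zero (proj k n)]
  exact Quotient.sound hr

theorem vert_mul_self (i u : ZMod n) : vert k n i u * vert k n i u = vert k n i u := by
  rw [vert_eq_proj, ← map_mul]
  exact congrArg _ (PathAlgebra.mulLin_ofPath_comp _ _)

theorem vert_mul_of_ne {i u j w : ZMod n} (h : ¬(i = j ∧ u = w)) :
    vert k n i u * vert k n j w = 0 := by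
  rw [vert_eq_proj, vert_eq_proj, ← map_mul, ← map_zero (proj k n)]
  exact congrArg _ (PathAlgebra.mulLin_ofPath_ne _ _ fun e => h (Prod.ext_iff.1 e.symm))

theorem sum_vert : ∑ x : Vertex n, vertexIdem k n x = 1 := by
  rw [← map_one (proj k n)]
  exact (map_sum (proj k n) _ _).symm

theorem arrA_eq_zero {i u : ZMod n} (h : u = i - 1) : arrA k n i u = 0 := by
  simp [arrA, arrowA, h]

theorem arrB_eq_zero {i u : ZMod n} (h : u = i) : arrB k n i u = 0 := by
  simp [arrB, arrowB, h]

theorem arrA_mul_vert (i u : ZMod n) : arrA k n i u * vert k n i u = arrA k n i u := by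
  rw [arrA, vert_eq_proj, ← map_mul, arrowA]
  split_ifs
  · exact congrArg _ (PathAlgebra.mulLin_ofPath_comp _ _)
  · rw [zero_mul]

theorem vert_mul_arrA (i u : ZMod n) : vert k n (i - 1) u * arrA k n i u = arrA k n i u := by
  rw [arrA, vert_eq_proj, ← map_mul, arrowA]
  split_ifs
  · exact congrArg _ (PathAlgebra.mulLin_ofPath_comp _ _)
  · rw [mul_zero]

theorem arrB_mul_vert (i u : ZMod n) : arrB k n i u * vert k n i u = arrB k n i u := by
  rw [arrB, vert_eq_proj, ← map_mul, arrowB]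
  split_ifs
  · exact congrArg _ (PathAlgebra.mulLin_ofPath_comp _ _)
  · rw [zero_mul]

theorem vert_mul_arrB (i u : ZMod n) : vert k n i (u - 1) * arrB k n i u = arrB k n i u := by
  rw [arrB, vert_eq_proj, ← map_mul, arrowB]
  split_ifs
  · exact congrArg _ (PathAlgebra.mulLin_ofPath_comp _ _)
  · rw [mul_zero]

theorem arrA_mul_arrB {i u : ZMod n} (h : u ≠ i) :
    arrA k n i (u - 1) * arrB k n i u = -(arrB k n (i - 1) u * arrA k n i u) := by
  by_cases h' : u = i - 1
  · subst h'
    rw [arrA_eq_zero k rfl, mul_zero, neg_zero, arrA, arrB, ← map_mul, sub_sub, one_add_one_eq_two]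
    exact proj_eq_zero k (Or.inl ⟨i, rfl⟩)
  · rw [eq_neg_iff_add_eq_zero]
    simp only [arrA, arrB, ← map_mul, ← map_add]
    exact proj_eq_zero k (Or.inr ⟨i, u, h, h', rfl⟩)

variable (n) in
/-- The sum of all arrows `a_{i,u}`. -/
noncomputable def totalA : AuslanderTaft k n := ∑ x : ZMod n × ZMod n, arrA k n x.1 x.2

variable (n) in
/-- The sum of all arrows `b_{i,u}`. -/
noncomputable def totalB : AuslanderTaft k n := ∑ x : ZMod n × ZMod n, arrB k n x.1 x.2

theorem sum_mul_vert {f : ZMod n → ZMod n → AuslanderTaft k n}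
    (hf : ∀ i u, f i u * vert k n i u = f i u) (i u : ZMod n) :
    (∑ x : ZMod n × ZMod n, f x.1 x.2) * vert k n i u = f i u := by
  rw [Finset.sum_mul, Finset.sum_eq_single (i, u)]
  · exact hf i u
  · intro x _ hx
    rw [← hf, mul_assoc, vert_mul_of_ne k fun h => hx (Prod.ext h.1 h.2), mul_zero]
  · simp

theorem totalA_mul_vert_eq_arrA (i u : ZMod n) : totalA k n * vert k n i u = arrA k n i u :=
  sum_mul_vert k (arrA_mul_vert k) i u

theorem totalB_mul_vert_eq_arrB (i u : ZMod n) : totalB k n * vert k n i u = arrB k n i u :=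
  sum_mul_vert k (arrB_mul_vert k) i u

theorem totalA_mul_vert (i u : ZMod n) :
    totalA k n * vert k n i u = vert k n (i - 1) u * totalA k n := by
  rw [totalA_mul_vert_eq_arrA, totalA, Finset.mul_sum, Finset.sum_eq_single (i, u)]
  · exact (vert_mul_arrA k i u).symm
  · intro x _ hx
    rw [← vert_mul_arrA, ← mul_assoc, vert_mul_of_ne, zero_mul]
    exact fun h => hx (Prod.ext (sub_left_injective h.1).symm h.2.symm)
  · simp

theorem totalB_mul_vert (i u : ZMod n) :
    totalB k n * vert k n i u = vert k n i (u - 1) * totalB k n := by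
  rw [totalB_mul_vert_eq_arrB, totalB, Finset.mul_sum, Finset.sum_eq_single (i, u)]
  · exact (vert_mul_arrB k i u).symm
  · intro x _ hx
    rw [← vert_mul_arrB, ← mul_assoc, vert_mul_of_ne, zero_mul]
    exact fun h => hx (Prod.ext h.1.symm (sub_left_injective h.2).symm)
  · simp

theorem totalA_mul_vert_eq_zero {i u : ZMod n} (h : u = i - 1) :
    totalA k n * vert k n i u = 0 := by
  rw [totalA_mul_vert_eq_arrA, arrA_eq_zero k h]

theorem totalB_mul_vert_self (i : ZMod n) : totalB k n * vert k n i i = 0 := by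
  rw [totalB_mul_vert_eq_arrB, arrB_eq_zero k rfl]

theorem totalA_mul_totalB_mul_vert {i u : ZMod n} (h : u ≠ i) :
    totalA k n * (totalB k n * vert k n i u) = -(totalB k n * (totalA k n * vert k n i u)) := by
  have hB : totalB k n * arrA k n i u = arrB k n (i - 1) u * arrA k n i u := by
    rw [← totalB_mul_vert_eq_arrB, mul_assoc, vert_mul_arrA]
  have hA : totalA k n * arrB k n i u = arrA k n i (u - 1) * arrB k n i u := by
    rw [← totalA_mul_vert_eq_arrA, mul_assoc, vert_mul_arrB]
  rw [totalA_mul_vert_eq_arrA, totalB_mul_vert_eq_arrB, hA, hB, arrA_mul_arrB k h]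

variable {k} in
theorem generators_induction {P : AuslanderTaft k n → Prop}
    (add : ∀ x y, P x → P y → P (x + y)) (smul : ∀ (c : k) x, P x → P (c • x))
    (mul : ∀ x y, P x → P y → P (x * y)) (vert : ∀ i u, P (vert k n i u))
    (a : P (totalA k n)) (b : P (totalB k n)) (x : AuslanderTaft k n) : P x := by
  obtain ⟨x, rfl⟩ := proj_surjective k n x
  induction x using PathAlgebra.induction with
  | h0 => simpa using smul 0 _ (vert 0 0)
  | hadd f g hf hg => simpa using add _ _ hf hg
  | hsmul c f hf => simpa using smul c _ hf
  | hpath x y p =>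
    induction p with
    | nil => exact vert x.1 x.2
    | cons p f ih =>
      have cons_eq_mul : PathAlgebra.ofPath k (p.cons f) =
          PathAlgebra.ofPath k f.toPath * PathAlgebra.ofPath k p :=
        (PathAlgebra.mulLin_ofPath_comp (k := k) (Quiver.Hom.toPath f) p).symm
      rw [cons_eq_mul, map_mul]
      refine mul _ _ ?_ ih
      obtain ⟨i, u, h⟩ | ⟨i, u, h⟩ := f
      · simpa [totalA_mul_vert_eq_arrA, arrA, arrowA, h] using mul _ _ a (vert i u)
      · simpa [totalB_mul_vert_eq_arrB, arrB, arrowB, h] using mul _ _ b (vert i u)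

/-- The algebra homomorphism defined by a homomorphism on the path algebra that respects the mesh
relations. -/
noncomputable def liftHom {R : Type*} [Ring R] [Algebra k R] (f : PathAlgebra k (Vertex n) →ₐ[k] R)
    (hf : ∀ r ∈ meshRelations k n, f r = 0) : AuslanderTaft k n →ₐ[k] R :=
  (meshCon k n).liftₐ f (by
    have h : TwoSidedIdeal.span (meshRelations k n) ≤ TwoSidedIdeal.ker f :=
      TwoSidedIdeal.span_le.2 fun r hr => (TwoSidedIdeal.mem_ker f).2 (hf r hr)
    exact TwoSidedIdeal.ringCon_le_iff.1 h)

end Generators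

/-! ### The semisimple quotient -/

section Augmentation

variable (k : Type*) [CommRing k] (n : ℕ) [NeZero n]

theorem isRepresentation_augmentation :
    PathAlgebra.IsRepresentation (V := Vertex n) (fun x => (Pi.single x 1 : Vertex n → k))
      (fun _ _ _ => 0) where
  idem x := by simp [← Pi.single_mul]
  ortho x y h := by
    ext z
    by_cases hz : z = x <;> simp_all [Pi.single_apply]
  sum := Finset.univ_sum_single 1
  source _ _ _ := zero_mul _
  target _ _ _ := mul_zero _

theorem hom_augmentation_arrowA (i u : ZMod n) :
    (isRepresentation_augmentation k n).hom k (arrowA k n i u) = 0 := by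
  rw [arrowA]
  split_ifs
  · exact (isRepresentation_augmentation k n).hom_arrow _
  · exact map_zero _

theorem hom_augmentation_arrowB (i u : ZMod n) :
    (isRepresentation_augmentation k n).hom k (arrowB k n i u) = 0 := by
  rw [arrowB]
  split_ifs
  · exact (isRepresentation_augmentation k n).hom_arrow _
  · exact map_zero _

/-- The projection of the Auslander algebra onto its semisimple quotient, which kills the arrows. -/
noncomputable def augmentation : AuslanderTaft k n →ₐ[k] (Vertex n → k) :=
  liftHom k ((isRepresentation_augmentation k n).hom k) (by
    rintro r (⟨i, rfl⟩ | ⟨i, u, -, -, rfl⟩) <;>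
      simp [hom_augmentation_arrowA, hom_augmentation_arrowB])

theorem augmentation_vertexIdem (x : Vertex n) :
    augmentation k n (vertexIdem k n x) = Pi.single x 1 :=
  (isRepresentation_augmentation k n).hom_nil x

theorem augmentation_totalA : augmentation k n (totalA k n) = 0 := by
  rw [totalA, map_sum]
  exact Finset.sum_eq_zero fun x _ => hom_augmentation_arrowA k n x.1 x.2

theorem augmentation_totalB : augmentation k n (totalB k n) = 0 := by
  rw [totalB, map_sum]
  exact Finset.sum_eq_zero fun x _ => hom_augmentation_arrowB k n x.1 x.2

/-- The character of the Auslander algebra through which it acts on the simple module at the vertex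
`(i, u)`. -/
noncomputable def vertexCharacter (i u : ZMod n) : AuslanderTaft k n →ₐ[k] k :=
  (Pi.evalAlgHom k (fun _ : Vertex n => k) (i, u)).comp (augmentation k n)

theorem vertexCharacter_vert (i u j w : ZMod n) :
    vertexCharacter k n i u (vert k n j w) = if i = j ∧ u = w then 1 else 0 := by
  have h : vertexCharacter k n i u (vert k n j w) = Pi.single (M := fun _ => k) (j, w) 1 (i, u) :=
    congrFun (augmentation_vertexIdem k n (j, w)) (i, u)
  rw [h, Pi.single_apply]
  exact if_congr Prod.ext_iff rfl rfl

theorem vertexCharacter_totalA (i u : ZMod n) : vertexCharacter k n i u (totalA k n) = 0 :=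
  congrFun (augmentation_totalA k n) (i, u)

theorem vertexCharacter_totalB (i u : ZMod n) : vertexCharacter k n i u (totalB k n) = 0 :=
  congrFun (augmentation_totalB k n) (i, u)

end Augmentation

section Height

variable {n : ℕ}

/-- The distance of the vertex `(i, u)` from the circle of the vertices `(i, i)`. The arrows `a`
raise it and the arrows `b` lower it by one; the vertices `(i, i - 1)` have the largest height,
`n - 1`. -/
def height (i u : ZMod n) : ℕ := (u - i).val

theorem height_eq_of_natCast {i u : ZMod n} {h : ℕ} (hn : h < n) (hh : (h : ZMod n) = u - i) :
    height i u = h := by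
  rw [height, ← hh, ZMod.val_cast_of_lt hn]

variable [NeZero n]

theorem height_lt (i u : ZMod n) : height i u < n := ZMod.val_lt _

theorem natCast_height (i u : ZMod n) : (height i u : ZMod n) = u - i := ZMod.natCast_zmod_val _

theorem height_add_one_lt {i u : ZMod n} (h : u ≠ i - 1) : height i u + 1 < n := by
  refine lt_of_le_of_ne (height_lt i u) fun e => h ?_
  have e := congrArg (Nat.cast : ℕ → ZMod n) e
  rw [Nat.cast_add, natCast_height, Nat.cast_one, ZMod.natCast_self] at e
  linear_combination e

theorem height_sub_one_left {i u : ZMod n} (h : u ≠ i - 1) : height (i - 1) u = height i u + 1 :=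
  height_eq_of_natCast (height_add_one_lt h)
    (by rw [Nat.cast_add, natCast_height, Nat.cast_one]; ring)

theorem height_sub_one_right {i u : ZMod n} (h : u ≠ i) : height i (u - 1) + 1 = height i u := by
  have h' : u - 1 ≠ i - 1 := fun e => h (sub_left_injective e)
  exact (height_eq_of_natCast (height_add_one_lt h')
    (by rw [Nat.cast_add, natCast_height, Nat.cast_one]; ring)).symm

theorem height_sub_natCast_left {i u : ZMod n} {s : ℕ} (hs : height i u + s < n) :
    height (i - (s : ZMod n)) u = height i u + s :=
  height_eq_of_natCast hs (by rw [Nat.cast_add, natCast_height]; ring)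

end Height

/-! ### Powers of the arrows -/

section Powers

variable (k : Type*) [CommRing k] {n : ℕ} [NeZero n]

theorem totalA_pow_mul_vert (i u : ZMod n) (s : ℕ) :
    totalA k n ^ s * vert k n i u = vert k n (i - s) u * totalA k n ^ s := by
  induction s with
  | zero => simp
  | succ s ih =>
    rw [pow_succ', mul_assoc, ih, ← mul_assoc, totalA_mul_vert, mul_assoc, Nat.cast_succ, sub_sub]

theorem totalB_pow_mul_vert (i u : ZMod n) (t : ℕ) :
    totalB k n ^ t * vert k n i u = vert k n i (u - t) * totalB k n ^ t := by
  induction t with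
  | zero => simp
  | succ t ih =>
    rw [pow_succ', mul_assoc, ih, ← mul_assoc, totalB_mul_vert, mul_assoc, Nat.cast_succ, sub_sub]

theorem totalA_pow_mul_vert_eq_zero {i u : ZMod n} {s : ℕ} (h : n ≤ height i u + s) :
    totalA k n ^ s * vert k n i u = 0 := by
  obtain ⟨r, hr⟩ : ∃ r, height i u + (r + 1) = n :=
    ⟨n - 1 - height i u, by have := height_lt i u; omega⟩
  have cast_eq : u = i - r - 1 := by
    have hr := congrArg (Nat.cast : ℕ → ZMod n) hr
    rw [Nat.cast_add, natCast_height, Nat.cast_succ, ZMod.natCast_self] at hr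
    linear_combination hr
  obtain ⟨m, rfl⟩ : ∃ m, s = m + (r + 1) := ⟨s - (r + 1), by omega⟩
  rw [pow_add, pow_succ', mul_assoc, mul_assoc, totalA_pow_mul_vert, ← mul_assoc (totalA k n),
    totalA_mul_vert_eq_zero k cast_eq, zero_mul, mul_zero]

theorem totalB_pow_mul_vert_eq_zero {i u : ZMod n} {t : ℕ} (h : height i u < t) :
    totalB k n ^ t * vert k n i u = 0 := by
  obtain ⟨m, rfl⟩ : ∃ m, t = m + (height i u + 1) := ⟨t - (height i u + 1), by omega⟩
  rw [pow_add, pow_succ', mul_assoc, mul_assoc, totalB_pow_mul_vert, natCast_height,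
    sub_sub_cancel, ← mul_assoc (totalB k n), totalB_mul_vert_self, zero_mul, mul_zero]

theorem exists_totalA_pow_mul_totalB (i u : ZMod n) (s : ℕ) :
    ∃ y, totalA k n ^ s * (totalB k n * vert k n i u) = y * (totalA k n ^ s * vert k n i u) := by
  induction s generalizing i with
  | zero => exact ⟨totalB k n, by simp⟩
  | succ s ih =>
    by_cases h : u = i
    · subst h
      exact ⟨0, by rw [totalB_mul_vert_self, mul_zero, zero_mul]⟩
    · obtain ⟨y, hy⟩ := ih (i - 1)
      refine ⟨-y, ?_⟩
      calc totalA k n ^ (s + 1) * (totalB k n * vert k n i u)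
          = totalA k n ^ s * (totalA k n * (totalB k n * vert k n i u)) := by
            rw [pow_succ, mul_assoc]
        _ = -(totalA k n ^ s * (totalB k n * vert k n (i - 1) u)) * totalA k n := by
            rw [totalA_mul_totalB_mul_vert k h, totalA_mul_vert]
            simp only [mul_neg, neg_mul, mul_assoc]
        _ = -y * (totalA k n ^ (s + 1) * vert k n i u) := by
            rw [hy, pow_succ, mul_assoc (totalA k n ^ s) (totalA k n), totalA_mul_vert]
            simp only [neg_mul, mul_assoc]

theorem exists_totalA_mul_totalB_pow (i u : ZMod n) (t : ℕ) :
    ∃ y, totalA k n * (totalB k n ^ t * vert k n i u) = y * (totalA k n * vert k n i u) := by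
  induction t with
  | zero => exact ⟨1, by simp⟩
  | succ t ih =>
    obtain ⟨y, hy⟩ := ih
    have pow_eq : totalB k n ^ (t + 1) * vert k n i u =
        totalB k n * vert k n i (u - t) * totalB k n ^ t := by
      rw [pow_succ', mul_assoc, totalB_pow_mul_vert, mul_assoc]
    by_cases h : u - t = i
    · exact ⟨0, by rw [pow_eq, h, totalB_mul_vert_self, zero_mul, mul_zero, zero_mul]⟩
    · refine ⟨-(totalB k n * y), ?_⟩
      rw [pow_eq, ← mul_assoc, totalA_mul_totalB_mul_vert k h, neg_mul, mul_assoc, mul_assoc,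
        ← totalB_pow_mul_vert, hy, neg_mul, mul_assoc]

theorem mul_vert_mem_span_totalB_pow_sup (i u : ZMod n) (x : AuslanderTaft k n) :
    x * vert k n i u ∈ Submodule.span k (Set.range fun t => totalB k n ^ t * vert k n i u) ⊔
      LinearMap.range (LinearMap.mulRight k (totalA k n * vert k n i u)) := by
  set M := Submodule.span k (Set.range fun t => totalB k n ^ t * vert k n i u) ⊔
    LinearMap.range (LinearMap.mulRight k (totalA k n * vert k n i u))
  suffices h : ∀ y ∈ M, x * y ∈ M from
    h _ (Submodule.mem_sup_left (Submodule.subset_span ⟨0, by simp⟩))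
  have mul_mem (r : AuslanderTaft k n)
      (hr : ∀ t, r * (totalB k n ^ t * vert k n i u) ∈ M) : ∀ y ∈ M, r * y ∈ M := by
    suffices h : M ≤ M.comap (LinearMap.mulLeft k r) from h
    refine sup_le (Submodule.span_le.2 ?_) ?_
    · rintro _ ⟨t, rfl⟩
      exact hr t
    · rintro _ ⟨y, rfl⟩
      exact Submodule.mem_sup_right ⟨r * y, mul_assoc _ _ _⟩
  induction x using generators_induction with
  | add r s hr hs => exact fun y hy => by rw [add_mul]; exact M.add_mem (hr y hy) (hs y hy)
  | smul c r hr => exact fun y hy => by rw [smul_mul_assoc]; exact M.smul_mem c (hr y hy)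
  | mul r s hr hs => exact fun y hy => by rw [mul_assoc]; exact hr _ (hs y hy)
  | vert j w =>
    refine mul_mem _ fun t => ?_
    by_cases h : j = i ∧ w = u - t
    · rw [totalB_pow_mul_vert, h.1, h.2, ← mul_assoc, vert_mul_self, ← totalB_pow_mul_vert]
      exact Submodule.mem_sup_left (Submodule.subset_span ⟨t, rfl⟩)
    · rw [totalB_pow_mul_vert, ← mul_assoc, vert_mul_of_ne k h, zero_mul]
      exact M.zero_mem
  | a =>
    refine mul_mem _ fun t => ?_
    obtain ⟨y, hy⟩ := exists_totalA_mul_totalB_pow k i u t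
    exact Submodule.mem_sup_right ⟨y, hy.symm⟩
  | b =>
    refine mul_mem _ fun t => Submodule.mem_sup_left (Submodule.subset_span ⟨t + 1, ?_⟩)
    simp only [pow_succ', mul_assoc]

/-- The path `b^t a^s` starting at `(i, u)`. These paths span the algebra, and those that do not
leave the quiver form a basis. -/
noncomputable def monomial (i u : ZMod n) (s t : ℕ) : AuslanderTaft k n :=
  totalB k n ^ t * (totalA k n ^ s * vert k n i u)

theorem monomial_mul_vert (i u j w : ZMod n) (s t : ℕ) :
    monomial k i u s t * vert k n j w = if i = j ∧ u = w then monomial k i u s t else 0 := by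
  rw [monomial, mul_assoc, mul_assoc]
  split_ifs with h
  · rw [← h.1, ← h.2, vert_mul_self]
  · rw [vert_mul_of_ne k h, mul_zero, mul_zero]

theorem monomial_eq_zero {i u : ZMod n} {s t : ℕ}
    (h : ¬(t ≤ height i u + s ∧ height i u + s < n)) : monomial k i u s t = 0 := by
  obtain hs | hs := le_or_gt n (height i u + s)
  · rw [monomial, totalA_pow_mul_vert_eq_zero k hs, mul_zero]
  · rw [monomial, totalA_pow_mul_vert, ← mul_assoc, totalB_pow_mul_vert_eq_zero, zero_mul]
    rw [height_sub_natCast_left hs]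
    omega

theorem monomial_mul_totalA (i u : ZMod n) (s t : ℕ) :
    monomial k (i - 1) u s t * totalA k n = monomial k i u (s + 1) t := by
  rw [monomial, monomial, mul_assoc, mul_assoc, ← totalA_mul_vert, pow_succ, mul_assoc]

theorem mul_vert_mem_span_monomial (i u : ZMod n) (x : AuslanderTaft k n) :
    x * vert k n i u ∈
      Submodule.span k (Set.range fun st : ℕ × ℕ => monomial k i u st.1 st.2) := by
  induction hm : n - height i u generalizing i x with
  | zero => exact absurd (height_lt i u) (by omega)
  | succ m ih =>
    obtain ⟨p, hp, _, ⟨y, rfl⟩, hpy⟩ :=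
      Submodule.mem_sup.1 (mul_vert_mem_span_totalB_pow_sup k i u x)
    rw [← hpy]
    refine add_mem (Submodule.span_mono ?_ hp) ?_
    · rintro _ ⟨t, rfl⟩
      refine ⟨(0, t), ?_⟩
      simp only [monomial, pow_zero, one_mul]
    · rw [LinearMap.mulRight_apply]
      by_cases hu : u = i - 1
      · rw [totalA_mul_vert_eq_zero k hu, mul_zero]
        exact zero_mem _
      · rw [totalA_mul_vert, ← mul_assoc]
        have hy := Submodule.mem_map_of_mem (f := LinearMap.mulRight k (totalA k n))
          (ih (i := i - 1) y (by rw [height_sub_one_left hu]; omega))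
        rw [Submodule.map_span] at hy
        refine Submodule.span_mono ?_ hy
        rintro _ ⟨_, ⟨⟨s, t⟩, rfl⟩, rfl⟩
        exact ⟨(s + 1, t), (monomial_mul_totalA k i u s t).symm⟩

end Powers

/-! ### Ladder representations and the basis of monomials -/

section Ladder

variable (k : Type*) [CommRing k] {n : ℕ}

/-- The operator through which the arrows `a` act on the ladder module with basis the pairs
`(p, q)`. -/
noncomputable def ladderA (n : ℕ) : Module.End k (ℕ × ℕ →₀ k) :=
  Finsupp.linearCombination k fun b =>
    if b.2 ≤ b.1 ∧ b.1 + 1 < n then Finsupp.single (b.1 + 1, b.2) 1 else 0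

/-- The operator through which the arrows `b` act on the ladder module; the sign makes it
anticommute with `ladderA`. -/
noncomputable def ladderB (n : ℕ) : Module.End k (ℕ × ℕ →₀ k) :=
  Finsupp.linearCombination k fun b =>
    if b.2 < b.1 ∧ b.1 < n then (-1 : k) ^ b.1 • Finsupp.single (b.1, b.2 + 1) 1 else 0

/-- The projection of the ladder module onto the span of the pairs `(p, q)` that lie over the vertex
`(i, w)`, where `(p, q)` lies over `(u - p, u - q)`. -/
noncomputable def ladderVert (u i w : ZMod n) : Module.End k (ℕ × ℕ →₀ k) :=
  Finsupp.linearCombination k fun b =>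
    if u - b.1 = i ∧ u - b.2 = w then Finsupp.single b 1 else 0

variable {k}

theorem ladderA_single (p q : ℕ) : ladderA k n (Finsupp.single (p, q) 1) =
    if q ≤ p ∧ p + 1 < n then Finsupp.single (p + 1, q) 1 else 0 := by
  rw [ladderA, Finsupp.linearCombination_single, one_smul]

theorem ladderB_single (p q : ℕ) : ladderB k n (Finsupp.single (p, q) 1) =
    if q < p ∧ p < n then (-1 : k) ^ p • Finsupp.single (p, q + 1) 1 else 0 := by
  rw [ladderB, Finsupp.linearCombination_single, one_smul]

theorem ladderVert_single (u i w : ZMod n) (p q : ℕ) :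
    ladderVert k u i w (Finsupp.single (p, q) 1) =
      if u - p = i ∧ u - q = w then Finsupp.single (p, q) 1 else 0 := by
  rw [ladderVert, Finsupp.linearCombination_single, one_smul]

theorem ladder_ext {f g : Module.End k (ℕ × ℕ →₀ k)}
    (h : ∀ p q, f (Finsupp.single (p, q) 1) = g (Finsupp.single (p, q) 1)) : f = g :=
  Finsupp.lhom_ext' fun b => LinearMap.ext_ring (h b.1 b.2)

theorem ladderVert_mul_ladderA (u i w : ZMod n) :
    ladderVert k u (i - 1) w * ladderA k n = ladderA k n * ladderVert k u i w := by
  refine ladder_ext fun p q => ?_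
  simp only [Module.End.mul_apply, ladderA_single, ladderVert_single, apply_ite, map_zero,
    Nat.cast_succ, ← sub_sub, sub_left_inj]
  split_ifs <;> rfl

theorem ladderVert_mul_ladderB (u i w : ZMod n) :
    ladderVert k u i (w - 1) * ladderB k n = ladderB k n * ladderVert k u i w := by
  refine ladder_ext fun p q => ?_
  simp only [Module.End.mul_apply, ladderB_single, ladderVert_single, apply_ite, map_zero, map_smul,
    Nat.cast_succ, ← sub_sub, sub_left_inj, smul_zero]
  split_ifs <;> rfl

theorem ladderVert_mul_self (u i w : ZMod n) :
    ladderVert k u i w * ladderVert k u i w = ladderVert k u i w := by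
  refine ladder_ext fun p q => ?_
  by_cases h : u - p = i ∧ u - q = w <;> simp [ladderVert_single, h]

theorem ladderVert_mul_of_ne (u : ZMod n) {i w j v : ZMod n} (h : ¬(i = j ∧ w = v)) :
    ladderVert k u i w * ladderVert k u j v = 0 := by
  refine ladder_ext fun p q => ?_
  by_cases hpq : u - p = j ∧ u - q = v
  · have hpq' : ¬(u - p = i ∧ u - q = w) := fun e =>
      h ⟨e.1.symm.trans hpq.1, e.2.symm.trans hpq.2⟩
    rw [Module.End.mul_apply, ladderVert_single, if_pos hpq, ladderVert_single, if_neg hpq',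
      LinearMap.zero_apply]
  · simp [ladderVert_single, hpq]

theorem sum_ladderVert [NeZero n] (u : ZMod n) :
    ∑ x : ZMod n × ZMod n, ladderVert k u x.1 x.2 = 1 := by
  refine ladder_ext fun p q => ?_
  rw [LinearMap.sum_apply, Finset.sum_eq_single (u - p, u - q), ladderVert_single,
    if_pos ⟨rfl, rfl⟩, Module.End.one_apply]
  · rintro ⟨i, w⟩ - hx
    rw [ladderVert_single, if_neg fun h => hx (Prod.ext h.1.symm h.2.symm)]
  · simp

theorem eq_of_sub_natCast_eq (u : ZMod n) {p q : ℕ} (hp : p < n) (hq : q < n)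
    (h : u - p = u - q) : p = q :=
  CharP.natCast_injOn_Iio (ZMod n) n hp hq (sub_right_injective h)

theorem ladderA_mul_ladderVert_eq_zero (u : ZMod n) {i w : ZMod n} (h : w = i - 1) :
    ladderA k n * ladderVert k u i w = 0 := by
  refine ladder_ext fun p q => ?_
  rw [Module.End.mul_apply, ladderVert_single, LinearMap.zero_apply]
  split_ifs with hpq
  · obtain ⟨rfl, rfl⟩ := hpq
    rw [ladderA_single, if_neg]
    rintro ⟨hqp, hpn⟩
    have := eq_of_sub_natCast_eq u (by omega) hpn (h.trans (by rw [Nat.cast_succ, sub_sub]))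
    omega
  · exact map_zero _

theorem ladderB_mul_ladderVert_self (u i : ZMod n) :
    ladderB k n * ladderVert k u i i = 0 := by
  refine ladder_ext fun p q => ?_
  rw [Module.End.mul_apply, ladderVert_single, LinearMap.zero_apply]
  split_ifs with hpq
  · rw [ladderB_single, if_neg]
    rintro ⟨hqp, hpn⟩
    have := eq_of_sub_natCast_eq u hpn (by omega) (hpq.1.trans hpq.2.symm)
    omega
  · exact map_zero _

theorem ladderA_mul_ladderB_mul_ladderVert (u : ZMod n) {i w : ZMod n} (h : w ≠ i) :
    ladderA k n * (ladderB k n * ladderVert k u i w) =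
      -(ladderB k n * (ladderA k n * ladderVert k u i w)) := by
  refine ladder_ext fun p q => ?_
  by_cases hpq : u - p = i ∧ u - q = w
  · have hne : q ≠ p := by
      rintro rfl
      exact h (hpq.2.symm.trans hpq.1)
    simp only [Module.End.mul_apply, LinearMap.neg_apply, ladderVert_single, if_pos hpq,
      ladderA_single, ladderB_single, apply_ite, map_zero, map_smul, pow_succ, smul_zero]
    split_ifs <;> first | omega | simp
  · simp [ladderVert_single, hpq]

theorem ladderA_pow_single {h s : ℕ} (hs : h + s < n) :
    (ladderA k n ^ s) (Finsupp.single (h, 0) 1) = Finsupp.single (h + s, 0) 1 := by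
  induction s with
  | zero => rfl
  | succ s ih =>
    rw [pow_succ', Module.End.mul_apply, ih (by omega), ladderA_single,
      if_pos ⟨Nat.zero_le _, by omega⟩]
    rfl

theorem ladderB_pow_single {h t : ℕ} (ht : t ≤ h) (hn : h < n) :
    (ladderB k n ^ t) (Finsupp.single (h, 0) 1) =
      ((-1 : k) ^ h) ^ t • Finsupp.single (h, t) 1 := by
  induction t with
  | zero => simp
  | succ t ih =>
    rw [pow_succ', Module.End.mul_apply, ih (by omega), map_smul, ladderB_single,
      if_pos ⟨by omega, hn⟩, smul_smul, ← pow_succ]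

variable (k) in
/-- The operator through which an arrow of the quiver acts on the ladder module. -/
noncomputable def ladderArrow (u : ZMod n) ⦃x y : Vertex n⦄ (f : x ⟶ y) :
    Module.End k (ℕ × ℕ →₀ k) :=
  match y, (show Arrow n x y from f) with
  | _, Arrow.a _ _ _ => ladderA k n * ladderVert k u x.1 x.2
  | _, Arrow.b _ _ _ => ladderB k n * ladderVert k u x.1 x.2

variable (k) [NeZero n]

theorem isRepresentation_ladder (u : ZMod n) :
    PathAlgebra.IsRepresentation (fun x : Vertex n => ladderVert k u x.1 x.2)
      (ladderArrow k u) where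
  idem x := ladderVert_mul_self u x.1 x.2
  ortho _ _ h := ladderVert_mul_of_ne u fun e => h (Prod.ext e.1 e.2)
  sum := sum_ladderVert u
  source _ _ f := by
    obtain ⟨i, w, h⟩ | ⟨i, w, h⟩ := f <;> simp only [ladderArrow, mul_assoc, ladderVert_mul_self]
  target _ _ f := by
    obtain ⟨i, w, h⟩ | ⟨i, w, h⟩ := f
    · simp only [ladderArrow, ← ladderVert_mul_ladderA, ← mul_assoc, ladderVert_mul_self]
    · simp only [ladderArrow, ← ladderVert_mul_ladderB, ← mul_assoc, ladderVert_mul_self]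

theorem hom_ladder_arrowA (u i w : ZMod n) :
    (isRepresentation_ladder k u).hom k (arrowA k n i w) = ladderA k n * ladderVert k u i w := by
  rw [arrowA]
  split_ifs with h
  · exact (isRepresentation_ladder k u).hom_arrow _
  · rw [map_zero, ladderA_mul_ladderVert_eq_zero u (not_not.1 h)]

theorem hom_ladder_arrowB (u i w : ZMod n) :
    (isRepresentation_ladder k u).hom k (arrowB k n i w) = ladderB k n * ladderVert k u i w := by
  rw [arrowB]
  split_ifs with h
  · exact (isRepresentation_ladder k u).hom_arrow _
  · rw [map_zero, not_not.1 h, ladderB_mul_ladderVert_self]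

theorem hom_ladder_arrowA_mul_arrowB (u i w : ZMod n) :
    (isRepresentation_ladder k u).hom k (arrowA k n i (w - 1) * arrowB k n i w) =
      ladderA k n * (ladderB k n * ladderVert k u i w) := by
  rw [map_mul, hom_ladder_arrowA, hom_ladder_arrowB, ← ladderVert_mul_ladderB, mul_assoc,
    ← mul_assoc (ladderVert k u i (w - 1)), ladderVert_mul_self]

theorem hom_ladder_arrowB_mul_arrowA (u i w : ZMod n) :
    (isRepresentation_ladder k u).hom k (arrowB k n (i - 1) w * arrowA k n i w) =
      ladderB k n * (ladderA k n * ladderVert k u i w) := by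
  rw [map_mul, hom_ladder_arrowA, hom_ladder_arrowB, ← ladderVert_mul_ladderA, mul_assoc,
    ← mul_assoc (ladderVert k u (i - 1) w), ladderVert_mul_self]

theorem hom_ladder_boundary (u i : ZMod n) :
    (isRepresentation_ladder k u).hom k (arrowA k n i (i - 2) * arrowB k n i (i - 1)) = 0 := by
  rw [show i - 2 = i - 1 - 1 by ring, hom_ladder_arrowA_mul_arrowB]
  by_cases h : i - 1 = i
  · rw [h, ladderB_mul_ladderVert_self, mul_zero]
  · rw [ladderA_mul_ladderB_mul_ladderVert u h, ladderA_mul_ladderVert_eq_zero u rfl, mul_zero]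
    exact neg_zero (G := Module.End k (ℕ × ℕ →₀ k))

/-- The ladder representation with parameter `u`. Acting on the vector `(height i u, 0)`, it
identifies the projective module at `(i, u)` with a submodule of the ladder module. -/
noncomputable def ladder (u : ZMod n) : AuslanderTaft k n →ₐ[k] Module.End k (ℕ × ℕ →₀ k) :=
  liftHom (R := Module.End k (ℕ × ℕ →₀ k)) k ((isRepresentation_ladder k u).hom k) (by
    rintro r (⟨i, rfl⟩ | ⟨i, w, h, -, rfl⟩)
    · exact hom_ladder_boundary k u i
    · rw [map_add, hom_ladder_arrowA_mul_arrowB, hom_ladder_arrowB_mul_arrowA,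
        ladderA_mul_ladderB_mul_ladderVert u h]
      exact neg_add_cancel (G := Module.End k (ℕ × ℕ →₀ k)) _)

theorem ladder_vert (u i w : ZMod n) : ladder k u (vert k n i w) = ladderVert k u i w :=
  (isRepresentation_ladder k u).hom_nil (i, w)

theorem ladder_totalA (u : ZMod n) : ladder k u (totalA k n) = ladderA k n := by
  rw [totalA, map_sum, ← mul_one (ladderA k n), ← sum_ladderVert u, Finset.mul_sum]
  exact Finset.sum_congr rfl fun x _ => hom_ladder_arrowA k u x.1 x.2

theorem ladder_totalB (u : ZMod n) : ladder k u (totalB k n) = ladderB k n := by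
  rw [totalB, map_sum, ← mul_one (ladderB k n), ← sum_ladderVert u, Finset.mul_sum]
  exact Finset.sum_congr rfl fun x _ => hom_ladder_arrowB k u x.1 x.2

variable {k}

theorem ladder_mul_vert_single (i u : ZMod n) (x : AuslanderTaft k n) :
    ladder k u (x * vert k n i u) (Finsupp.single (height i u, 0) 1) =
      ladder k u x (Finsupp.single (height i u, 0) 1) := by
  rw [map_mul, Module.End.mul_apply, ladder_vert, ladderVert_single,
    if_pos ⟨by rw [natCast_height, sub_sub_cancel], by rw [Nat.cast_zero, sub_zero]⟩]

theorem ladder_mul_totalA_pow_single {i u : ZMod n} {s : ℕ} (h : height i u + s < n)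
    (y : AuslanderTaft k n) :
    ladder k u (y * totalA k n ^ s) (Finsupp.single (height i u, 0) 1) =
      ladder k u y (Finsupp.single (height (i - (s : ZMod n)) u, 0) 1) := by
  rw [map_mul, Module.End.mul_apply, map_pow, ladder_totalA, ladderA_pow_single h,
    height_sub_natCast_left h]

theorem ladder_monomial_single (i u : ZMod n) (s t : ℕ) :
    ladder k u (monomial k i u s t) (Finsupp.single (height i u, 0) 1) =
      if t ≤ height i u + s ∧ height i u + s < n then
        ((-1 : k) ^ (height i u + s)) ^ t • Finsupp.single (height i u + s, t) 1 else 0 := by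
  split_ifs with h
  · rw [monomial, ← mul_assoc, ladder_mul_vert_single, ladder_mul_totalA_pow_single h.2, map_pow,
      ladder_totalB, height_sub_natCast_left h.2, ladderB_pow_single h.1 h.2]
  · rw [monomial_eq_zero k h, map_zero, LinearMap.zero_apply]

/-- The coefficient of `monomial k i u s t`, up to a sign. -/
noncomputable def monomialCoeff (i u : ZMod n) (s t : ℕ) : AuslanderTaft k n →ₗ[k] k :=
  Finsupp.lapply (height i u + s, t) ∘ₗ
    LinearMap.applyₗ (Finsupp.single (height i u, 0) 1) ∘ₗ (ladder k u).toLinearMap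

theorem isUnit_monomialCoeff_self {i u : ZMod n} {s t : ℕ}
    (h : t ≤ height i u + s ∧ height i u + s < n) :
    IsUnit (monomialCoeff i u s t (monomial k i u s t)) := by
  have h' := ladder_monomial_single (k := k) i u s t
  rw [if_pos h] at h'
  have sign_isUnit : IsUnit (((-1 : k) ^ (height i u + s)) ^ t) := (isUnit_one.neg.pow _).pow _
  simpa [monomialCoeff, h'] using sign_isUnit

theorem monomialCoeff_of_ne {i u : ZMod n} {s t s' t' : ℕ} (h : (s', t') ≠ (s, t)) :
    monomialCoeff i u s t (monomial k i u s' t') = 0 := by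
  have h' := ladder_monomial_single (k := k) i u s' t'
  have hne : (height i u + s, t) ≠ (height i u + s', t') := fun e =>
    h (by rw [Prod.mk.injEq] at e ⊢; omega)
  rw [monomialCoeff, LinearMap.comp_apply, LinearMap.comp_apply, LinearMap.applyₗ_apply_apply,
    AlgHom.toLinearMap_apply, h', Finsupp.lapply_apply]
  split_ifs
  · rw [Finsupp.smul_apply, Finsupp.single_eq_of_ne hne, smul_zero]
  · rfl

theorem eq_zero_of_ladder_eq_zero {i u : ZMod n} {x : AuslanderTaft k n}
    (hx : x * vert k n i u = x)
    (h : ladder k u x (Finsupp.single (height i u, 0) 1) = 0) : x = 0 := by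
  have hx_span := mul_vert_mem_span_monomial k i u x
  rw [hx] at hx_span
  obtain ⟨c, rfl⟩ := Finsupp.mem_span_range_iff_exists_finsupp.1 hx_span
  refine Finset.sum_eq_zero fun st _ => ?_
  dsimp only
  by_cases hst : st.2 ≤ height i u + st.1 ∧ height i u + st.1 < n
  · have coeff_eq_zero : monomialCoeff i u st.1 st.2
        (c.sum fun st a => a • monomial k i u st.1 st.2) = 0 := DFunLike.congr_fun h _
    rw [Finsupp.sum, map_sum, Finset.sum_eq_single st, map_smul, smul_eq_mul,
      (isUnit_monomialCoeff_self hst).mul_left_eq_zero] at coeff_eq_zero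
    · rw [coeff_eq_zero, zero_smul]
    · intro st' _ hne
      rw [map_smul, monomialCoeff_of_ne hne, smul_zero]
    · intro hc
      rw [Finsupp.notMem_support_iff.1 hc, zero_smul, map_zero]
  · rw [monomial_eq_zero k hst, smul_zero]

theorem eq_zero_of_mul_totalA_pow_eq_zero {i u : ZMod n} {s : ℕ} (hs : height i u + s < n)
    {x : AuslanderTaft k n} (hx : x * vert k n (i - s) u = x)
    (h : x * (totalA k n ^ s * vert k n i u) = 0) : x = 0 := by
  refine eq_zero_of_ladder_eq_zero hx ?_
  rw [← ladder_mul_totalA_pow_single hs, ← ladder_mul_vert_single, mul_assoc, h, map_zero,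
    LinearMap.zero_apply]

end Ladder

section MonomialBasis

variable (k : Type*) [CommRing k] {n : ℕ} [NeZero n]

theorem span_monomial : Submodule.span k (Set.range
    fun c : (ZMod n × ZMod n) × ℕ × ℕ => monomial k c.1.1 c.1.2 c.2.1 c.2.2) = ⊤ := by
  refine (Submodule.eq_top_iff').2 fun x => ?_
  rw [← mul_one x, ← sum_vert k, Finset.mul_sum]
  refine sum_mem fun y _ => Submodule.span_mono ?_ (mul_vert_mem_span_monomial k y.1 y.2 x)
  rintro _ ⟨st, rfl⟩
  exact ⟨(y, st), rfl⟩

variable (n) in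
/-- The quadruples `(i, u, s, t)` for which the path `b^t a^s` starting at `(i, u)` does not leave
the quiver. -/
abbrev MonomialIndex : Type :=
  {c : (ZMod n × ZMod n) × ℕ × ℕ //
    c.2.2 ≤ height c.1.1 c.1.2 + c.2.1 ∧ height c.1.1 c.1.2 + c.2.1 < n}

theorem linearIndependent_monomial : LinearIndependent k
    fun c : MonomialIndex n => monomial k c.1.1.1 c.1.1.2 c.1.2.1 c.1.2.2 := by
  refine linearIndependent_iff'.2 fun S g hg c hc => ?_
  have coeff_eq_zero := congrArg (fun x => monomialCoeff c.1.1.1 c.1.1.2 c.1.2.1 c.1.2.2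
    (x * vert k n c.1.1.1 c.1.1.2)) hg
  simp only [Finset.sum_mul, smul_mul_assoc, monomial_mul_vert, map_sum, map_smul, zero_mul,
    map_zero] at coeff_eq_zero
  rwa [Finset.sum_eq_single_of_mem c hc, if_pos ⟨rfl, rfl⟩, smul_eq_mul,
    (isUnit_monomialCoeff_self c.2).mul_left_eq_zero] at coeff_eq_zero
  rintro ⟨⟨⟨i, u⟩, s, t⟩, hd⟩ _ hne
  split_ifs with h
  · obtain ⟨rfl, rfl⟩ := h
    rw [monomialCoeff_of_ne fun e => hne (Subtype.ext (Prod.ext rfl e)), smul_zero]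
  · rw [map_zero, smul_zero]

theorem top_le_span_monomialIndex : ⊤ ≤ Submodule.span k (Set.range
    fun c : MonomialIndex n => monomial k c.1.1.1 c.1.1.2 c.1.2.1 c.1.2.2) := by
  rw [← span_monomial k, Submodule.span_le]
  rintro _ ⟨c, rfl⟩
  by_cases hc : c.2.2 ≤ height c.1.1 c.1.2 + c.2.1 ∧ height c.1.1 c.1.2 + c.2.1 < n
  · exact Submodule.subset_span ⟨⟨c, hc⟩, rfl⟩
  · simp only [SetLike.mem_coe, monomial_eq_zero k hc, zero_mem]

instance : Module.Free k (AuslanderTaft k n) :=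
  .of_basis (.mk (linearIndependent_monomial k) (top_le_span_monomialIndex k))

end MonomialBasis

/-! ### The filtration by powers of the arrows `a` -/

section Filtration

variable (k : Type*) [CommRing k] {n : ℕ} [NeZero n]

/-- The triples `(i, u, s)` for which the path `a^s` starting at `(i, u)` is not zero. -/
def powerIndices (n : ℕ) [NeZero n] : Finset (ZMod n × ZMod n × ℕ) :=
  {c ∈ Finset.univ ×ˢ Finset.univ ×ˢ Finset.range n | height c.1 c.2.1 + c.2.2 < n}

theorem mem_powerIndices {i u : ZMod n} {s : ℕ} :
    (i, u, s) ∈ powerIndices n ↔ height i u + s < n := by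
  simp only [powerIndices, Finset.mem_filter, Finset.mem_product, Finset.mem_univ, true_and,
    Finset.mem_range, and_iff_right_iff_imp]
  omega

/-- Multiplication by an arrow on the right raises the weight of a power of `totalA`. -/
def weight (c : ZMod n × ZMod n × ℕ) : ℕ := height c.1 c.2.1 + 2 * c.2.2

/-- The path `a^s` starting at `(i, u)`. -/
noncomputable def aPow (c : ZMod n × ZMod n × ℕ) : AuslanderTaft k n :=
  totalA k n ^ c.2.2 * vert k n c.1 c.2.1

variable {k} in
theorem aPow_eq_zero {c : ZMod n × ZMod n × ℕ} (h : c ∉ powerIndices n) : aPow k c = 0 :=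
  totalA_pow_mul_vert_eq_zero k (not_lt.1 (mt mem_powerIndices.2 h))

theorem aPow_mul_vert (i u j w : ZMod n) (s : ℕ) :
    aPow k (i, u, s) * vert k n j w = if i = j ∧ u = w then aPow k (i, u, s) else 0 := by
  rw [aPow, mul_assoc]
  split_ifs with h
  · rw [← h.1, ← h.2, vert_mul_self]
  · rw [vert_mul_of_ne k h, mul_zero]

theorem aPow_mul_totalA (i u : ZMod n) (s : ℕ) :
    aPow k (i, u, s) * totalA k n = aPow k (i + 1, u, s + 1) := by
  have h := totalA_mul_vert k (i + 1) u
  rw [add_sub_cancel_right] at h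
  rw [aPow, aPow, mul_assoc, ← h, ← mul_assoc, pow_succ]

theorem totalA_mul_aPow (i u : ZMod n) (s : ℕ) :
    totalA k n * aPow k (i, u, s) = aPow k (i, u, s + 1) := by
  rw [aPow, aPow, ← mul_assoc, pow_succ']

theorem exists_aPow_mul_totalB (i u : ZMod n) (s : ℕ) :
    ∃ y, aPow k (i, u, s) * totalB k n = y * aPow k (i, u + 1, s) := by
  have h := totalB_mul_vert k i (u + 1)
  rw [add_sub_cancel_right] at h
  obtain ⟨y, hy⟩ := exists_totalA_pow_mul_totalB k i (u + 1) s
  exact ⟨y, by rw [aPow, aPow, mul_assoc, ← h, hy]⟩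

theorem weight_lt_aPow_mul_totalA {i u : ZMod n} {s : ℕ}
    (h : (i + 1, u, s + 1) ∈ powerIndices n) : weight (i, u, s) < weight (i + 1, u, s + 1) := by
  rw [mem_powerIndices] at h
  have hu : u ≠ i := by
    rintro rfl
    have cast_eq : ((height (u + 1) u + 1 : ℕ) : ZMod n) = 0 := by
      rw [Nat.cast_add, natCast_height, Nat.cast_one]
      ring
    have := Nat.le_of_dvd (Nat.succ_pos _) ((ZMod.natCast_eq_zero_iff _ _).1 cast_eq)
    omega
  have := height_sub_one_left (i := i + 1) (u := u) (by rwa [add_sub_cancel_right])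
  rw [add_sub_cancel_right] at this
  simp only [weight]
  omega

/-- The left ideal generated by the powers of `totalA` with indices in `S`. -/
noncomputable def powerIdeal (S : Finset (ZMod n × ZMod n × ℕ)) : Submodule k (AuslanderTaft k n) :=
  (Ideal.span (aPow k '' S)).restrictScalars k

/-- The finite set `S` contains all indices whose weight exceeds `N`. -/
def ContainsAbove (S : Finset (ZMod n × ZMod n × ℕ)) (N : ℕ) : Prop :=
  ∀ d ∈ powerIndices n, N < weight d → d ∈ S

variable {k} {S : Finset (ZMod n × ZMod n × ℕ)}

theorem aPow_mem_powerIdeal {c : ZMod n × ZMod n × ℕ} (hc : c ∈ powerIndices n → c ∈ S) :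
    aPow k c ∈ powerIdeal k S := by
  by_cases h : c ∈ powerIndices n
  · exact Ideal.subset_span ⟨c, hc h, rfl⟩
  · rw [aPow_eq_zero h]
    exact zero_mem _

theorem mul_mem_powerIdeal (x : AuslanderTaft k n) {y : AuslanderTaft k n}
    (hy : y ∈ powerIdeal k S) : x * y ∈ powerIdeal k S :=
  Ideal.mul_mem_left _ x hy

theorem aPow_mul_totalA_mem {c : ZMod n × ZMod n × ℕ} (hS : ContainsAbove S (weight c)) :
    aPow k c * totalA k n ∈ powerIdeal k S := by
  obtain ⟨i, u, s⟩ := c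
  rw [aPow_mul_totalA]
  exact aPow_mem_powerIdeal fun h => hS _ h (weight_lt_aPow_mul_totalA h)

theorem aPow_mul_totalB_mem {c : ZMod n × ZMod n × ℕ} (hS : ContainsAbove S (weight c)) :
    aPow k c * totalB k n ∈ powerIdeal k S := by
  obtain ⟨i, u, s⟩ := c
  by_cases hu : u + 1 = i
  · have h := totalB_mul_vert k i (u + 1)
    rw [add_sub_cancel_right, hu, totalB_mul_vert_self] at h
    rw [aPow, mul_assoc, ← h, mul_zero]
    exact zero_mem _
  · obtain ⟨y, hy⟩ := exists_aPow_mul_totalB k i u s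
    rw [hy]
    refine mul_mem_powerIdeal y (aPow_mem_powerIdeal fun h => hS _ h ?_)
    have := height_sub_one_right hu
    rw [add_sub_cancel_right] at this
    simp only [weight]
    omega

open BimoduleAction in
theorem isInvariant_powerIdeal (hS : ∀ c ∈ S, ContainsAbove S (weight c)) :
    (self k (AuslanderTaft k n)).IsInvariant (powerIdeal k S) where
  left_mem x _ hy := mul_mem_powerIdeal x hy
  right_mem x := by
    have of_generators (r : AuslanderTaft k n) (hr : ∀ c ∈ S, aPow k c * r ∈ powerIdeal k S) :
        ∀ y ∈ powerIdeal k S, y * r ∈ powerIdeal k S := by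
      intro y hy
      induction hy using Submodule.span_induction with
      | mem y hy =>
        obtain ⟨c, hc, rfl⟩ := hy
        exact hr c hc
      | zero => rw [zero_mul]; exact zero_mem _
      | add y z _ _ hy hz => rw [add_mul]; exact add_mem hy hz
      | smul a y _ hy => rw [smul_mul_assoc]; exact mul_mem_powerIdeal a hy
    simp only [self_right]
    induction x using generators_induction with
    | add r s hr hs => exact fun y hy => by rw [mul_add]; exact add_mem (hr y hy) (hs y hy)
    | smul c r hr => exact fun y hy => by rw [mul_smul_comm]; exact Submodule.smul_mem _ c (hr y hy)
    | mul r s hr hs => exact fun y hy => by rw [← mul_assoc]; exact hs _ (hr y hy)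
    | vert j w =>
      rintro y hy
      refine of_generators _ (fun c hc => ?_) y hy
      rw [aPow_mul_vert]
      split_ifs
      · exact aPow_mem_powerIdeal fun _ => hc
      · exact zero_mem _
    | a => exact of_generators _ fun c hc => aPow_mul_totalA_mem (hS c hc)
    | b => exact of_generators _ fun c hc => aPow_mul_totalB_mem (hS c hc)

theorem aPow_mul_sub_smul_mem (hS : ∀ c ∈ S, ContainsAbove S (weight c)) {i u : ZMod n} {s : ℕ}
    (hc : ContainsAbove S (weight (i, u, s))) (r : AuslanderTaft k n) :
    aPow k (i, u, s) * r - vertexCharacter k n i u r • aPow k (i, u, s) ∈ powerIdeal k S := by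
  induction r using generators_induction with
  | add r t hr ht =>
    convert add_mem hr ht using 1
    rw [mul_add, map_add, add_smul]
    abel
  | smul c r hr =>
    convert Submodule.smul_mem _ c hr using 1
    rw [mul_smul_comm, map_smul, smul_sub, smul_assoc]
  | mul r t hr ht =>
    convert add_mem ((isInvariant_powerIdeal hS).right_mem t _ hr)
      (Submodule.smul_mem _ (vertexCharacter k n i u r) ht) using 1
    rw [BimoduleAction.self_right, map_mul, sub_mul, smul_mul_assoc, smul_sub, smul_smul, mul_assoc]
    abel
  | vert j w =>
    rw [aPow_mul_vert, vertexCharacter_vert]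
    split_ifs <;> simp
  | a =>
    rw [vertexCharacter_totalA, zero_smul, sub_zero]
    exact aPow_mul_totalA_mem hc
  | b =>
    rw [vertexCharacter_totalB, zero_smul, sub_zero]
    exact aPow_mul_totalB_mem hc

theorem exists_mul_vert_eq_mul_aPow (hS : ∀ c ∈ S, ContainsAbove S (weight c)) {i u : ZMod n}
    {s : ℕ} (hc : (i, u, s) ∈ powerIndices n) (hcS : (i, u, s) ∉ S) {z : AuslanderTaft k n}
    (hz : z ∈ powerIdeal k S) : ∃ y, z * vert k n i u = y * aPow k (i, u, s + 1) := by
  induction hz using Submodule.span_induction with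
  | mem z hz =>
    obtain ⟨⟨j, w, t⟩, hd, rfl⟩ := hz
    rw [aPow_mul_vert]
    split_ifs with h
    · obtain ⟨rfl, rfl⟩ := h
      have ht : s < t := by
        by_contra! hts
        have hne : t ≠ s := fun e => hcS (e ▸ hd)
        exact hcS (hS _ hd _ hc (by simp only [weight]; omega))
      refine ⟨totalA k n ^ (t - (s + 1)), ?_⟩
      rw [aPow, aPow, ← mul_assoc, ← pow_add, Nat.sub_add_cancel ht]
    · exact ⟨0, (zero_mul _).symm⟩
  | zero => exact ⟨0, by rw [zero_mul, zero_mul]⟩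
  | add y z _ _ hy hz =>
    obtain ⟨⟨y', hy⟩, z', hz⟩ := hy, hz
    exact ⟨y' + z', by rw [add_mul, add_mul, hy, hz]⟩
  | smul a y _ hy =>
    obtain ⟨y', hy⟩ := hy
    exact ⟨a * y', by rw [smul_eq_mul, mul_assoc, mul_assoc, hy]⟩

theorem mem_powerIdeal_insert {c : ZMod n × ZMod n × ℕ} {y : AuslanderTaft k n} :
    y ∈ powerIdeal k (insert c S) ↔ ∃ x, y - x * aPow k c ∈ powerIdeal k S := by
  rw [powerIdeal, Submodule.restrictScalars_mem, Finset.coe_insert, Set.image_insert_eq]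
  refine Submodule.mem_span_insert.trans (exists_congr fun x => ?_)
  constructor
  · rintro ⟨z, hz, rfl⟩
    rwa [smul_eq_mul, add_sub_cancel_left]
  · exact fun h => ⟨_, h, (add_sub_cancel _ _).symm⟩

variable (k) in
theorem exists_idempotent_totalA_injective (i u : ZMod n) :
    ∃ p : AuslanderTaft k n, IsIdempotentElem p ∧
      p * (totalA k n * vert k n i u) = totalA k n * vert k n i u ∧
      (∀ x, x * p = x → x * (totalA k n * vert k n i u) = 0 → x = 0) ∧
      ∀ j, height j u ≤ height i u → vertexCharacter k n j u p = 0 := by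
  by_cases h : u = i - 1
  · refine ⟨0, mul_zero 0, ?_, fun x hx _ => by rw [← hx, mul_zero], fun j _ => map_zero _⟩
    rw [totalA_mul_vert_eq_zero k h, mul_zero]
  · refine ⟨vert k n (i - 1) u, vert_mul_self k _ _, ?_, fun x hx hxα => ?_, fun j hj => ?_⟩
    · rw [totalA_mul_vert, ← mul_assoc, vert_mul_self]
    · exact eq_zero_of_mul_totalA_pow_eq_zero (height_add_one_lt h) (by rwa [Nat.cast_one])
        (by rwa [pow_one])
    · rw [vertexCharacter_vert, if_neg]
      rintro ⟨rfl, -⟩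
      rw [height_sub_one_left h] at hj
      omega

theorem mul_aPow_mem_powerIdeal_iff (hS : ∀ c ∈ S, ContainsAbove S (weight c)) {i u : ZMod n}
    {s : ℕ} (hc : (i, u, s) ∈ powerIndices n) (hcS : (i, u, s) ∉ S)
    (hcU : ContainsAbove S (weight (i, u, s))) {x : AuslanderTaft k n}
    (hx : x * vert k n (i - s) u = x) : x * aPow k (i, u, s) ∈ powerIdeal k S ↔
      ∃ y, y * (totalA k n * vert k n (i - s) u) = x := by
  have step_mul : totalA k n * vert k n (i - s) u * aPow k (i, u, s) = aPow k (i, u, s + 1) := by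
    rw [← totalA_mul_aPow, aPow, totalA_pow_mul_vert, mul_assoc, ← mul_assoc (vert k n (i - s) u),
      vert_mul_self]
  constructor
  · intro h
    obtain ⟨y, hy⟩ := exists_mul_vert_eq_mul_aPow hS hc hcS h
    rw [mul_assoc, aPow_mul_vert, if_pos ⟨rfl, rfl⟩, ← step_mul, ← mul_assoc] at hy
    refine ⟨y, (sub_eq_zero.1 ?_).symm⟩
    refine eq_zero_of_mul_totalA_pow_eq_zero (mem_powerIndices.1 hc) ?_ ?_
    · rw [sub_mul, hx, mul_assoc, mul_assoc, vert_mul_self]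
    · rw [sub_mul]
      exact sub_eq_zero.2 hy
  · rintro ⟨y, rfl⟩
    rw [mul_assoc, step_mul]
    refine mul_mem_powerIdeal y (aPow_mem_powerIdeal fun h => hcU _ h ?_)
    simp only [weight]
    omega

end Filtration

section Acyclicity

open BimoduleAction CoeffChains

variable (k : Type*) [CommRing k] {n : ℕ} [NeZero n]

theorem powerIdeal_empty : powerIdeal k (∅ : Finset (ZMod n × ZMod n × ℕ)) = ⊥ := by
  rw [powerIdeal, Finset.coe_empty, Set.image_empty, Ideal.span_empty,
    Submodule.restrictScalars_bot]

theorem powerIdeal_powerIndices : powerIdeal k (powerIndices n) = ⊤ := by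
  refine (Submodule.eq_top_iff').2 fun x => ?_
  rw [← mul_one x, ← sum_vert k]
  refine mul_mem_powerIdeal x (sum_mem fun y _ => ?_)
  have h : aPow k (y.1, y.2, 0) ∈ powerIdeal k (powerIndices n) := aPow_mem_powerIdeal id
  rwa [aPow, pow_zero, one_mul] at h

variable {k}

theorem acyclic_quotient_powerIdeal_of_insert {S : Finset (ZMod n × ZMod n × ℕ)}
    {c : ZMod n × ZMod n × ℕ} (hS : ∀ d ∈ S, ContainsAbove S (weight d))
    (hc : c ∈ powerIndices n) (hcS : c ∉ S) (hcU : ContainsAbove S (weight c))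
    (hSc : ∀ d ∈ insert c S, ContainsAbove (insert c S) (weight d)) {m : ℕ}
    (h : Acyclic ((self k _).quotient (isInvariant_powerIdeal (k := k) hSc)) (m + 1)) :
    Acyclic ((self k _).quotient (isInvariant_powerIdeal (k := k) hS)) (m + 1) := by
  obtain ⟨i, u, s⟩ := c
  obtain ⟨p, hp, hpα, α_injective, hχp⟩ := exists_idempotent_totalA_injective k (i - (s : ZMod n)) u
  refine acyclic_quotient_of_generator (χ := vertexCharacter k n i u) (p := vert k n (i - s) u)
    (p' := p) (α := totalA k n * vert k n (i - s) u) (v := aPow k (i, u, s)) _ _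
    (vert_mul_self k _ _) hp (hχp i ?_) ?_ ?_ (aPow_mul_sub_smul_mem hS hcU)
    (fun _ => mem_powerIdeal_insert) α_injective (fun x hx => ?_) h
  · rw [height_sub_natCast_left (mem_powerIndices.1 hc)]
    omega
  · rw [mul_assoc, vert_mul_self]
  · rw [aPow, totalA_pow_mul_vert, ← mul_assoc, vert_mul_self]
  · rw [mul_aPow_mem_powerIdeal_iff hS hc hcS hcU hx]
    constructor
    · rintro ⟨y, rfl⟩
      exact ⟨y * p, by rw [mul_assoc, hp], by rw [mul_assoc, hpα]⟩
    · rintro ⟨y, -, rfl⟩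
      exact ⟨y, rfl⟩

theorem acyclic_quotient_powerIdeal {S : Finset (ZMod n × ZMod n × ℕ)} (hSn : S ⊆ powerIndices n)
    (hS : ∀ c ∈ S, ContainsAbove S (weight c)) (m : ℕ) :
    Acyclic ((self k _).quotient (isInvariant_powerIdeal (k := k) hS)) (m + 1) := by
  induction hN : (powerIndices n \ S).card generalizing S with
  | zero =>
    obtain rfl : S = powerIndices n :=
      hSn.antisymm (Finset.sdiff_eq_empty_iff_subset.1 (Finset.card_eq_zero.1 hN))
    have : Subsingleton (AuslanderTaft k n ⧸ powerIdeal k (powerIndices n)) :=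
      Submodule.Quotient.subsingleton_iff.2 (powerIdeal_powerIndices k)
    exact .of_subsingleton _ _
  | succ N ih =>
    obtain ⟨c, hc, hc_max⟩ := (powerIndices n \ S).exists_max_image weight
      (Finset.card_pos.1 (hN ▸ N.succ_pos))
    rw [Finset.mem_sdiff] at hc
    have hcU : ContainsAbove S (weight c) := fun d hd hcd => by
      by_contra hdS
      exact (hc_max d (Finset.mem_sdiff.2 ⟨hd, hdS⟩)).not_gt hcd
    have hSc : ∀ d ∈ insert c S, ContainsAbove (insert c S) (weight d) := fun d hd e he hde =>
      Finset.mem_insert_of_mem <| by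
        obtain rfl | hd := Finset.mem_insert.1 hd
        · exact hcU e he hde
        · exact hS d hd e he hde
    refine acyclic_quotient_powerIdeal_of_insert hS hc.1 hc.2 hcU hSc
      (ih (Finset.insert_subset hc.1 hSn) hSc ?_)
    rw [Finset.sdiff_insert, Finset.card_erase_of_mem (Finset.mem_sdiff.2 hc), hN,
      Nat.add_sub_cancel]

theorem acyclic_self (m : ℕ) : Acyclic (self k (AuslanderTaft k n)) (m + 1) := by
  have hS : ∀ c ∈ (∅ : Finset (ZMod n × ZMod n × ℕ)), ContainsAbove (n := n) ∅ (weight c) :=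
    fun _ hc => absurd hc (Finset.notMem_empty _)
  refine .of_isHom_bijective (f := (powerIdeal k ∅).mkQ) ⟨fun _ _ => rfl, fun _ _ => rfl⟩ ?_
    (acyclic_quotient_powerIdeal (Finset.empty_subset _) hS m)
  refine ⟨LinearMap.ker_eq_bot.1 ?_, Submodule.mkQ_surjective _⟩
  rw [Submodule.ker_mkQ, powerIdeal_empty]

end Acyclicity

/-! ### Hochschild homology in degree zero -/

section Vertices

theorem card_vertex (n : ℕ) : Nat.card (Vertex n) = n ^ 2 := by
  rw [Vertex, Nat.card_prod, Nat.card_zmod, sq]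

variable (k : Type*) [CommRing k] {n : ℕ} [NeZero n]

theorem linearIndependent_hochschildClassZero : LinearIndependent k fun x : Vertex n =>
    hochschildClassZero k (AuslanderTaft k n) (vertexIdem k n x) := by
  obtain ⟨g, hg⟩ := exists_comp_hochschildZeroMk_eq (augmentation k n).toLinearMap fun x a => by
    simp only [AlgHom.toLinearMap_apply, map_mul, mul_comm]
  have g_vertex : (g ∘ fun x => hochschildClassZero k _ (vertexIdem k n x)) =
      Pi.basisFun k (Vertex n) := funext fun x => by
    rw [Pi.basisFun_apply, ← augmentation_vertexIdem, Function.comp_apply, ← hochschildZeroMk_apply]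
    exact LinearMap.congr_fun hg _
  refine LinearIndependent.of_comp g ?_
  rw [g_vertex]
  exact (Pi.basisFun k (Vertex n)).linearIndependent

theorem vert_mul_monomial (i u : ZMod n) (s t : ℕ) :
    vert k n (i - s) (u - t) * monomial k i u s t = monomial k i u s t := by
  rw [monomial, totalA_pow_mul_vert, ← mul_assoc (totalB k n ^ t), totalB_pow_mul_vert,
    ← mul_assoc, ← mul_assoc, vert_mul_self]

theorem monomial_zero_zero (i u : ZMod n) : monomial k i u 0 0 = vert k n i u := by
  rw [monomial, pow_zero, pow_zero, one_mul, one_mul]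

theorem hochschildZeroMk_monomial_eq_zero {s t : ℕ} (hs : s < n) (ht : t < n)
    (h : (s, t) ≠ (0, 0)) (i u : ZMod n) :
    hochschildZeroMk k (AuslanderTaft k n) (monomial k i u s t) = 0 := by
  rw [← vert_mul_monomial, hochschildZeroMk_mul_comm, monomial_mul_vert, if_neg, map_zero]
  rw [eq_comm (a := i), sub_eq_self, eq_comm (a := u), sub_eq_self, ZMod.natCast_eq_zero_iff,
    ZMod.natCast_eq_zero_iff]
  exact fun ⟨hs', ht'⟩ => h (Prod.ext (Nat.eq_zero_of_dvd_of_lt hs' hs)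
    (Nat.eq_zero_of_dvd_of_lt ht' ht))

theorem top_le_span_hochschildClassZero : ⊤ ≤ Submodule.span k (Set.range fun x : Vertex n =>
    hochschildClassZero k (AuslanderTaft k n) (vertexIdem k n x)) := by
  suffices h : Submodule.span k (Set.range
      fun c : (ZMod n × ZMod n) × ℕ × ℕ => monomial k c.1.1 c.1.2 c.2.1 c.2.2) ≤
      Submodule.comap (hochschildZeroMk k (AuslanderTaft k n)) (Submodule.span k (Set.range
        fun x : Vertex n => hochschildClassZero k (AuslanderTaft k n) (vertexIdem k n x))) by
    intro c _
    obtain ⟨x, rfl⟩ := hochschildZeroMk_surjective k _ c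
    exact h (span_monomial k (n := n) ▸ Submodule.mem_top)
  refine Submodule.span_le.2 ?_
  rintro _ ⟨⟨⟨i, u⟩, s, t⟩, rfl⟩
  rw [SetLike.mem_coe, Submodule.mem_comap]
  dsimp only
  by_cases in_quiver : t ≤ height i u + s ∧ height i u + s < n
  · by_cases is_vertex : (s, t) = (0, 0)
    · obtain ⟨rfl, rfl⟩ := Prod.mk.inj is_vertex
      rw [monomial_zero_zero, hochschildZeroMk_apply]
      exact Submodule.subset_span ⟨(i, u), rfl⟩
    · rw [hochschildZeroMk_monomial_eq_zero k (by omega) (by omega) is_vertex]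
      exact zero_mem _
  · rw [monomial_eq_zero k in_quiver, map_zero]
    exact zero_mem _

/-- The basis of `HH_0` formed by the classes of the vertices. -/
noncomputable def hochschildZeroBasis :
    Module.Basis (Vertex n) k (HochschildHomology k (AuslanderTaft k n) 0) :=
  .mk (linearIndependent_hochschildClassZero k) (top_le_span_hochschildClassZero k)

/-- The functions on the vertices, in coordinates. -/
noncomputable def vertexFinsuppEquiv : (Vertex n →₀ k) ≃ₗ[k] (Fin (n ^ 2) → k) :=
  Finsupp.linearEquivFunOnFinite k k (Vertex n) ≪≫ₗ
    LinearEquiv.funCongrLeft k k (Finite.equivFinOfCardEq (card_vertex n)).symm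

end Vertices

end TaftAuslander

open TaftAuslander in
theorem mainTheorem1_general (k : Type*) [CommRing k] (n : ℕ) [NeZero n] :
    (∃ B : Module.Basis (Vertex n) k (HochschildHomology k (AuslanderTaft k n) 0),
      ∀ x, B x = hochschildClassZero k (AuslanderTaft k n) (vertexIdem k n x)) ∧
    Nonempty (HochschildHomology k (AuslanderTaft k n) 0 ≃ₗ[k] (Fin (n ^ 2) → k)) ∧
    (∀ p : ℕ, 0 < p → Subsingleton (HochschildHomology k (AuslanderTaft k n) p)) ∧
    (∀ p : ℕ,
      Nonempty (CyclicHomology k (AuslanderTaft k n) (2 * p) ≃ₗ[k] (Vertex n →₀ k)) ∧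
      Nonempty (CyclicHomology k (AuslanderTaft k n) (2 * p) ≃ₗ[k] (Fin (n ^ 2) → k)) ∧
      Subsingleton (CyclicHomology k (AuslanderTaft k n) (2 * p + 1))) := by
  have acyclic := acyclic_self (k := k) (n := n)
  have hochschild_zero := (hochschildZeroBasis k (n := n)).repr
  refine ⟨⟨hochschildZeroBasis k, Module.Basis.mk_apply _ _⟩,
    ⟨hochschild_zero ≪≫ₗ vertexFinsuppEquiv k⟩, fun p hp => ?_, fun p => ?_⟩
  · obtain ⟨m, rfl⟩ := Nat.exists_eq_succ_of_ne_zero hp.ne'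
    exact subsingleton_hochschildHomology (acyclic m)
  · obtain ⟨periodicity⟩ := nonempty_cyclicHomology_even_equiv acyclic p
    have cyclic_even := periodicity ≪≫ₗ cyclicHomologyZeroEquiv k _ ≪≫ₗ hochschild_zero
    exact ⟨⟨cyclic_even⟩, ⟨cyclic_even ≪≫ₗ vertexFinsuppEquiv k⟩,
      subsingleton_cyclicHomology_odd acyclic p⟩

/-- Hochschild and cyclic homology of the Auslander algebra of the Taft algebra. -/
theorem mainTheorem1 (k : Type*) [Field k] [IsAlgClosed k] (n : ℕ) [NeZero n] (hn : 2 ≤ n) :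
    (∃ B : Module.Basis (TaftAuslander.Vertex n) k
        (TaftAuslander.HochschildHomology k (TaftAuslander.AuslanderTaft k n) 0),
      ∀ x, B x = TaftAuslander.hochschildClassZero k (TaftAuslander.AuslanderTaft k n)
        (TaftAuslander.vertexIdem k n x)) ∧
    Nonempty (TaftAuslander.HochschildHomology k (TaftAuslander.AuslanderTaft k n) 0
      ≃ₗ[k] (Fin (n ^ 2) → k)) ∧
    (∀ p : ℕ, 0 < p →
      Subsingleton (TaftAuslander.HochschildHomology k (TaftAuslander.AuslanderTaft k n) p)) ∧
    (∀ p : ℕ,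
      Nonempty (TaftAuslander.CyclicHomology k (TaftAuslander.AuslanderTaft k n) (2 * p)
        ≃ₗ[k] (TaftAuslander.Vertex n →₀ k)) ∧
      Nonempty (TaftAuslander.CyclicHomology k (TaftAuslander.AuslanderTaft k n) (2 * p)
        ≃ₗ[k] (Fin (n ^ 2) → k)) ∧
      Subsingleton
        (TaftAuslander.CyclicHomology k (TaftAuslander.AuslanderTaft k n) (2 * p + 1))) :=
  mainTheorem1_general k n
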